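/- Notation. Let $\Lambda$ be the ring of symmetric functions in $x_1,x_2,\dots$ over $\mathbb{C}$, with power sums $p_k$, complete homogeneous functions $h_k$ and elementary functions $e_k$. For a class function $f$ on $S_n$ let $\mathrm{ch}(f)=\frac1{n!}\sum_{w\in S_n} f(w)\,p_{\lambda(w)}$, where $\lambda(w)$ is the cycle type of $w$, be its Frobenius characteristic; $\mathrm{ch}$ is injective on class functions. For a partition $\mu$ of $n$, $\chi^\mu$ is the irreducible character of $S_n$ with $\mathrm{ch}(\chi^\mu)=s_\mu=\det(h_{\mu_i-i+j})$. Plethysm is denoted $f[g]$. For $j\ge 1$ let $\mathrm{Lie}_{(j)}$ be the character of $S_j$ induced from a linear character of the subgroup generated by a $j$-cycle $c$ that sends $c$ to a primitive $j$-th root of unity. Put $\ell_j=\mathrm{ch}(\mathrm{Lie}_{(j)})$ and $\pi_j=\mathrm{ch}(\epsilon_{S_j}\otimes \mathrm{Lie}_{(j)})$, where $\epsilon_{S_j}$ is the sign character. For a partition $\lambda=1^{m_1}2^{m_2}\cdots$ of $n$ let $\mathrm{Lie}_\lambda$ and $\mathrm{W}_\lambda$ be the characters of $S_n$ with $$\mathrm{ch}(\mathrm{Lie}_\lambda)=\prod_{j\ge1}h_{m_j}[\ell_j],\qquad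 \mathrm{ch}(\mathrm{W}_\lambda)=\prod_{j \text{ odd}}h_{m_j}[\pi_j]\prod_{j\text{ even}}e_{m_j}[\pi_j].$$ Let $\widehat{\mathrm{Lie}}^i_n=\sum_\lambda \mathrm{Lie}_\lambda$ and $\widehat{\mathrm{W}}^i_n=\sum_\lambda \mathrm{W}_\lambda$, both sums over the partitions $\lambda$ of $n$ with no part equal to $1$ and with rank $\sum_k(\lambda_k-1)=i$, and let $\widehat{\mathrm{Lie}}_n=\sum_{i\ge 0}\widehat{\mathrm{Lie}}^i_n$ and $\widehat{\mathrm{W}}_n=\sum_{i\ge 0}\widehat{\mathrm{W}}^i_n$. Let $Q$ be a standard Young tableau of size $n$, drawn with rows going down. Call $i$ an ascent of $Q$ if $i=n$, or if $1\le i<n$ and $i+1$ lies in a weakly higher row than $i$. $Q$ is a desarrangement tableau if its smallest ascent is even (so the empty tableau is one). $Q$ is Whitney-generating if either it is one of the three tableaux $\varnothing$, $12$, $12/3$ (rows separated by slashes), or $n\ge 4$ and its restriction to the entries $1,2,3,4$ is * $12/3/4$ or $124/3$; or * $12/34$, and the smallest ascent $k\ge 4$ of $Q$ is odd; or * $123/4$,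 and the smallest ascent $k\ge 4$ of $Q$ is even. **Theorem.** For every $n\ge 0$ one has the irreducible decompositions $$\widehat{\mathrm{Lie}}_n=\sum_Q\chi^{\mathrm{shape}(Q)},\qquad \widehat{\mathrm{W}}_n=\sum_Q\chi^{\mathrm{shape}(Q)},$$ where the first sum is over all desarrangement tableaux $Q$ of size $n$ and the second over all Whitney-generating tableaux $Q$ of size $n$. -/

import Mathlib

noncomputable section

namespace WhitneyTableaux

/-! ### Symmetric functions, as formal power series in `x_0, x_1, x_2, …` over `ℂ` -/

/-- The ring of formal power series in countably many variables, in which the symmetric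
functions live. -/
abbrev Series : Type := MvPowerSeries ℕ ℂ

open Classical in
/-- The power sum `p_k = ∑ i, x_i ^ k` (used for `k ≥ 1`). -/
def psum (k : ℕ) : Series := fun d => if ∃ i, d = Finsupp.single i k then 1 else 0

/-- The complete homogeneous symmetric function `h_r`, the sum of all monomials of degree `r`;
it is indexed by an integer, with `h_r = 0` for `r < 0`. -/
def hsymm (r : ℤ) : Series := fun d => if (d.degree : ℤ) = r then 1 else 0

open Classical in
/-- The elementary symmetric function `e_r`, the sum of all squarefree monomials of degree `r`. -/
def esymm (r : ℕ) : Series := fun d => if d.degree = r ∧ ∀ i, d i ≤ 1 then 1 else 0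

/-- The Schur function of the partition whose Ferrers diagram is `μ`, by the Jacobi-Trudi
determinant `det (h_{μ_i - i + j})`, whose size is the number of rows of `μ`. -/
def schur (μ : YoungDiagram) : Series :=
  Matrix.det (Matrix.of fun i j : Fin (μ.colLen 0) =>
    hsymm ((μ.rowLen i : ℤ) - (i : ℤ) + (j : ℤ)))

open Classical in
/-- The plethysm `f[g]`. The functions `p_1, p_2, …` are algebraically independent generators of
the algebra of symmetric functions over `ℂ`, so that a symmetric function `f` is
`F(p_1, p_2, …)` for a unique polynomial `F` (whose variable number `k` stands for `p_{k+1}`).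
The plethysm by `g` is the algebra homomorphism in `f` that sends `p_k` to
`p_k[g] = g(x_0 ^ k, x_1 ^ k, …)`, that is, it replaces the variables of `f` by the
monomials of `g`. (The value is `0` when `f` is not a symmetric function.) -/
def plethysm (f g : Series) : Series :=
  if h : ∃ F : MvPolynomial ℕ ℂ, MvPolynomial.aeval (fun k : ℕ => psum (k + 1)) F = f then
    MvPolynomial.aeval
      (fun k : ℕ => MvPowerSeries.expand (k + 1) (Nat.succ_ne_zero k) g) h.choose
  else 0

/-! ### Characters of finite groups and the Frobenius characteristic -/

/-- `f` is constant on conjugacy classes. -/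
def IsClassFunction {G : Type} [Group G] (f : G → ℂ) : Prop :=
  ∀ g h : G, f (h * g * h⁻¹) = f g

/-- `χ` is the character of an irreducible finite-dimensional complex representation of `G`. -/
def IsIrreducibleCharacter {G : Type} [Group G] (χ : G → ℂ) : Prop :=
  ∃ (d : ℕ) (ρ : Representation ℂ G (Fin d → ℂ)), ρ.IsIrreducible ∧ ρ.character = χ

open Classical in
/-- The induced character `ψ ↑_H^G`, namely
`g ↦ |H|⁻¹ ∑_{x ∈ G, x⁻¹ g x ∈ H} ψ (x⁻¹ g x)`. -/
def inducedCharacter {G : Type} [Group G] [Fintype G] (H : Subgroup G) (ψ : H → ℂ) (g : G) : ℂ :=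
  (Nat.card H : ℂ)⁻¹ * ∑ x : G, if h : x⁻¹ * g * x ∈ H then ψ ⟨x⁻¹ * g * x, h⟩ else 0

/-- The Frobenius characteristic `ch f = (n!)⁻¹ ∑_{w ∈ S_n} f(w) p_{λ(w)}`, where `λ(w)` is the
cycle type of `w`, fixed points included. -/
def ch (n : ℕ) (f : Equiv.Perm (Fin n) → ℂ) : Series :=
  ((n.factorial : ℂ)⁻¹) • ∑ w, f w • (w.partition.parts.map psum).prod

open Classical in
/-- The class function on `S_n` with Frobenius characteristic `F` (`ch` is injective on class
functions, and onto the symmetric functions over `ℂ` that are homogeneous of degree `n`;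
the value is `0` for other `F`). -/
def classFunctionOf (n : ℕ) (F : Series) : Equiv.Perm (Fin n) → ℂ :=
  if h : ∃ f : Equiv.Perm (Fin n) → ℂ, IsClassFunction f ∧ ch n f = F then h.choose else 0

open Classical in
/-- The irreducible character `χ^μ` of `S_n`, for a partition `μ` of `n`: the one whose Frobenius
characteristic is the Schur function of `μ`. (The value is `0` if `μ` is not of size `n`.) -/
def irreducibleCharacter (n : ℕ) (μ : YoungDiagram) : Equiv.Perm (Fin n) → ℂ :=
  if h : ∃ χ : Equiv.Perm (Fin n) → ℂ, IsIrreducibleCharacter χ ∧ ch n χ = schur μ then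
    h.choose
  else 0

/-! ### The characters `Lie_λ` and `W_λ` -/

/-- The complex number `exp(2πi/n)`, a primitive `n`-th root of unity for `n ≥ 1`. -/
def rootOfUnity (n : ℕ) : ℂˣ :=
  Units.mk0 (Complex.exp (2 * Real.pi * Complex.I / n)) (Complex.exp_ne_zero _)

/-- The cyclic subgroup `C_n` of `S_n` generated by the `n`-cycle `finRotate n`. -/
def cyclicSubgroup (n : ℕ) : Subgroup (Equiv.Perm (Fin n)) := Subgroup.zpowers (finRotate n)

/-- The chosen `n`-cycle, as an element of `C_n`. -/
def cyclicGenerator (n : ℕ) : cyclicSubgroup n := ⟨finRotate n, Subgroup.mem_zpowers _⟩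

theorem mem_zpowers_cyclicGenerator (n : ℕ) (x : cyclicSubgroup n) :
    x ∈ Subgroup.zpowers (cyclicGenerator n) := by
  obtain ⟨x, k, hk⟩ := x
  exact ⟨k, Subtype.ext hk⟩

theorem orderOf_rootOfUnity_dvd (n : ℕ) :
    orderOf (rootOfUnity n) ∣ orderOf (cyclicGenerator n) := by
  have h1 : orderOf (cyclicGenerator n) = orderOf (finRotate n) :=
    (Subgroup.orderOf_coe (cyclicGenerator n)).symm
  rw [h1]
  match n with
  | 0 =>
    have : rootOfUnity 0 = 1 := by ext; simp [rootOfUnity]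
    simp [this]
  | 1 =>
    have : rootOfUnity 1 = 1 := by ext; simp [rootOfUnity]
    simp [this]
  | n + 2 =>
    rw [isCycle_finRotate.orderOf, support_finRotate, Finset.card_univ, Fintype.card_fin]
    apply orderOf_dvd_of_pow_eq_one
    ext
    have h := (Complex.isPrimitiveRoot_exp (n + 2) (by omega)).pow_eq_one
    simpa [rootOfUnity] using h

/-- The linear character of `C_n` that sends the `n`-cycle to a primitive `n`-th root of unity. -/
def cyclicCharacter (n : ℕ) : cyclicSubgroup n →* ℂˣ :=
  monoidHomOfForallMemZpowers (mem_zpowers_cyclicGenerator n) (orderOf_rootOfUnity_dvd n)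

/-- The Lie character `Lie_(n)`, induced from the above linear character of `C_n`. -/
def lieCharacter (n : ℕ) : Equiv.Perm (Fin n) → ℂ :=
  inducedCharacter (cyclicSubgroup n) fun x => (cyclicCharacter n x : ℂ)

/-- `ℓ_n = ch(Lie_(n))`. -/
def ell (n : ℕ) : Series := ch n (lieCharacter n)

/-- `π_n = ch(ε ⊗ Lie_(n))`, where `ε` is the sign character. -/
def piSymm (n : ℕ) : Series :=
  ch n fun w => ((Equiv.Perm.sign w : ℤ) : ℂ) * lieCharacter n w

/-- The higher Lie character `Lie_λ` of `S_n`: its Frobenius characteristic is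
`∏_j h_{m_j}[ℓ_j]`, where `m_j` is the multiplicity of `j` in `λ`. -/
def lieChar {n : ℕ} (l : n.Partition) : Equiv.Perm (Fin n) → ℂ :=
  classFunctionOf n (∏ j ∈ Finset.Icc 1 n, plethysm (hsymm (l.parts.count j)) (ell j))

/-- The Whitney homology character `W_λ` of `S_n`: its Frobenius characteristic is
`∏_{j odd} h_{m_j}[π_j] ∏_{j even} e_{m_j}[π_j]`, where `m_j` is the multiplicity of `j`
in `λ`. -/
def whitneyChar {n : ℕ} (l : n.Partition) : Equiv.Perm (Fin n) → ℂ :=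
  classFunctionOf n
    ((∏ j ∈ (Finset.Icc 1 n).filter Odd, plethysm (hsymm (l.parts.count j)) (piSymm j)) *
      ∏ j ∈ (Finset.Icc 1 n).filter Even, plethysm (esymm (l.parts.count j)) (piSymm j))

/-- The rank `∑_k (λ_k - 1)` of a partition. -/
def rank {n : ℕ} (l : n.Partition) : ℕ := (l.parts.map fun k => k - 1).sum

/-- The partitions of `n` without parts of size `1` and of rank `i`. -/
def hatPartitions (i n : ℕ) : Finset n.Partition :=
  Finset.univ.filter fun l => 1 ∉ l.parts ∧ rank l = i

/-- The character `\widehat{Lie}^i_n`. -/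
def lieHatGraded (i n : ℕ) : Equiv.Perm (Fin n) → ℂ := ∑ l ∈ hatPartitions i n, lieChar l

/-- The character `\widehat{W}^i_n`. -/
def whitneyHatGraded (i n : ℕ) : Equiv.Perm (Fin n) → ℂ :=
  ∑ l ∈ hatPartitions i n, whitneyChar l

/-- The character `\widehat{Lie}_n = ∑_i \widehat{Lie}^i_n` (the rank of a partition of `n` is at
most `n`). -/
def lieHat (n : ℕ) : Equiv.Perm (Fin n) → ℂ := ∑ i ∈ Finset.range (n + 1), lieHatGraded i n

/-- The character `\widehat{W}_n = ∑_i \widehat{W}^i_n`. -/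
def whitneyHat (n : ℕ) : Equiv.Perm (Fin n) → ℂ :=
  ∑ i ∈ Finset.range (n + 1), whitneyHatGraded i n

/-! ### Standard Young tableaux -/

/-- Standard Young tableaux of size `n`: the entry in row `i` and column `j` (both counted from
`0`, rows downwards) is `entry i j`, which is `0` outside the shape. -/
@[ext]
structure StandardTableau (n : ℕ) where
  shape : YoungDiagram
  entry : ℕ → ℕ → ℕ
  bijOn : Set.BijOn (fun c : ℕ × ℕ => entry c.1 c.2) (shape.cells : Set (ℕ × ℕ)) (Set.Icc 1 n)
  row_strict : ∀ i j₁ j₂ : ℕ, j₁ < j₂ → (i, j₂) ∈ shape → entry i j₁ < entry i j₂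
  col_strict : ∀ i₁ i₂ j : ℕ, i₁ < i₂ → (i₂, j) ∈ shape → entry i₁ j < entry i₂ j
  zeros : ∀ i j : ℕ, (i, j) ∉ shape → entry i j = 0

namespace StandardTableau

variable {n : ℕ}

theorem entry_mem (Q : StandardTableau n) {i j : ℕ} (h : (i, j) ∈ Q.shape) :
    1 ≤ Q.entry i j ∧ Q.entry i j ≤ n :=
  Q.bijOn.mapsTo (x := (i, j)) h

theorem row_lt_entry (Q : StandardTableau n) (i j : ℕ) (h : (i, j) ∈ Q.shape) :
    i < Q.entry i j := by
  induction i with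
  | zero => exact (Q.entry_mem h).1
  | succ i ih =>
    have h1 := ih (Q.shape.up_left_mem (Nat.le_succ i) le_rfl h)
    have h2 := Q.col_strict i (i + 1) j (Nat.lt_succ_self i) h
    omega

theorem col_lt_entry (Q : StandardTableau n) (i j : ℕ) (h : (i, j) ∈ Q.shape) :
    j < Q.entry i j := by
  induction j with
  | zero => exact (Q.entry_mem h).1
  | succ j ih =>
    have h1 := ih (Q.shape.up_left_mem le_rfl (Nat.le_succ j) h)
    have h2 := Q.row_strict i j (j + 1) (Nat.lt_succ_self j) h
    omega

theorem entry_le (Q : StandardTableau n) (i j : ℕ) : Q.entry i j ≤ n := by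
  by_cases h : (i, j) ∈ Q.shape
  · exact (Q.entry_mem h).2
  · simp [Q.zeros i j h]

theorem mem_shape_iff (Q : StandardTableau n) (i j : ℕ) :
    (i, j) ∈ Q.shape ↔ Q.entry i j ≠ 0 := by
  refine ⟨fun h => ?_, fun h => ?_⟩
  · have := (Q.entry_mem h).1
    omega
  · by_contra h'
    exact h (Q.zeros i j h')

/-- There are finitely many standard Young tableaux of size `n`. -/
instance : Finite (StandardTableau n) := by
  refine Finite.of_injective
    (fun Q : StandardTableau n => fun c : Fin n × Fin n =>
      (⟨Q.entry c.1 c.2, Nat.lt_succ_of_le (Q.entry_le _ _)⟩ : Fin (n + 1))) ?_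
  intro Q R hQR
  have he : Q.entry = R.entry := by
    funext i j
    by_cases hb : i < n ∧ j < n
    · have := congrFun hQR (⟨i, hb.1⟩, ⟨j, hb.2⟩)
      simpa using this
    · have key : ∀ S : StandardTableau n, S.entry i j = 0 := by
        intro S
        refine S.zeros i j fun h => hb ⟨?_, ?_⟩
        · exact (S.row_lt_entry i j h).trans_le (S.entry_mem h).2
        · exact (S.col_lt_entry i j h).trans_le (S.entry_mem h).2
      rw [key Q, key R]
  have hs : Q.shape = R.shape := by
    refine SetLike.ext fun c => ?_
    obtain ⟨i, j⟩ := c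
    rw [Q.mem_shape_iff, R.mem_shape_iff, he]
  exact StandardTableau.ext hs he

/-- `k` is an ascent of `Q` if `k = n`, or if `k + 1` lies in a weakly higher row than `k`. -/
def IsAscent (Q : StandardTableau n) (k : ℕ) : Prop :=
  k = n ∨ ∃ i j i' j' : ℕ, (i, j) ∈ Q.shape ∧ (i', j') ∈ Q.shape ∧
    Q.entry i j = k ∧ Q.entry i' j' = k + 1 ∧ i' ≤ i

/-- The smallest ascent of `Q` that is at least `m` (it exists for `m ≤ n`, as `n` is an
ascent). -/
def firstAscentFrom (Q : StandardTableau n) (m : ℕ) : ℕ := sInf {k | m ≤ k ∧ Q.IsAscent k}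

/-- A desarrangement tableau is a standard tableau whose first ascent is even. -/
def IsDesarrangement (Q : StandardTableau n) : Prop := Even (Q.firstAscentFrom 0)

/-- Whitney-generating tableaux. The first three clauses are the ones of size at most `3`. The
last four describe those whose entries `1, 2, 3, 4` form, in this order, one of
the tableaux `12/3/4`, `124/3`, `12/34`, `123/4` (rows separated by slashes). -/
def IsWhitneyGenerating (Q : StandardTableau n) : Prop :=
  n = 0 ∨
  (n = 2 ∧ Q.entry 0 0 = 1 ∧ Q.entry 0 1 = 2) ∨
  (n = 3 ∧ Q.entry 0 0 = 1 ∧ Q.entry 0 1 = 2 ∧ Q.entry 1 0 = 3) ∨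
  (Q.entry 0 0 = 1 ∧ Q.entry 0 1 = 2 ∧ Q.entry 1 0 = 3 ∧ Q.entry 2 0 = 4) ∨
  (Q.entry 0 0 = 1 ∧ Q.entry 0 1 = 2 ∧ Q.entry 1 0 = 3 ∧ Q.entry 0 2 = 4) ∨
  ((Q.entry 0 0 = 1 ∧ Q.entry 0 1 = 2 ∧ Q.entry 1 0 = 3 ∧ Q.entry 1 1 = 4) ∧
    Odd (Q.firstAscentFrom 4)) ∨
  ((Q.entry 0 0 = 1 ∧ Q.entry 0 1 = 2 ∧ Q.entry 0 2 = 3 ∧ Q.entry 1 0 = 4) ∧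
    Even (Q.firstAscentFrom 4))

end StandardTableau

/-- The set of desarrangement tableaux of size `n`. -/
def desarrangementTableaux (n : ℕ) : Finset (StandardTableau n) :=
  (Set.toFinite {Q : StandardTableau n | Q.IsDesarrangement}).toFinset

/-- The set of Whitney-generating tableaux of size `n`. -/
def whitneyGeneratingTableaux (n : ℕ) : Finset (StandardTableau n) :=
  (Set.toFinite {Q : StandardTableau n | Q.IsWhitneyGenerating}).toFinset

end WhitneyTableaux

end

noncomputable section

namespace WhitneyTableaux

section

open MvPowerSeries Finset

/-! ### Newton's identities and algebraic independence of the power sums -/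

/-! Both statements are identities of symmetric functions in disguise. By `ch_injective` it suffices
to compare Frobenius characteristics, and this is done through generating functions in a grading
variable t. Write H(t) for the series of the h_n and E(-t) for the series of the (-1)^n e_n, with
e_n taken as the Schur function of a column.

Character side. The n-cycle generates a cyclic group whose elements of order d have cycle type
d^(n/d), so n ℓ_n is the sum over d | n of μ(d) p_d^(n/d), where μ(d) occurs as the sum of the
primitive d-th roots of unity (`ch_mul_lieCharacter`); twisting by the sign character inserts signs.
The sum over all partitions without parts 1 is a product over part sizes j ≥ 2, and multiplication
by H(t) restores the factor j = 1. Comparing logarithmic derivatives (`hsymm_mul_hatSeries`), the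
Möbius sums collapse and leave H(t) · Lie(t) = 1/(1 - p_1 t) and H(t) · W(t) = (1 + p_2 t^2)/(1 -
p_1 t).

Tableau side. Removing the largest entry and applying the Pieri rule for h_1 shows that a family of
tableaux that is stable under adding cells is multiplied by h_1 from one size to the next
(`sum_restrict_mul_schur`). The families of the theorem fail to be stable only at tableaux whose
first ascent is at the very end, because only then can a new cell change the first ascent, and its
parity with it. For desarrangement tableaux the only exception is a column, which gives D_n = h_1
D_(n-1) + (-1)^n e_n. For Whitney-generating tableaux of size at least 4 the exceptions are the
shapes (3,1,...,1) and (2,2,1,...,1), with opposite signs, and `colSchur_add_psum_two` identifies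
their difference with e_n + p_2 e_(n-2). Hence (1 - p_1 t) D(t) = E(-t) and (1 - p_1 t) W(t) = (1 +
p_2 t^2) E(-t). Since E(-t) H(t) = 1, both sides agree.

Two foundations are also needed. The power sums are algebraically independent
(`aeval_psum_injective`), which makes plethysm computable and `ch` injective. Moreover each Schur
function of a tableau shape must be the characteristic of an irreducible character: the Jacobi-Trudi
determinant defines a virtual character, the bialternant formula gives it norm 1
(`charForm_jtChar`), and its degree is positive because it counts tableaux (`shapeChar_one`). -/

open Classical in
theorem coeff_psum (k : ℕ) (d : ℕ →₀ ℕ) :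
    coeff d (psum k) = if ∃ i, d = Finsupp.single i k then 1 else 0 := rfl

theorem coeff_hsymm (r : ℤ) (d : ℕ →₀ ℕ) :
    coeff d (hsymm r) = if (d.degree : ℤ) = r then 1 else 0 := rfl

open Classical in
theorem coeff_esymm (r : ℕ) (d : ℕ →₀ ℕ) :
    coeff d (esymm r) = if d.degree = r ∧ ∀ i, d i ≤ 1 then 1 else 0 := rfl

/-- Only the splittings of `d` that remove a pure power x_i^k contribute, and for k > 0 the index i
can be recovered from it. Both Newton identities become counts over i and k through this formula. -/
theorem coeff_psum_mul {k : ℕ} (hk : 0 < k) (F : Series) (d : ℕ →₀ ℕ) :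
    coeff d (psum k * F) =
      ∑ i ∈ d.support, if k ≤ d i then coeff (d - Finsupp.single i k) F else 0 := by
  classical
  rw [coeff_mul, ← Finset.sum_filter]
  simp_rw [coeff_psum, ite_mul, one_mul, zero_mul]
  rw [← Finset.sum_filter]
  symm
  refine Finset.sum_bij (fun i _ => (Finsupp.single i k, d - Finsupp.single i k)) ?_ ?_ ?_ ?_
  · intro i hi
    simp only [mem_filter, HasAntidiagonal.mem_antidiagonal] at hi ⊢
    exact ⟨add_tsub_cancel_of_le (Finsupp.single_le_iff.2 hi.2), i, rfl⟩
  · intro i _ j _ h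
    have := congrArg Prod.fst h
    exact (Finsupp.single_left_injective hk.ne') this
  · rintro ⟨a, b⟩ h
    simp only [mem_filter, HasAntidiagonal.mem_antidiagonal] at h
    obtain ⟨hab, i, rfl⟩ := h
    have hle : k ≤ d i := by rw [← hab]; simp
    refine ⟨i, ?_, ?_⟩
    · simp only [mem_filter, Finsupp.mem_support_iff]
      exact ⟨by omega, hle⟩
    · rw [← hab]; simp
  · intro i _
    rfl

theorem degree_sub_single {d : ℕ →₀ ℕ} {i k : ℕ} (h : k ≤ d i) :
    (d - Finsupp.single i k).degree + k = d.degree := by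
  have : d - Finsupp.single i k + Finsupp.single i k = d :=
    tsub_add_cancel_of_le (Finsupp.single_le_iff.2 h)
  conv_rhs => rw [← this]
  simp

theorem hsymm_zero : hsymm 0 = 1 := by
  ext d
  rw [coeff_hsymm, coeff_one]
  simp [Finsupp.degree_eq_zero_iff]

theorem esymm_zero : esymm 0 = 1 := by
  classical
  ext d
  rw [coeff_esymm, coeff_one]
  by_cases h : d = 0 <;> simp [h, Finsupp.degree_eq_zero_iff]

theorem hsymm_of_neg {r : ℤ} (h : r < 0) : hsymm r = 0 := by
  ext d
  rw [coeff_hsymm, if_neg (by omega), map_zero]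

theorem sum_support_eq_degree (d : ℕ →₀ ℕ) : ∑ i ∈ d.support, d i = d.degree := rfl

/-- Newton's identity for the complete homogeneous symmetric functions. -/
theorem hsymm_newton (m : ℕ) :
    ((m : ℂ) + 1) • hsymm (m + 1 : ℕ) =
      ∑ k ∈ range (m + 1), psum (k + 1) * hsymm (m - k : ℕ) := by
  ext d
  rw [coeff_smul, map_sum, coeff_hsymm]
  simp_rw [coeff_psum_mul (Nat.succ_pos _), coeff_hsymm]
  rw [sum_comm]
  split_ifs with h
  · norm_cast at h
    -- Each i contributes once for every k + 1 ≤ d i, that is d i times, and these multiplicities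
    -- add up to the degree m + 1.
    trans ∑ i ∈ d.support, (d i : ℂ)
    · rw [← Nat.cast_sum, sum_support_eq_degree, h]; push_cast; ring
    · refine sum_congr rfl fun i hi => ?_
      have hdi : d i ≤ m + 1 := by
        rw [← h]; exact Finsupp.le_degree i d
      rw [← sum_filter]
      trans ∑ k ∈ range (d i), (1 : ℂ)
      · simp
      · refine sum_subset_zero_on_sdiff ?_ ?_ ?_
        · intro k hk; simp at hk ⊢; omega
        · intro k hk; simp at hk; omega
        · intro k hk
          simp at hk
          have := degree_sub_single (d := d) (i := i) (k := k + 1) (by omega)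
          rw [if_pos]
          have : (d - Finsupp.single i (k + 1)).degree = m - k := by omega
          rw [this]
  · norm_cast at h
    rw [mul_zero]
    symm
    refine sum_eq_zero fun i _ => sum_eq_zero fun k hk => ?_
    simp at hk
    split_ifs with h1 h2 <;> [skip; rfl; rfl]
    have := degree_sub_single (d := d) h1
    norm_cast at h2
    omega

/-- Newton's identity for the elementary symmetric functions. -/
theorem esymm_newton (m : ℕ) :
    ((m : ℂ) + 1) • esymm (m + 1) =
      ∑ k ∈ range (m + 1), ((-1 : ℂ) ^ k) • (psum (k + 1) * esymm (m - k)) := by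
  classical
  ext d
  rw [coeff_smul, map_sum, coeff_esymm]
  simp_rw [coeff_smul, coeff_psum_mul (Nat.succ_pos _), coeff_esymm, mul_sum]
  rw [sum_comm]
  by_cases h : d.degree = m + 1
  swap
  · rw [if_neg (by tauto), mul_zero]
    symm
    refine sum_eq_zero fun i _ => sum_eq_zero fun k hk => ?_
    simp at hk
    split_ifs with h1 h2 <;> [skip; exact mul_zero _; exact mul_zero _]
    have := degree_sub_single (d := d) h1
    omega
  -- Removing x_i^(k+1) leaves a squarefree monomial only if at most one x_i remains. For d i ≥ 2
  -- there are two such k, with opposite signs; for d i = 1 only k = 0 survives.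
  have key : ∀ i ∈ d.support, (∑ k ∈ range (m + 1), (-1 : ℂ) ^ k *
      (if k + 1 ≤ d i then if (d - Finsupp.single i (k + 1)).degree = m - k ∧
        ∀ j, (d - Finsupp.single i (k + 1)) j ≤ 1 then 1 else 0 else 0)) =
      if ∀ j, d j ≤ 1 then 1 else 0 := by
    intro i hi
    have hi0 : d i ≠ 0 := by simpa using hi
    have hdi : d i ≤ m + 1 := by
      rw [← h]; exact Finsupp.le_degree i d
    have hterm : ∀ k, k + 1 ≤ d i → (((d - Finsupp.single i (k + 1)).degree = m - k ∧
        ∀ j, (d - Finsupp.single i (k + 1)) j ≤ 1) ↔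
        ((∀ j, j ≠ i → d j ≤ 1) ∧ d i ≤ k + 2)) := by
      intro k hk
      have hd := degree_sub_single (d := d) hk
      constructor
      · rintro ⟨-, h2⟩
        refine ⟨fun j hj => ?_, ?_⟩
        · have := h2 j
          rwa [Finsupp.tsub_apply, Finsupp.single_eq_of_ne hj, tsub_zero] at this
        · have := h2 i
          rw [Finsupp.tsub_apply, Finsupp.single_eq_same] at this
          omega
      · rintro ⟨h1, h2⟩
        refine ⟨by omega, fun j => ?_⟩
        by_cases hj : j = i
        · subst hj
          rw [Finsupp.tsub_apply, Finsupp.single_eq_same]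
          omega
        · rw [Finsupp.tsub_apply, Finsupp.single_eq_of_ne hj, tsub_zero]
          exact h1 j hj
    by_cases hoff : ∀ j, j ≠ i → d j ≤ 1
    swap
    · rw [if_neg (fun h => hoff fun j _ => h j)]
      refine sum_eq_zero fun k _ => ?_
      split_ifs with h1 h2
      · exact absurd ((hterm k h1).1 h2).1 hoff
      · simp
      · simp
    have hconv : ∀ k ∈ range (m + 1), (-1 : ℂ) ^ k *
      (if k + 1 ≤ d i then if (d - Finsupp.single i (k + 1)).degree = m - k ∧
        ∀ j, (d - Finsupp.single i (k + 1)) j ≤ 1 then 1 else 0 else 0) =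
        if k + 1 ≤ d i ∧ d i ≤ k + 2 then (-1 : ℂ) ^ k else 0 := by
      intro k _
      by_cases h1 : k + 1 ≤ d i
      · simp only [h1, hterm k h1, if_true, true_and]
        split_ifs <;> simp_all
      · simp [h1]
    rw [sum_congr rfl hconv]
    by_cases h1 : d i = 1
    · rw [if_pos, sum_eq_single 0]
      · simp [h1]
      · intro b _ hb
        rw [if_neg]; omega
      · simp
      · intro j
        by_cases hj : j = i
        · subst hj; omega
        · exact hoff j hj
    · rw [if_neg (fun h => h1 (le_antisymm (h i) (Nat.pos_of_ne_zero hi0)))]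
      obtain ⟨e, he⟩ : ∃ e, d i = e + 2 := ⟨d i - 2, by omega⟩
      rw [← sum_filter]
      have : (range (m + 1)).filter (fun k => k + 1 ≤ d i ∧ d i ≤ k + 2) = {e, e + 1} := by
        ext k; simp; omega
      rw [this, sum_pair (by omega), pow_succ]
      ring
  rw [sum_congr rfl key]
  split_ifs with h1 h2 h2
  · have : ∑ i ∈ d.support, (1 : ℂ) = ∑ i ∈ d.support, (d i : ℂ) := by
      refine sum_congr rfl fun i hi => ?_
      have hi0 : d i ≠ 0 := by simpa using hi
      have := h1.2 i
      rw [show d i = 1 by omega, Nat.cast_one]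
    rw [this, ← Nat.cast_sum, sum_support_eq_degree, h]; push_cast; ring
  · tauto
  · tauto
  · simp

/-- The expansion of the complete homogeneous (`ε = 1`) or elementary (`ε = -1`) symmetric
functions in power sums, where the variable number `k` stands for `p_{k+1}`. -/
def newtonPoly (ε : ℂ) : ℕ → MvPolynomial ℕ ℂ
  | 0 => 1
  | m + 1 => ((m : ℂ) + 1)⁻¹ •
      ∑ k : Fin (m + 1), ε ^ (k : ℕ) • (MvPolynomial.X (k : ℕ) * newtonPoly ε (m - k))

theorem newtonPoly_succ (ε : ℂ) (m : ℕ) :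
    ((m : ℂ) + 1) • newtonPoly ε (m + 1) =
      ∑ k ∈ range (m + 1), ε ^ k • (MvPolynomial.X k * newtonPoly ε (m - k)) := by
  rw [newtonPoly, smul_smul, mul_inv_cancel₀ (by exact_mod_cast Nat.succ_ne_zero m), one_smul,
    Finset.sum_range]

/-- The recursion is kept for arbitrary values `q`: it is used with q the power sums, and again with
q the plethysms p_k[g]. -/
theorem aeval_newtonPoly_succ {R : Type*} [CommRing R] [Algebra ℂ R] (q : ℕ → R) (ε : ℂ) (m : ℕ) :
    ((m : ℂ) + 1) • MvPolynomial.aeval q (newtonPoly ε (m + 1)) =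
      ∑ k ∈ range (m + 1),
        ε ^ k • (q k * MvPolynomial.aeval q (newtonPoly ε (m - k))) := by
  rw [← map_smul, newtonPoly_succ]
  simp [map_sum]

theorem aeval_newtonPoly_one (m : ℕ) :
    MvPolynomial.aeval (fun k : ℕ => psum (k + 1)) (newtonPoly 1 m) = hsymm m := by
  induction m using Nat.strong_induction_on with
  | _ m ih =>
    rcases m with _ | m
    · simp [newtonPoly, hsymm_zero]
    · have h1 := aeval_newtonPoly_succ (fun k : ℕ => psum (k + 1)) 1 m
      have h2 := hsymm_newton m
      have h3 : ((m : ℂ) + 1) ≠ 0 := by exact_mod_cast Nat.succ_ne_zero m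
      refine smul_right_injective _ h3 ?_
      simp only
      rw [h1, h2]
      refine sum_congr rfl fun k hk => ?_
      rw [ih _ (by omega)]
      simp

theorem aeval_newtonPoly_neg_one (m : ℕ) :
    MvPolynomial.aeval (fun k : ℕ => psum (k + 1)) (newtonPoly (-1) m) = esymm m := by
  induction m using Nat.strong_induction_on with
  | _ m ih =>
    rcases m with _ | m
    · simp [newtonPoly, esymm_zero]
    · have h1 := aeval_newtonPoly_succ (fun k : ℕ => psum (k + 1)) (-1) m
      have h2 := esymm_newton m
      have h3 : ((m : ℂ) + 1) ≠ 0 := by exact_mod_cast Nat.succ_ne_zero m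
      refine smul_right_injective _ h3 ?_
      simp only
      rw [h1, h2]
      refine sum_congr rfl fun k hk => ?_
      rw [ih _ (by omega)]

/-! ### Restriction to finitely many variables -/

/-- Set the variables `x_M, x_{M+1}, …` to zero. -/
def truncVars (M : ℕ) : Series →ₐ[ℂ] MvPowerSeries (Fin M) ℂ := killCompl Fin.valEmbedding

theorem coeff_truncVars (M : ℕ) (F : Series) (d : Fin M →₀ ℕ) :
    coeff d (truncVars M F) = coeff (d.embDomain Fin.valEmbedding) F :=
  coeff_killCompl _ _

/-- An exponent vector has finite support, so every coefficient is already visible in finitely many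
variables. -/
theorem ext_truncVars {F G : Series} (h : ∀ M, truncVars M F = truncVars M G) : F = G := by
  classical
  ext d
  obtain ⟨M, hM⟩ : ∃ M, ∀ i ∈ d.support, i < M :=
    ⟨d.support.sup id + 1, fun i hi => Nat.lt_succ_of_le (Finset.le_sup (f := id) hi)⟩
  have key : d = (d.comapDomain (Fin.valEmbedding : Fin M ↪ ℕ)
      (Fin.valEmbedding.injective.injOn)).embDomain Fin.valEmbedding := by
    rw [Finsupp.embDomain_comapDomain]
    intro i hi
    exact ⟨⟨i, hM i hi⟩, rfl⟩
  rw [key, ← coeff_truncVars, ← coeff_truncVars, h]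

theorem truncVars_psum (M : ℕ) {k : ℕ} (hk : 0 < k) :
    truncVars M (psum k) = ∑ i : Fin M, X i ^ k := by
  classical
  ext d
  rw [coeff_truncVars, coeff_psum, map_sum]
  simp_rw [coeff_X_pow]
  split_ifs with h
  · obtain ⟨i, hi⟩ := h
    have hiM : i ∈ Set.range (Fin.valEmbedding : Fin M ↪ ℕ) := by
      by_contra hc
      have := Finsupp.embDomain_of_notMem_range (Fin.valEmbedding : Fin M ↪ ℕ) d i hc
      rw [hi] at this
      simp at this
      omega
    obtain ⟨j, rfl⟩ := hiM
    rw [← Finsupp.embDomain_single] at hi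
    have hd := Finsupp.embDomain_injective _ hi
    rw [sum_eq_single j]
    · simp [hd]
    · intro b _ hb
      rw [if_neg]
      rw [hd]
      exact fun h => hb (Finsupp.single_left_injective hk.ne' h).symm
    · simp
  · symm
    refine sum_eq_zero fun i _ => ?_
    rw [if_neg]
    rintro rfl
    exact h ⟨i, Finsupp.embDomain_single _ _ _⟩

theorem coeff_truncVars_hsymm (M : ℕ) (r : ℤ) (d : Fin M →₀ ℕ) :
    coeff d (truncVars M (hsymm r)) = if (d.degree : ℤ) = r then 1 else 0 := by
  rw [coeff_truncVars, coeff_hsymm]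
  congr 3
  rw [Finsupp.degree_apply, Finsupp.degree_apply, Finsupp.support_embDomain, sum_map]
  simp only [Finsupp.embDomain_apply_self]

end

/-! ### Algebraic independence of the power sums -/

section

open MvPowerSeries Finset

/-- Multiplying out, one chooses a variable `c o` for every factor `o`. -/
theorem truncVars_prod_psum (M : ℕ) (b : List ℕ) :
    truncVars M (b.map fun k => psum (k + 1)).prod =
      ∑ c : Fin b.length → Fin M,
        monomial (∑ o, Finsupp.single (c o) (b[o] + 1)) (1 : ℂ) := by
  classical
  rw [← Fin.prod_univ_fun_getElem, map_prod]
  simp_rw [truncVars_psum M (Nat.succ_pos _)]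
  rw [Finset.prod_univ_sum, Fintype.piFinset_univ]
  refine sum_congr rfl fun c _ => ?_
  simp_rw [X_pow_eq]
  rw [MvPowerSeries.prod_monomial]
  simp

/-- The power sums are algebraically independent. -/
theorem aeval_psum_injective :
    Function.Injective (MvPolynomial.aeval (R := ℂ) (fun k : ℕ => psum (k + 1))) := by
  classical
  rw [injective_iff_map_eq_zero]
  intro F hF
  by_contra hne
  -- The degree here is the number of power sum factors, not the weighted degree. A product with the
  -- most factors is detected by the monomial that puts its factors into distinct variables.
  obtain ⟨m, hm, hmax⟩ := Finset.exists_max_image F.support Finsupp.degree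
    (MvPolynomial.support_nonempty.2 hne)
  let L : (ℕ →₀ ℕ) → List ℕ := fun m => (Finsupp.toMultiset m).toList
  have hL : ∀ m, ((L m : List ℕ) : Multiset ℕ) = Finsupp.toMultiset m := fun m =>
    Multiset.coe_toList _
  have hlen : ∀ m, (L m).length = m.degree := fun m => by
    rw [Multiset.length_toList, Finsupp.card_toMultiset]; rfl
  have hprod : ∀ m : ℕ →₀ ℕ, (m.prod fun k e => psum (k + 1) ^ e) =
      ((L m).map fun k => psum (k + 1)).prod := by
    intro m
    rw [← Multiset.prod_coe, ← Multiset.map_coe, hL, Finsupp.toMultiset_map,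
      Finsupp.prod_toMultiset, Finsupp.prod_mapDomain_index] <;> simp [pow_add]
  let M := (L m).length
  let d : Fin M →₀ ℕ := ∑ o, Finsupp.single o ((L m)[o] + 1)
  have hd : ∀ i, d i = (L m)[i] + 1 := by
    intro i
    simp only [d, Finsupp.finsetSum_apply]
    rw [sum_eq_single i]
    · simp
    · intro b _ hb; simp [hb]
    · simp
  have hcoeff : ∀ m', coeff d (truncVars M (m'.prod fun k e => psum (k + 1) ^ e)) =
      ((univ.filter fun c : Fin (L m').length → Fin M =>
        d = ∑ o, Finsupp.single (c o) ((L m')[o] + 1)).card : ℂ) := by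
    intro m'
    rw [hprod, truncVars_prod_psum, map_sum]
    simp_rw [coeff_monomial]
    simp
  have hself : coeff d (truncVars M (m.prod fun k e => psum (k + 1) ^ e)) ≠ 0 := by
    rw [hcoeff, Nat.cast_ne_zero, ← Nat.pos_iff_ne_zero, Finset.card_pos]
    exact ⟨id, by simp [d, M]⟩
  have hother : ∀ m' ∈ F.support, m' ≠ m →
      coeff d (truncVars M (m'.prod fun k e => psum (k + 1) ^ e)) = 0 := by
    intro m' hm' hmm
    rw [hcoeff, Nat.cast_eq_zero, Finset.card_eq_zero, Finset.filter_eq_empty_iff]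
    intro c _ hc
    apply hmm
    have hci : ∀ i, (L m)[i] + 1 = ∑ o, if c o = i then (L m')[o] + 1 else 0 := by
      intro i
      rw [← hd, hc, Finsupp.finsetSum_apply]
      refine sum_congr rfl fun o _ => ?_
      rw [Finsupp.single_apply]
    -- Every exponent of `d` is positive, so every variable receives a factor. By maximality of `m`
    -- no variable receives two, so the factors of `m'` are those of `m` in another order.
    have hsurj : Function.Surjective c := by
      intro i
      by_contra hno
      push Not at hno
      have := hci i
      simp [hno] at this
    have hle : (L m').length ≤ M := by
      simp only [M, hlen]; exact hmax m' hm'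
    have hcard : (L m').length = M := by
      refine le_antisymm hle ?_
      simpa using Fintype.card_le_of_surjective c hsurj
    have hbij : Function.Bijective c :=
      (Fintype.bijective_iff_surjective_and_card c).2 ⟨hsurj, by simpa using hcard⟩
    have hget : ∀ o, (L m)[c o] = (L m')[o] := by
      intro o
      have := hci (c o)
      simp only [hbij.1.eq_iff] at this
      simpa using this
    have hmul : ((L m' : List ℕ) : Multiset ℕ) = (L m : List ℕ) := by
      have h1 : ∀ l : List ℕ, (l : Multiset ℕ) =
          (univ : Finset (Fin l.length)).val.map (fun o => l[o]) := by
        intro l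
        rw [Fin.univ_val_map]
        simp
      rw [h1, h1]
      have h2 : (univ : Finset (Fin M)).val = (univ : Finset (Fin (L m').length)).val.map c := by
        have := congrArg Finset.val (Finset.map_univ_equiv (Equiv.ofBijective c hbij))
        rw [← this]; rfl
      change _ = Multiset.map _ (univ : Finset (Fin M)).val
      rw [h2, Multiset.map_map]
      exact Multiset.map_congr rfl fun o _ => (hget o).symm
    rw [hL, hL] at hmul
    exact Multiset.toFinsupp.symm.injective hmul
  have h0 := congrArg (fun G => coeff d (truncVars M G)) hF
  simp only [map_zero] at h0
  rw [MvPolynomial.aeval_def, MvPolynomial.eval₂_eq, map_sum, map_sum, sum_eq_single m] at h0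
  · rw [← Algebra.smul_def, map_smul, coeff_smul] at h0
    rcases mul_eq_zero.1 h0 with h | h
    · exact MvPolynomial.mem_support_iff.1 hm h
    · exact hself h
  · intro m' hm' hmm
    rw [← Algebra.smul_def, map_smul, coeff_smul]
    exact mul_eq_zero_of_right _ (hother m' hm' hmm)
  · intro h; exact absurd hm h

/-! ### Plethysm -/

/-- Algebraic independence makes the polynomial chosen in the definition equal to `F`. -/
theorem plethysm_aeval (F : MvPolynomial ℕ ℂ) (g : Series) :
    plethysm (MvPolynomial.aeval (fun k : ℕ => psum (k + 1)) F) g =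
      MvPolynomial.aeval
        (fun k : ℕ => MvPowerSeries.expand (k + 1) (Nat.succ_ne_zero k) g) F := by
  have h : ∃ G : MvPolynomial ℕ ℂ, MvPolynomial.aeval (fun k : ℕ => psum (k + 1)) G =
      MvPolynomial.aeval (fun k : ℕ => psum (k + 1)) F := ⟨F, rfl⟩
  rw [plethysm, dif_pos h, aeval_psum_injective h.choose_spec]

theorem plethysm_hsymm (m : ℕ) (g : Series) :
    plethysm (hsymm m) g = MvPolynomial.aeval
        (fun k : ℕ => MvPowerSeries.expand (k + 1) (Nat.succ_ne_zero k) g) (newtonPoly 1 m) := by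
  rw [← aeval_newtonPoly_one, plethysm_aeval]

theorem plethysm_esymm (m : ℕ) (g : Series) :
    plethysm (esymm m) g = MvPolynomial.aeval
        (fun k : ℕ => MvPowerSeries.expand (k + 1) (Nat.succ_ne_zero k) g) (newtonPoly (-1) m) := by
  rw [← aeval_newtonPoly_neg_one, plethysm_aeval]

theorem expand_psum {k : ℕ} (hk : k ≠ 0) (d : ℕ) :
    MvPowerSeries.expand k hk (psum d) = psum (k * d) := by
  classical
  ext e
  rw [coeff_psum]
  by_cases h : ∃ f : ℕ →₀ ℕ, e = k • f
  · obtain ⟨f, rfl⟩ := h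
    rw [coeff_expand_smul, coeff_psum]
    congr 1
    refine propext (exists_congr fun i => ?_)
    have : Finsupp.single i (k * d) = k • Finsupp.single i d := by simp
    rw [this]
    exact (smul_right_injective _ hk).eq_iff.symm
  · obtain ⟨i, hi⟩ : ∃ i, ¬ k ∣ e i := by
      by_contra hno
      push Not at hno
      refine h ⟨e.mapRange (· / k) (Nat.zero_div k), ?_⟩
      ext i
      simp [Nat.mul_div_cancel' (hno i)]
    rw [coeff_expand_of_not_dvd _ hk _ hi, if_neg]
    rintro ⟨j, rfl⟩
    apply hi
    rw [Finsupp.single_apply]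
    split_ifs <;> simp

end

section

open Finset PowerSeries

/-! ### Generating functions over partitions and logarithmic derivatives -/

section EulerOperator

variable {R : Type*} [CommRing R]

/-- The Euler operator `t d/dt` on power series. -/
def eulerOp (R : Type*) [CommRing R] : Derivation R R⟦X⟧ R⟦X⟧ :=
  (PowerSeries.X : R⟦X⟧) • PowerSeries.derivative R

theorem coeff_eulerOp (f : R⟦X⟧) (n : ℕ) : coeff n (eulerOp R f) = n * coeff n f := by
  change coeff n (PowerSeries.X * PowerSeries.derivative R f) = _
  cases n with
  | zero => simp
  | succ n => rw [coeff_succ_X_mul, coeff_derivative]; push_cast; ring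

/-- The form `f * a` says that a is the logarithmic derivative of f without dividing by f; such
logarithmic derivatives add up over products. -/
theorem eulerOp_mul {f g a b : R⟦X⟧} (hf : eulerOp R f = f * a) (hg : eulerOp R g = g * b) :
    eulerOp R (f * g) = f * g * (a + b) := by
  rw [Derivation.leibniz, hf, hg, smul_eq_mul, smul_eq_mul]; ring

theorem eulerOp_prod {ι : Type*} (s : Finset ι) (f g : ι → R⟦X⟧)
    (h : ∀ i ∈ s, eulerOp R (f i) = f i * g i) :
    eulerOp R (∏ i ∈ s, f i) = (∏ i ∈ s, f i) * ∑ i ∈ s, g i := by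
  classical
  induction s using Finset.induction_on with
  | empty => simp
  | insert i s hi ih =>
    rw [prod_insert hi, sum_insert hi]
    exact eulerOp_mul (h i (mem_insert_self _ _)) (ih fun j hj => h j (mem_insert_of_mem hj))

/-- Chain rule for t ↦ t^j: the logarithmic derivative is substituted and multiplied by j. -/
theorem eulerOp_expand {j : ℕ} (hj : j ≠ 0) {f g : R⟦X⟧} (h : eulerOp R f = f * g) :
    eulerOp R (expand j hj f) = expand j hj f * ((j : R) • expand j hj g) := by
  have : eulerOp R (expand j hj f) = (j : R) • expand j hj (eulerOp R f) := by
    ext n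
    rw [coeff_eulerOp, coeff_smul, coeff_expand, coeff_expand]
    split_ifs with hd
    · rw [coeff_eulerOp]
      obtain ⟨m, rfl⟩ := hd
      rw [Nat.mul_div_cancel_left _ (Nat.pos_of_ne_zero hj)]
      push_cast
      rw [smul_eq_mul]; ring
    · simp
  rw [this, h, map_mul, mul_smul_comm]

variable [Algebra ℂ R]

/-- Since C and D have no constant term, r times the r-th coefficient is expressed by lower
coefficients, and r is invertible over ℂ. Only degrees up to n are compared, so that finite products
can stand in for infinite ones. -/
theorem eq_of_eulerOp {A B C D : R⟦X⟧} (hA : eulerOp R A = A * C) (hB : eulerOp R B = B * D)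
    (h0 : coeff 0 A = coeff 0 B) (hC0 : coeff 0 C = 0) (n : ℕ)
    (hCD : ∀ r ≤ n, coeff r C = coeff r D) : ∀ r ≤ n, coeff r A = coeff r B := by
  intro r
  induction r using Nat.strong_induction_on with
  | _ r ih =>
    intro hr
    rcases Nat.eq_zero_or_pos r with rfl | hpos
    · exact h0
    have h1 : (r : R) * coeff r A = (r : R) * coeff r B := by
      rw [← coeff_eulerOp, ← coeff_eulerOp, hA, hB, coeff_mul, coeff_mul]
      refine sum_congr rfl fun x hx => ?_
      rw [HasAntidiagonal.mem_antidiagonal] at hx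
      rcases Nat.eq_zero_or_pos x.2 with h2 | h2
      · rw [← hCD _ (by omega), h2, hC0]; simp
      · rw [ih x.1 (by omega) (by omega), hCD _ (by omega)]
    have h2 : (r : ℂ) • coeff r A = (r : ℂ) • coeff r B := by
      rw [Algebra.smul_def, Algebra.smul_def, map_natCast, h1]
    have h3 : (r : ℂ) ≠ 0 := Nat.cast_ne_zero.2 hpos.ne'
    simpa [smul_smul, inv_mul_cancel₀ h3] using congrArg (fun z => (r : ℂ)⁻¹ • z) h2

/-- The generating function of the plethysms `h_m[g]` (for `ε = 1`) or `e_m[g]` (for `ε = -1`),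
where `q k` is `p_{k+1}[g]`. -/
def newtonSeries (ε : ℂ) (q : ℕ → R) : R⟦X⟧ :=
  PowerSeries.mk fun m => MvPolynomial.aeval q (newtonPoly ε m)

/-- This is the Newton recursion, read as a differential equation. -/
theorem eulerOp_newtonSeries (ε : ℂ) (q : ℕ → R) :
    eulerOp R (newtonSeries ε q) = newtonSeries ε q *
      (PowerSeries.X * PowerSeries.mk fun k => ε ^ k • q k) := by
  ext n
  rw [coeff_eulerOp]
  cases n with
  | zero => simp
  | succ n =>
    rw [mul_left_comm, coeff_succ_X_mul, mul_comm (newtonSeries ε q), coeff_mul,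
      Nat.sum_antidiagonal_eq_sum_range_succ_mk]
    have := aeval_newtonPoly_succ q ε n
    rw [Algebra.smul_def, map_add, map_natCast, map_one] at this
    simp only [newtonSeries, coeff_mk]
    push_cast
    rw [this]
    refine sum_congr rfl fun k _ => ?_
    rw [smul_mul_assoc]

end EulerOperator

/-! ### Sums over partitions as coefficients of products -/

section PartitionSums

variable {R : Type*} [CommRing R]

/-- A partition corresponds to the family of the amounts j · m_j contributed by its parts of size j.
Families in which some entry is not divisible by j do not come from partitions, and their terms
vanish because the j-th factor is a series in t^j. -/
theorem sum_partition_prod (f : ℕ → ℕ → R) (n : ℕ) :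
    ∑ l : n.Partition, ∏ j ∈ Icc 1 n, f j (l.parts.count j) =
      coeff n (∏ j ∈ Icc 1 n, if hj : j = 0 then (1 : R⟦X⟧)
        else expand j hj (PowerSeries.mk (f j))) := by
  classical
  rw [coeff_prod]
  refine sum_of_injOn Nat.Partition.toFinsuppAntidiag
    (Nat.Partition.toFinsuppAntidiag_injective n).injOn ?_ ?_ ?_
  · intro l _
    exact l.toFinsuppAntidiag_mem_finsuppAntidiag
  · intro g hg hg'
    rw [mem_finsuppAntidiag] at hg
    by_contra hne
    have hdvd : ∀ j ∈ Icc 1 n, j ∣ g j := by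
      intro j hj
      by_contra hd
      refine hne (prod_eq_zero hj ?_)
      have hj0 : j ≠ 0 := by rw [mem_Icc] at hj; omega
      rw [dif_neg hj0, coeff_expand_of_not_dvd _ _ _ hd]
    apply hg'
    have hcount : ∀ i, Multiset.count i (∑ j ∈ Icc 1 n, Multiset.replicate (g j / j) j) =
        if i ∈ Icc 1 n then g i / i else 0 := by
      intro i
      rw [Multiset.count_sum']
      simp_rw [Multiset.count_replicate]
      rw [sum_ite_eq']
    refine ⟨⟨∑ j ∈ Icc 1 n, Multiset.replicate (g j / j) j, ?_, ?_⟩, mem_coe.2 (mem_univ _), ?_⟩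
    · intro i hi
      have := Multiset.count_pos.2 hi
      rw [hcount] at this
      split_ifs at this with h
      · rw [mem_Icc] at h; omega
      · omega
    · rw [← Multiset.coe_sumAddMonoidHom, map_sum]
      refine Eq.trans ?_ hg.1
      refine sum_congr rfl fun j hj => ?_
      simp only [Multiset.coe_sumAddMonoidHom, Multiset.sum_replicate, smul_eq_mul]
      exact Nat.div_mul_cancel (hdvd j hj)
    · ext i
      change Multiset.count i _ * i = g i
      rw [hcount]
      split_ifs with h
      · exact Nat.div_mul_cancel (hdvd i h)
      · have : i ∉ g.support := fun hi => h (hg.2 hi)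
        simp at this
        simp [this]
  · intro l _
    refine prod_congr rfl fun j hj => ?_
    have hj0 : j ≠ 0 := by rw [mem_Icc] at hj; omega
    rw [dif_neg hj0]
    change _ = coeff (l.parts.count j * j) _
    rw [mul_comm, coeff_expand_mul, coeff_mk]

/-- Replacing `f 1` by the indicator of multiplicity 0 removes the partitions with a part 1 and
turns the factor j = 1 into 1. -/
theorem sum_partition_prod_no_ones (f : ℕ → ℕ → R) (hf : f 1 0 = 1) (n : ℕ) :
    ∑ l : n.Partition with 1 ∉ l.parts, ∏ j ∈ Icc 1 n, f j (l.parts.count j) =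
      coeff n (∏ j ∈ Icc 2 n, if hj : j = 0 then (1 : R⟦X⟧)
        else expand j hj (PowerSeries.mk (f j))) := by
  classical
  let f' : ℕ → ℕ → R := fun j m => if j = 1 then if m = 0 then 1 else 0 else f j m
  rcases Nat.eq_zero_or_pos n with rfl | hn
  · rw [filter_true_of_mem]
    · simp
    · intro l _ h
      have := l.parts_sum
      have h1 := Multiset.le_sum_of_mem h
      omega
  have h1 := sum_partition_prod f' n
  have h2 : Icc 1 n = insert 1 (Icc 2 n) := by ext; simp; omega
  have h3 : (PowerSeries.mk (f' 1) : R⟦X⟧) = 1 := by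
    ext m; simp [f', coeff_one]
  rw [h2, prod_insert (by simp), dif_neg one_ne_zero, h3, map_one, one_mul, ← h2] at h1
  rw [sum_filter]
  have h4 : (∏ j ∈ Icc 2 n, if hj : j = 0 then (1 : R⟦X⟧)
      else expand j hj (PowerSeries.mk (f' j))) = ∏ j ∈ Icc 2 n, if hj : j = 0 then (1 : R⟦X⟧)
      else expand j hj (PowerSeries.mk (f j)) := by
    refine prod_congr rfl fun j hj => ?_
    have hj1 : j ≠ 1 := by rw [mem_Icc] at hj; omega
    simp [f', hj1]
  rw [← h4, ← h1]
  refine sum_congr rfl fun l _ => ?_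
  by_cases h : 1 ∈ l.parts
  · rw [if_neg (not_not.2 h)]
    symm
    refine prod_eq_zero (i := 1) (by simp; omega) ?_
    simp only [f', if_true]
    exact if_neg fun h' => (Multiset.count_pos.2 h).ne' h'
  · rw [if_pos h]
    refine prod_congr rfl fun j _ => ?_
    by_cases hj : j = 1
    · subst hj
      simp [f', Multiset.count_eq_zero.2 h, hf]
    · simp [f', hj]

end PartitionSums

/-! ### Sums of primitive roots of unity -/

/-- The sum of the primitive `d`-th roots of unity. -/
def primitiveSum (d : ℕ) : ℂ := ∑ z ∈ primitiveRoots d ℂ, z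

/-- Every n-th root of unity is a primitive d-th root for exactly one divisor d of n. -/
theorem sum_primitiveRoots {A : Type*} [AddCommMonoid A] {n : ℕ} (hn : n ≠ 0) {ζ : ℂ}
    (hprim : IsPrimitiveRoot ζ n) (f : ℂ → A) :
    ∑ x ∈ n.divisorsAntidiagonal, ∑ z ∈ primitiveRoots x.1 ℂ, f z =
      ∑ k ∈ range n, f (ζ ^ k) := by
  classical
  rw [Nat.sum_divisorsAntidiagonal (f := fun d _ => ∑ z ∈ primitiveRoots d ℂ, f z)]
  have : NeZero n := ⟨hn⟩
  rw [← sum_biUnion, ← IsPrimitiveRoot.nthRoots_one_eq_biUnion_primitiveRoots]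
  · have h1 : Polynomial.nthRootsFinset n (1 : ℂ) = (range n).image fun k => ζ ^ k := by
      ext z
      rw [Polynomial.mem_nthRootsFinset (Nat.pos_of_ne_zero hn), mem_image]
      constructor
      · intro hz
        obtain ⟨i, hi, rfl⟩ := hprim.eq_pow_of_pow_eq_one hz
        exact ⟨i, mem_range.2 hi, rfl⟩
      · rintro ⟨k, _, rfl⟩
        rw [← pow_mul, mul_comm k n, pow_mul, hprim.pow_eq_one, one_pow]
    rw [h1, sum_image]
    intro a ha b hb hab
    exact hprim.pow_inj (by simpa using ha) (by simpa using hb) hab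
  · intro a _ b _ hab
    exact IsPrimitiveRoot.disjoint hab

/-- All n-th roots of unity sum to 0 unless n = 1. This is the only property of the Möbius function
that is needed, so `primitiveSum` is never identified with it. -/
theorem sum_primitiveSum {n : ℕ} (hn : n ≠ 0) :
    ∑ x ∈ n.divisorsAntidiagonal, primitiveSum x.1 = if n = 1 then 1 else 0 := by
  have hprim := Complex.isPrimitiveRoot_exp n hn
  refine (sum_primitiveRoots hn hprim fun z => z).trans ?_
  split_ifs with h
  · subst h; simp
  · exact hprim.geom_sum_eq_zero (by omega)

/-- Write (-1)^e = 2 [e even] - 1. The factorizations d · e = n with e even are those of n/2, so the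
unsigned identity applies to n and to n/2. -/
theorem sum_primitiveSum_sign {n : ℕ} (hn : n ≠ 0) :
    ∑ x ∈ n.divisorsAntidiagonal, (-1) ^ x.2 * primitiveSum x.1 =
      if n = 1 then -1 else if n = 2 then 2 else 0 := by
  classical
  have h1 : ∀ x : ℕ × ℕ, (-1 : ℂ) ^ x.2 * primitiveSum x.1 =
      2 * (if 2 ∣ x.2 then primitiveSum x.1 else 0) - primitiveSum x.1 := by
    intro x
    split_ifs with h
    · rw [(even_iff_two_dvd.2 h).neg_one_pow]; ring
    · rw [(Nat.not_even_iff_odd.1 (fun h' => h (even_iff_two_dvd.1 h'))).neg_one_pow]; ring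
  rw [sum_congr rfl fun x _ => h1 x, sum_sub_distrib, sum_primitiveSum hn, ← mul_sum, ← sum_filter]
  have h2 : ∑ x ∈ n.divisorsAntidiagonal with 2 ∣ x.2, primitiveSum x.1 =
      if n = 2 then 1 else 0 := by
    by_cases hd : 2 ∣ n
    · obtain ⟨m, rfl⟩ := hd
      have hm : m ≠ 0 := by rintro rfl; simp at hn
      trans ∑ x ∈ m.divisorsAntidiagonal, primitiveSum x.1
      · symm
        refine sum_bij (fun x _ => (x.1, 2 * x.2)) ?_ ?_ ?_ ?_
        · intro x hx
          simp only [mem_filter, Nat.mem_divisorsAntidiagonal] at hx ⊢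
          refine ⟨⟨?_, hn⟩, ⟨_, rfl⟩⟩
          rw [← hx.1]; ring
        · rintro ⟨a, b⟩ _ ⟨c, d⟩ _ h
          simp only [Prod.mk.injEq] at h ⊢
          omega
        · rintro ⟨a, b⟩ h
          simp only [mem_filter, Nat.mem_divisorsAntidiagonal] at h
          obtain ⟨⟨h1, -⟩, c, rfl⟩ := h
          refine ⟨(a, c), ?_, rfl⟩
          rw [Nat.mem_divisorsAntidiagonal]
          refine ⟨?_, hm⟩
          have : 2 * (a * c) = 2 * m := by rw [← h1]; ring
          simpa using this
        · intro x _; rfl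
      · rw [sum_primitiveSum hm]
        congr 1
        exact propext ⟨fun h => by omega, fun h => by omega⟩
    · rw [filter_false_of_mem, sum_empty, if_neg (by rintro rfl; exact hd (dvd_refl 2))]
      intro x hx h
      rw [Nat.mem_divisorsAntidiagonal] at hx
      exact hd (hx.1 ▸ h.mul_left _)
  rw [h2]
  split_ifs <;> first | omega | norm_num

end

section

open Finset PowerSeries

/-! ### The generating functions of the hat characters -/

/-- Both sides run over the factorizations r = d · e · k, grouped by d · e on the left and by d · k
on the right. In the second grouping the power sum p_(dk)^e is constant in the inner sum. -/
theorem sum_divisors_swap {A : Type*} [AddCommMonoid A] (Φ : ℕ → ℕ → ℕ → A) (r : ℕ) :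
    ∑ y ∈ r.divisorsAntidiagonal, ∑ x ∈ y.1.divisorsAntidiagonal, Φ y.2 x.1 x.2 =
      ∑ y ∈ r.divisorsAntidiagonal, ∑ x ∈ y.1.divisorsAntidiagonal, Φ x.2 x.1 y.2 := by
  rw [sum_sigma', sum_sigma']
  refine sum_nbij' (fun z => ⟨(z.2.1 * z.1.2, z.2.2), (z.2.1, z.1.2)⟩)
    (fun z => ⟨(z.2.1 * z.1.2, z.2.2), (z.2.1, z.1.2)⟩) ?_ ?_ ?_ ?_ ?_
  · rintro ⟨⟨j, k⟩, ⟨d, e⟩⟩ h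
    simp only [mem_sigma, Nat.mem_divisorsAntidiagonal] at h ⊢
    obtain ⟨⟨h1, h2⟩, h3, h4⟩ := h
    subst h3 h1
    simp only [mul_ne_zero_iff] at h2 ⊢
    exact ⟨⟨by ring, h2⟩, trivial, h2.1.1, h2.2⟩
  · rintro ⟨⟨j, k⟩, ⟨d, e⟩⟩ h
    simp only [mem_sigma, Nat.mem_divisorsAntidiagonal] at h ⊢
    obtain ⟨⟨h1, h2⟩, h3, h4⟩ := h
    subst h3 h1
    simp only [mul_ne_zero_iff] at h2 ⊢
    exact ⟨⟨by ring, h2⟩, trivial, h2.1.1, h2.2⟩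
  · rintro ⟨⟨j, k⟩, ⟨d, e⟩⟩ h
    simp only [mem_sigma, Nat.mem_divisorsAntidiagonal] at h ⊢
    obtain ⟨-, rfl, -⟩ := h
    rfl
  · rintro ⟨⟨j, k⟩, ⟨d, e⟩⟩ h
    simp only [mem_sigma, Nat.mem_divisorsAntidiagonal] at h ⊢
    obtain ⟨-, rfl, -⟩ := h
    rfl
  · rintro ⟨⟨j, k⟩, ⟨d, e⟩⟩ h
    rfl

/-- The power sums `p_{k+1}[g]`. -/
def psumPlethysm (g : Series) (k : ℕ) : Series :=
  MvPowerSeries.expand (k + 1) (Nat.succ_ne_zero k) g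

/-- The coefficient of the logarithmic derivative of the generating function of
`∏_j h_{m_j}[g_j]` (or `e_{m_j}` when `ε j = -1`) when
`j g_j = ∑_{d ∣ j} η j (j / d) r(d) p_d^{j/d}` for the sums `r(d)` of primitive roots. -/
def logCoeff (ε : ℕ → ℂ) (η : ℕ → ℕ → ℂ) (j k : ℕ) : Series :=
  ∑ x ∈ j.divisorsAntidiagonal, (ε j ^ (k - 1) * (η j x.2 * primitiveSum x.1)) •
    psum (k * x.1) ^ x.2

/-- The generating function of `∏_{j ≥ 2} h_{m_j}[g_j]` over partitions without parts `1`. -/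
def hatSeries (ε : ℕ → ℂ) (g : ℕ → Series) : PowerSeries Series :=
  PowerSeries.mk fun n => coeff n (∏ j ∈ Icc 2 n, if hj : j = 0 then (1 : PowerSeries Series)
        else expand j hj (newtonSeries (ε j) (psumPlethysm (g j))))

theorem newtonSeries_psum :
    newtonSeries 1 (fun k => psum (k + 1)) = PowerSeries.mk fun m => hsymm (m : ℕ) := by
  ext m
  simp [newtonSeries, aeval_newtonPoly_one]

theorem primitiveSum_one : primitiveSum 1 = 1 := by simp [primitiveSum]

/-- The normalizations `hε` and `hη` make j = 1 contribute p_r in degree r, which is the logarithmic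
derivative of H(t). Multiplication by H(t) therefore completes the product over j ≥ 2, and the claim
follows by comparing logarithmic derivatives. -/
theorem hsymm_mul_hatSeries {ε : ℕ → ℂ} {η : ℕ → ℕ → ℂ} {g : ℕ → Series}
    (hε : ε 1 = 1) (hη : η 1 1 = 1)
    (hg : ∀ j : ℕ, 1 ≤ j → (j : ℂ) • g j =
      ∑ x ∈ j.divisorsAntidiagonal, (η j x.2 * primitiveSum x.1) • psum x.1 ^ x.2)
    {A D : PowerSeries Series} (hA : eulerOp Series A = A * D) (hA0 : coeff 0 A = 1)
    (hD0 : coeff 0 D = 0)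
    (hD : ∀ r, 1 ≤ r → coeff r D = ∑ y ∈ r.divisorsAntidiagonal, logCoeff ε η y.1 y.2) :
    (PowerSeries.mk fun m => hsymm (m : ℕ)) * hatSeries ε g = A := by
  let P : ℕ → PowerSeries Series := fun n => ∏ j ∈ Icc 2 n, if hj : j = 0 then
    (1 : PowerSeries Series) else expand j hj (newtonSeries (ε j) (psumPlethysm (g j)))
  let G : ℕ → PowerSeries Series := fun j => if hj : j = 0 then 0 else (j : Series) •
    expand j hj (PowerSeries.X * PowerSeries.mk fun k => ε j ^ k • psumPlethysm (g j) k)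
  have hP : ∀ n, eulerOp Series (P n) = P n * ∑ j ∈ Icc 2 n, G j := by
    intro n
    refine eulerOp_prod _ _ _ fun j hj => ?_
    have hj0 : j ≠ 0 := by rw [mem_Icc] at hj; omega
    simp only [G, dif_neg hj0]
    exact eulerOp_expand hj0 (eulerOp_newtonSeries _ _)
  have hG : ∀ j, 1 ≤ j → ∀ r, coeff r (G j) =
      if r ≠ 0 ∧ j ∣ r then logCoeff ε η j (r / j) else 0 := by
    intro j hj r
    have hj0 : j ≠ 0 := by omega
    simp only [G, dif_neg hj0]
    by_cases hd : j ∣ r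
    swap
    · rw [coeff_smul, coeff_expand_of_not_dvd _ _ _ hd, smul_zero, if_neg (by tauto)]
    obtain ⟨k, rfl⟩ := hd
    rw [coeff_smul, coeff_expand_mul]
    rcases k with _ | k
    · simp
    rw [coeff_succ_X_mul, coeff_mk, if_pos ⟨by positivity, dvd_mul_right _ _⟩,
      Nat.mul_div_cancel_left _ (by omega)]
    -- The factor j from the substitution t ↦ t^j is absorbed into j g_j, for which `hg` gives the
    -- power sum expansion.
    have h1 : (j : Series) • (ε j ^ k • psumPlethysm (g j) k) =
        ε j ^ k • psumPlethysm ((j : ℂ) • g j) k := by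
      rw [psumPlethysm, psumPlethysm, map_smul, smul_comm, smul_eq_mul, Algebra.smul_def (j : ℂ),
        map_natCast]
    rw [h1, hg j hj, psumPlethysm, map_sum, smul_sum, logCoeff]
    refine sum_congr rfl fun x _ => ?_
    rw [map_smul, map_pow, expand_psum, smul_smul]
    rfl
  have hG0 : ∀ n, coeff 0 (∑ j ∈ Icc 2 n, G j) = 0 := by
    intro n
    rw [map_sum]
    refine sum_eq_zero fun j hj => ?_
    rw [hG j (by rw [mem_Icc] at hj; omega)]
    simp
  have hlog : ∀ n r, 1 ≤ r → r ≤ n → coeff r (∑ j ∈ Icc 2 n, G j) =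
      (∑ y ∈ r.divisorsAntidiagonal, logCoeff ε η y.1 y.2) - psum r := by
    intro n r hr hrn
    have h1 : logCoeff ε η 1 r = psum r := by
      simp [logCoeff, hε, hη, primitiveSum_one]
    have h2 : ∑ j ∈ Icc 1 n, coeff r (G j) =
        ∑ y ∈ r.divisorsAntidiagonal, logCoeff ε η y.1 y.2 := by
      rw [Nat.sum_divisorsAntidiagonal (f := fun j k => logCoeff ε η j k)]
      have : r.divisors = (Icc 1 n).filter (· ∣ r) := by
        ext j
        simp only [Nat.mem_divisors, mem_filter, mem_Icc]
        constructor
        · intro h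
          have := Nat.le_of_dvd (by omega) h.1
          have := Nat.pos_of_dvd_of_pos h.1 (by omega)
          exact ⟨⟨by omega, by omega⟩, h.1⟩
        · intro h
          exact ⟨h.2, by omega⟩
      rw [this, sum_filter]
      refine sum_congr rfl fun j hj => ?_
      rw [hG j (by rw [mem_Icc] at hj; omega)]
      have : r ≠ 0 := by omega
      simp [this]
    have h3 : Icc 1 n = insert 1 (Icc 2 n) := by ext; simp; omega
    rw [h3, sum_insert (by simp), hG 1 le_rfl, if_pos ⟨by omega, one_dvd _⟩, Nat.div_one, h1] at h2
    rw [← h2, map_sum]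
    ring
  have hP0 : ∀ n, coeff 0 (P n) = 1 := by
    intro n
    simp only [P]
    rw [coeff_zero_eq_constantCoeff_apply, map_prod]
    refine prod_eq_one fun j hj => ?_
    have hj0 : j ≠ 0 := by rw [mem_Icc] at hj; omega
    rw [dif_neg hj0, constantCoeff_expand]
    simp [newtonSeries, newtonPoly]
  -- The n-th coefficient of `hatSeries` uses its own finite product. Parts larger than b do not
  -- affect degree b, so one product `P n` serves all degrees up to n.
  have hstab : ∀ n b, b ≤ n → coeff b (P b) = coeff b (P n) := by
    intro n b hb
    refine eq_of_eulerOp (hP b) (hP n) (by rw [hP0, hP0]) (hG0 b) b ?_ b le_rfl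
    intro r hr
    rcases Nat.eq_zero_or_pos r with rfl | h
    · rw [hG0, hG0]
    · rw [hlog b r h hr, hlog n r h (hr.trans hb)]
  ext1 n
  trans coeff n ((PowerSeries.mk fun m => hsymm (m : ℕ)) * P n)
  · rw [coeff_mul, coeff_mul]
    refine sum_congr rfl fun x hx => ?_
    rw [HasAntidiagonal.mem_antidiagonal] at hx
    rw [← hstab n x.2 (by omega), hatSeries, coeff_mk, coeff_mk]
  · have hH := eulerOp_newtonSeries (R := Series) 1 fun k => psum (k + 1)
    rw [newtonSeries_psum] at hH
    refine eq_of_eulerOp (eulerOp_mul hH (hP n)) hA ?_ ?_ n ?_ n le_rfl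
    · rw [hA0, coeff_zero_eq_constantCoeff_apply, map_mul, ← coeff_zero_eq_constantCoeff_apply,
        ← coeff_zero_eq_constantCoeff_apply, hP0, coeff_mk, mul_one]
      exact hsymm_zero
    · rw [map_add, hG0]; simp
    · intro r hr
      rw [map_add]
      rcases r with _ | r
      · rw [hG0, hD0]; simp
      · rw [hlog n _ (Nat.succ_pos _) hr, hD _ (Nat.succ_pos _), coeff_succ_X_mul, coeff_mk]
        simp

/-! ### Closed forms of the two generating functions -/

theorem eulerOp_geometric {R : Type*} [CommRing R] (p : R) :
    eulerOp R (PowerSeries.mk fun r => p ^ r) =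
      (PowerSeries.mk fun r => p ^ r) * PowerSeries.mk fun r => if r = 0 then 0 else p ^ r := by
  ext n
  rw [coeff_eulerOp, coeff_mul, coeff_mk, Nat.sum_antidiagonal_eq_sum_range_succ_mk,
    ← sum_range_reflect]
  rw [sum_range_succ']
  have : ∀ k ∈ range n, coeff (n + 1 - 1 - (k + 1)) (PowerSeries.mk fun r => p ^ r) *
      coeff (n - (n + 1 - 1 - (k + 1))) (PowerSeries.mk fun r => if r = 0 then 0 else p ^ r) =
      p ^ n := by
    intro k hk
    rw [mem_range] at hk
    rw [coeff_mk, coeff_mk, if_neg (by omega), ← pow_add]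
    congr 1; omega
  rw [sum_congr rfl this]
  simp

theorem eulerOp_one_add_mul_X_sq {R : Type*} [CommRing R] (p : R) :
    eulerOp R (1 + PowerSeries.C p * PowerSeries.X ^ 2) =
      (1 + PowerSeries.C p * PowerSeries.X ^ 2) *
        PowerSeries.mk fun r => if r ≠ 0 ∧ 2 ∣ r then 2 * (-1) ^ (r / 2 + 1) * p ^ (r / 2) else 0 := by
  ext n
  rw [coeff_eulerOp, add_mul, one_mul, map_add, map_add, mul_assoc, coeff_C_mul, coeff_C_mul,
    coeff_X_pow, coeff_one, coeff_mk, coeff_X_pow_mul', coeff_mk]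
  by_cases h2 : 2 ∣ n
  swap
  · have : n ≠ 2 := by rintro rfl; exact h2 (dvd_refl 2)
    have h3 : n ≠ 0 := by rintro rfl; exact h2 (dvd_zero 2)
    rw [if_neg this, if_neg h3, if_neg (by tauto)]
    split_ifs with h4 h5
    · exact absurd ((Nat.dvd_sub_iff_left h4 (dvd_refl 2)).1 h5.2) h2
    · simp
    · simp
  obtain ⟨m, rfl⟩ := h2
  rcases m with _ | _ | m
  · simp
  · simp
  · rw [if_neg (by omega), if_neg (by omega), if_pos ⟨by omega, dvd_mul_right _ _⟩,
      if_pos (by omega), if_pos ⟨by omega, by omega⟩, show (2 * (m + 1 + 1) - 2) / 2 = m + 1 by omega,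
      Nat.mul_div_cancel_left _ (by norm_num)]
    ring

/-- The signs of the Whitney characters: `h` for odd parts and `e` for even parts. -/
def whitneySign (j : ℕ) : ℂ := (-1) ^ (j + 1)

/-- After regrouping by n = d · k, the inner sum of primitive roots vanishes unless n = 1, and only
p_1^r is left: the logarithmic derivative of 1/(1 - p_1 t). -/
theorem hsymm_mul_hatSeries_lie {g : ℕ → Series}
    (hg : ∀ j : ℕ, 1 ≤ j → (j : ℂ) • g j =
      ∑ x ∈ j.divisorsAntidiagonal, primitiveSum x.1 • psum x.1 ^ x.2) :
    (PowerSeries.mk fun m => hsymm (m : ℕ)) * hatSeries (fun _ => 1) g =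
      PowerSeries.mk fun r => psum 1 ^ r := by
  refine hsymm_mul_hatSeries (η := fun _ _ => 1) rfl rfl (by simpa using hg)
    (eulerOp_geometric (psum 1)) (by simp) (by simp) fun r hr => ?_
  rw [coeff_mk, if_neg (by omega)]
  simp only [logCoeff, one_pow, one_mul]
  rw [sum_divisors_swap (fun k d e => primitiveSum d • psum (k * d) ^ e)]
  have : ∀ y ∈ r.divisorsAntidiagonal, (∑ x ∈ y.1.divisorsAntidiagonal,
      primitiveSum x.1 • psum (x.2 * x.1) ^ y.2) = if y = (1, r) then psum 1 ^ r else 0 := by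
    rintro ⟨n, e⟩ hy
    have hy' := Nat.mem_divisorsAntidiagonal.1 hy
    have h1 : ∀ x ∈ n.divisorsAntidiagonal, primitiveSum x.1 • psum (x.2 * x.1) ^ e =
        primitiveSum x.1 • psum n ^ e := by
      intro x hx
      rw [mul_comm, (Nat.mem_divisorsAntidiagonal.1 hx).1]
    have hn : n ≠ 0 := by rintro rfl; simp at hy'; omega
    rw [sum_congr rfl h1, ← sum_smul, sum_primitiveSum hn]
    by_cases h : n = 1
    · subst h
      have : e = r := by simpa using hy'.1
      simp [this]
    · simp [h]
  rw [sum_congr rfl this, sum_ite_eq', if_pos]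
  rw [Nat.mem_divisorsAntidiagonal]
  simp; omega

/-- With the signs, the inner sum survives for n = 1 and for n = 2. The second contribution is the
logarithmic derivative of 1 + p_2 t^2. -/
theorem hsymm_mul_hatSeries_whitney {g : ℕ → Series}
    (hg : ∀ j : ℕ, 1 ≤ j → (j : ℂ) • g j =
      ∑ x ∈ j.divisorsAntidiagonal, ((-1) ^ (j + x.2) * primitiveSum x.1) • psum x.1 ^ x.2) :
    (PowerSeries.mk fun m => hsymm (m : ℕ)) * hatSeries whitneySign g =
      (1 + PowerSeries.C (psum 2) * PowerSeries.X ^ 2) * PowerSeries.mk fun r => psum 1 ^ r := by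
  refine hsymm_mul_hatSeries (η := fun j e => (-1) ^ (j + e)) (by simp [whitneySign]) (by simp) hg
    (eulerOp_mul (eulerOp_one_add_mul_X_sq (psum 2)) (eulerOp_geometric (psum 1)))
    (by simp) (by simp) fun r hr => ?_
  rw [map_add, coeff_mk, coeff_mk, if_neg (show ¬ r = 0 by omega)]
  simp only [logCoeff]
  -- With j = de, the exponent (j + 1)(k - 1) + j + e has the parity of dke + e + 1 + k. Once dk and
  -- e are fixed, only (-1)^k varies.
  have h0 : ∀ y ∈ r.divisorsAntidiagonal, (∑ x ∈ y.1.divisorsAntidiagonal,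
      (whitneySign y.1 ^ (y.2 - 1) * ((-1) ^ (y.1 + x.2) * primitiveSum x.1)) •
        psum (y.2 * x.1) ^ x.2) = ∑ x ∈ y.1.divisorsAntidiagonal,
      ((-1 : ℂ) ^ (x.1 * y.2 * x.2 + x.2 + 1) * ((-1) ^ y.2 * primitiveSum x.1)) •
        psum (y.2 * x.1) ^ x.2 := by
    intro y hy
    have hy' := Nat.mem_divisorsAntidiagonal.1 hy
    refine sum_congr rfl fun x hx => ?_
    have hx' := Nat.mem_divisorsAntidiagonal.1 hx
    congr 1
    rw [whitneySign, ← pow_mul, ← mul_assoc, ← mul_assoc, ← pow_add, ← pow_add]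
    congr 1
    obtain ⟨k, hk⟩ : ∃ k, y.2 = k + 1 := ⟨y.2 - 1, by
      have : y.2 ≠ 0 := by intro h; rw [h] at hy'; simp at hy'; omega
      omega⟩
    rw [← hx'.1, hk, Nat.add_sub_cancel]
    refine neg_one_pow_congr ?_
    simp only [parity_simps]
    tauto
  rw [sum_congr rfl h0, sum_divisors_swap (fun k d e =>
    ((-1 : ℂ) ^ (d * k * e + e + 1) * ((-1) ^ k * primitiveSum d)) • psum (k * d) ^ e)]
  have : ∀ y ∈ r.divisorsAntidiagonal, (∑ x ∈ y.1.divisorsAntidiagonal,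
      ((-1 : ℂ) ^ (x.1 * x.2 * y.2 + y.2 + 1) * ((-1) ^ x.2 * primitiveSum x.1)) •
        psum (x.2 * x.1) ^ y.2) = (if y = (1, r) then psum 1 ^ r else 0) +
        if y = (2, r / 2) then 2 * (-1) ^ (r / 2 + 1) * psum 2 ^ (r / 2) else 0 := by
    rintro ⟨n, e⟩ hy
    have hy' := Nat.mem_divisorsAntidiagonal.1 hy
    have h1 : ∀ x ∈ n.divisorsAntidiagonal,
        ((-1 : ℂ) ^ (x.1 * x.2 * e + e + 1) * ((-1) ^ x.2 * primitiveSum x.1)) •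
          psum (x.2 * x.1) ^ e =
        ((-1 : ℂ) ^ (n * e + e + 1) * ((-1) ^ x.2 * primitiveSum x.1)) • psum n ^ e := by
      intro x hx
      rw [mul_comm x.2, (Nat.mem_divisorsAntidiagonal.1 hx).1]
    have hn : n ≠ 0 := by rintro rfl; simp at hy'; omega
    rw [sum_congr rfl h1, ← sum_smul, ← mul_sum, sum_primitiveSum_sign hn]
    by_cases h : n = 1
    · subst h
      have : e = r := by simpa using hy'.1
      subst this
      have h2 : (-1 : ℂ) ^ (1 * e + e + 1) = -1 := by
        rw [Odd.neg_one_pow]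
        exact ⟨e, by ring⟩
      simp only [h2]
      simp
    · by_cases h2 : n = 2
      · subst h2
        have : e = r / 2 := by omega
        rw [← this]
        have h3 : (-1 : ℂ) ^ (2 * e + e + 1) = (-1) ^ (e + 1) :=
          neg_one_pow_congr (by simp [parity_simps])
        rw [if_neg h, if_pos rfl, h3, if_neg (by simp), if_pos rfl, zero_add, mul_comm, mul_smul,
          Algebra.smul_def, Algebra.smul_def, map_ofNat]
        simp [mul_assoc]
      · simp [h, h2]
  have hr1 : (1, r) ∈ r.divisorsAntidiagonal := by
    rw [Nat.mem_divisorsAntidiagonal]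
    simp; omega
  have hr2 : (2, r / 2) ∈ r.divisorsAntidiagonal ↔ r ≠ 0 ∧ 2 ∣ r := by
    rw [Nat.mem_divisorsAntidiagonal]
    simp only
    omega
  rw [sum_congr rfl this, sum_add_distrib, sum_ite_eq', sum_ite_eq', if_pos hr1, add_comm]
  simp only [hr2]

end

section

open Finset Equiv

/-! ### Colourings fixed by a permutation -/

theorem comp_eq_of_sameCycle {α β : Type*} {w : Perm α} {c : α → β} (hc : c ∘ w = c) {x y : α}
    (h : w.SameCycle x y) : c x = c y := by
  obtain ⟨k, rfl⟩ := h
  have h1 : ∀ x, c (w x) = c x := fun x => congrFun hc x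
  have h2 : ∀ x, c (w⁻¹ x) = c x := fun x => by
    rw [← h1 (w⁻¹ x), ← Perm.mul_apply, mul_inv_cancel, Perm.one_apply]
  induction k with
  | zero => simp
  | succ k ih => rw [add_comm, zpow_add, Perm.mul_apply, zpow_one, h1]; exact ih
  | pred k ih => rw [sub_eq_add_neg, add_comm, zpow_add, Perm.mul_apply, zpow_neg_one, h2]; exact ih

section Colourings

variable {α : Type*} [Fintype α] [DecidableEq α]

theorem prod_parts_partition {R : Type*} [CommMonoid R] (w : Perm α) (P : ℕ → R) :
    (w.partition.parts.map P).prod =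
      (∏ c ∈ w.cycleFactorsFinset, P c.support.card) * P 1 ^ (Fintype.card α - w.support.card) := by
  rw [Perm.parts_partition, Multiset.map_add, Multiset.prod_add, Multiset.map_replicate,
    Multiset.prod_replicate, Perm.cycleType_def, Multiset.map_map]
  rfl

/-- The cycle, possibly a fixed point, of a permutation that contains a given element. -/
def cycleRep (w : Perm α) (x : α) :
    {c : Perm α // c ∈ w.cycleFactorsFinset} ⊕ {x : α // w x = x} :=
  if h : w x = x then Sum.inr ⟨x, h⟩
  else Sum.inl ⟨w.cycleOf x, Perm.cycleOf_mem_cycleFactorsFinset_iff.2 (Perm.mem_support.2 h)⟩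

theorem cycleRep_eq_inl {w : Perm α} {x : α} {c : {c : Perm α // c ∈ w.cycleFactorsFinset}} :
    cycleRep w x = Sum.inl c ↔ x ∈ (c : Perm α).support := by
  obtain ⟨c, hc⟩ := c
  unfold cycleRep
  split_ifs with h
  · simp only [false_iff]
    intro hx
    exact Perm.mem_support.1 (Perm.mem_cycleFactorsFinset_support_le hc hx) h
  · simp only [Sum.inl.injEq, Subtype.mk.injEq]
    constructor
    · rintro rfl
      rw [Perm.mem_support_cycleOf_iff]
      exact ⟨Perm.SameCycle.refl _ _, Perm.mem_support.2 h⟩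
    · intro hx
      exact (Perm.cycle_is_cycleOf hx hc).symm

theorem cycleRep_eq_inr {w : Perm α} {x : α} {y : {x : α // w x = x}} :
    cycleRep w x = Sum.inr y ↔ x = y := by
  obtain ⟨y, hy⟩ := y
  unfold cycleRep
  split_ifs with h
  · simp
  · simp only [false_iff]
    rintro rfl
    exact h hy

theorem cycleRep_surjective (w : Perm α) : Function.Surjective (cycleRep w) := by
  rintro (⟨c, hc⟩ | y)
  · obtain ⟨x, hx⟩ : c.support.Nonempty :=
      (Perm.mem_cycleFactorsFinset_iff.1 hc).1.nonempty_support
    exact ⟨x, cycleRep_eq_inl.2 hx⟩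
  · exact ⟨y, cycleRep_eq_inr.2 rfl⟩

/-- With `cycleRep_comp`, this identifies the colourings fixed by w with arbitrary colourings of its
set of cycles. -/
theorem sameCycle_of_cycleRep_eq {w : Perm α} {x y : α} (h : cycleRep w x = cycleRep w y) :
    w.SameCycle x y := by
  rcases hy : cycleRep w y with c | z
  · rw [hy] at h
    rw [cycleRep_eq_inl] at h hy
    have hc := (Perm.mem_cycleFactorsFinset_iff.1 c.2)
    have h1 : w.cycleOf x = c := (Perm.cycle_is_cycleOf h c.2).symm
    have h2 : y ∈ (w.cycleOf x).support := by rw [h1]; exact hy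
    exact (Perm.mem_support_cycleOf_iff.1 h2).1
  · rw [hy] at h
    rw [cycleRep_eq_inr] at h hy
    rw [h, hy]

theorem cycleRep_comp (w : Perm α) : cycleRep w ∘ w = cycleRep w := by
  funext x
  rw [Function.comp_apply]
  rcases hy : cycleRep w x with c | z
  · rw [cycleRep_eq_inl] at hy ⊢
    have hc := (Perm.mem_cycleFactorsFinset_iff.1 c.2)
    rw [← hc.2 x hy]
    exact Perm.apply_mem_support.2 hy
  · rw [cycleRep_eq_inr] at hy ⊢
    rw [hy, z.2]

/-- The power sum products count the colourings that are fixed by a permutation. -/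
theorem sum_fixed_colourings {β R : Type*} [Fintype β] [DecidableEq β] [CommSemiring R]
    (w : Perm α) (x : β → R) :
    ∑ c : α → β with c ∘ w = c, ∏ i, x (c i) =
      (w.partition.parts.map fun k => ∑ b, x b ^ k).prod := by
  classical
  let ι := {c : Perm α // c ∈ w.cycleFactorsFinset} ⊕ {x : α // w x = x}
  have h1 : ∑ c : α → β with c ∘ w = c, ∏ i, x (c i) =
      ∑ d : ι → β, ∏ i, x (d (cycleRep w i)) := by
    symm
    refine sum_bij (fun d _ => d ∘ cycleRep w) ?_ ?_ ?_ ?_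
    · intro d _
      rw [mem_filter]
      exact ⟨mem_univ _, by rw [Function.comp_assoc, cycleRep_comp]⟩
    · intro d _ d' _ h
      exact (cycleRep_surjective w).injective_comp_right h
    · intro c hc
      rw [mem_filter] at hc
      refine ⟨c ∘ Function.surjInv (cycleRep_surjective w), mem_univ _, ?_⟩
      funext i
      exact comp_eq_of_sameCycle hc.2
        (sameCycle_of_cycleRep_eq (Function.surjInv_eq (cycleRep_surjective w) _))
    · intro d _
      rfl
  -- A cycle of length k with colour b contributes x_b^k. Summing over the independent colours of
  -- the cycles gives the product of power sums.
  have h2 : ∀ d : ι → β, ∏ i, x (d (cycleRep w i)) =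
      ∏ o : ι, x (d o) ^ (univ.filter fun i => cycleRep w i = o).card := by
    intro d
    rw [← prod_fiberwise univ (cycleRep w)]
    refine prod_congr rfl fun o _ => ?_
    rw [← prod_const]
    refine prod_congr rfl fun i hi => ?_
    rw [(mem_filter.1 hi).2]
  rw [h1, sum_congr rfl fun d _ => h2 d, ← Fintype.piFinset_univ,
    ← prod_univ_sum (fun _ => univ)
      (fun (o : ι) b => x b ^ (univ.filter fun i => cycleRep w i = o).card),
    Fintype.prod_sum_type, prod_parts_partition,
    ← prod_coe_sort w.cycleFactorsFinset]
  congr 1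
  · refine prod_congr rfl fun c _ => ?_
    refine sum_congr rfl fun b _ => ?_
    congr 2
    ext i
    simp [cycleRep_eq_inl]
  · have h3 : Fintype.card {x : α // w x = x} = Fintype.card α - w.support.card := by
      rw [Fintype.card_subtype, ← card_compl]
      congr 1
      ext i
      simp
    rw [← h3, ← card_univ, ← prod_const]
    refine prod_congr rfl fun y _ => ?_
    refine sum_congr rfl fun b _ => ?_
    congr 1
    rw [card_eq_one]
    refine ⟨y, ?_⟩
    ext i
    simp [cycleRep_eq_inr]

end Colourings

end

section

open Finset Equiv

/-! ### The Frobenius characteristic -/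

/-- The product of the power sums of the cycle lengths of a permutation. -/
def cyclePsum {n : ℕ} (w : Perm (Fin n)) : Series := (w.partition.parts.map psum).prod

theorem ch_eq (n : ℕ) (f : Perm (Fin n) → ℂ) :
    ch n f = ((n.factorial : ℂ)⁻¹) • ∑ w, f w • cyclePsum w := rfl

/-- The number of times that each colour occurs in a colouring. -/
def content {n : ℕ} {β : Type*} (c : Fin n → β) : β →₀ ℕ := ∑ i, Finsupp.single (c i) 1

theorem content_apply {n : ℕ} {β : Type*} [DecidableEq β] (c : Fin n → β) (b : β) :
    content c b = (univ.filter fun i => c i = b).card := by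
  rw [content, Finsupp.finsetSum_apply, card_filter]
  exact sum_congr rfl fun i _ => Finsupp.single_apply

theorem content_comp_perm {n : ℕ} {β : Type*} (c : Fin n → β) (w : Perm (Fin n)) :
    content (c ∘ w) = content c :=
  Equiv.sum_comp w fun i => Finsupp.single (c i) 1

/-- The character of the permutation representation on the colourings of content `a`. -/
def colouringChar {n M : ℕ} (a : Fin M →₀ ℕ) (w : Perm (Fin n)) : ℂ :=
  ((univ.filter fun c : Fin n → Fin M => c ∘ w = c ∧ content c = a).card : ℂ)

theorem truncVars_cyclePsum {n : ℕ} (M : ℕ) (w : Perm (Fin n)) :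
    truncVars M (cyclePsum w) =
      ∑ c : Fin n → Fin M with c ∘ w = c, MvPowerSeries.monomial (content c) (1 : ℂ) := by
  have h1 : ∀ c : Fin n → Fin M, MvPowerSeries.monomial (content c) (1 : ℂ) =
      ∏ i, MvPowerSeries.X (R := ℂ) (c i) := by
    intro c
    simp_rw [MvPowerSeries.X]
    rw [MvPowerSeries.prod_monomial]
    simp [content]
  simp_rw [h1]
  rw [sum_fixed_colourings, cyclePsum, map_multiset_prod, Multiset.map_map]
  congr 1
  refine Multiset.map_congr rfl fun k hk => ?_
  exact truncVars_psum M (w.partition.parts_pos hk)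

theorem coeff_truncVars_cyclePsum {n M : ℕ} (w : Perm (Fin n)) (a : Fin M →₀ ℕ) :
    MvPowerSeries.coeff a (truncVars M (cyclePsum w)) = colouringChar a w := by
  classical
  rw [truncVars_cyclePsum, map_sum, colouringChar, ← filter_filter, card_filter, Nat.cast_sum]
  refine sum_congr rfl fun c _ => ?_
  rw [MvPowerSeries.coeff_monomial]
  push_cast
  congr 1
  exact propext eq_comm

/-- The coefficients of `ch n f` are pairings of f with permutation characters. This is the link
used for both characteristics and scalar products of characters. -/
theorem coeff_truncVars_ch {n M : ℕ} (f : Perm (Fin n) → ℂ) (a : Fin M →₀ ℕ) :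
    MvPowerSeries.coeff a (truncVars M (ch n f)) =
      (n.factorial : ℂ)⁻¹ * ∑ w, f w * colouringChar a w := by
  rw [ch_eq, map_smul, map_sum, MvPowerSeries.coeff_smul, map_sum]
  congr 1
  refine sum_congr rfl fun w _ => ?_
  rw [map_smul, MvPowerSeries.coeff_smul, coeff_truncVars_cyclePsum]

theorem ch_sum {ι : Type*} (n : ℕ) (s : Finset ι) (f : ι → Perm (Fin n) → ℂ) :
    ch n (∑ i ∈ s, f i) = ∑ i ∈ s, ch n (f i) := by
  simp only [ch_eq, Finset.sum_apply, sum_smul]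
  rw [sum_comm, smul_sum]

theorem ch_smul (n : ℕ) (a : ℂ) (f : Perm (Fin n) → ℂ) : ch n (a • f) = a • ch n f := by
  simp only [ch_eq, Pi.smul_apply, smul_assoc]
  rw [← smul_sum, smul_comm]

theorem ch_add (n : ℕ) (f g : Perm (Fin n) → ℂ) : ch n (f + g) = ch n f + ch n g := by
  simp only [ch_eq, Pi.add_apply, add_smul, sum_add_distrib, smul_add]

theorem ch_zero (n : ℕ) : ch n 0 = 0 := by simp [ch_eq]

theorem IsClassFunction.zero {G : Type} [Group G] : IsClassFunction (0 : G → ℂ) :=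
  fun _ _ => rfl

theorem IsClassFunction.add {G : Type} [Group G] {f g : G → ℂ} (hf : IsClassFunction f)
    (hg : IsClassFunction g) : IsClassFunction (f + g) := fun a b => by
  rw [Pi.add_apply, Pi.add_apply, hf, hg]

theorem IsClassFunction.smul {G : Type} [Group G] {f : G → ℂ} (hf : IsClassFunction f) (a : ℂ) :
    IsClassFunction (a • f) := fun x y => by
  rw [Pi.smul_apply, Pi.smul_apply, hf]

theorem IsClassFunction.sum {G ι : Type} [Group G] {s : Finset ι} {f : ι → G → ℂ}
    (hf : ∀ i ∈ s, IsClassFunction (f i)) : IsClassFunction (∑ i ∈ s, f i) := fun x y => by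
  rw [Finset.sum_apply, Finset.sum_apply]
  exact sum_congr rfl fun i hi => hf i hi x y

theorem IsClassFunction.apply_eq {n : ℕ} {f : Perm (Fin n) → ℂ} (hf : IsClassFunction f)
    {v w : Perm (Fin n)} (h : v.partition = w.partition) : f v = f w := by
  obtain ⟨u, rfl⟩ := isConj_iff.1 (Perm.partition_eq_of_isConj.2 h)
  exact (hf v u).symm

/-- The exponents of the power sum product of a partition, where the variable number `k` stands for
`p_{k+1}`. -/
def partsExponent (s : Multiset ℕ) : ℕ →₀ ℕ := Multiset.toFinsupp (s.map fun k => k - 1)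

theorem partsExponent_injOn {s t : Multiset ℕ} (hs : ∀ k ∈ s, 0 < k) (ht : ∀ k ∈ t, 0 < k)
    (h : partsExponent s = partsExponent t) : s = t := by
  have h1 := Multiset.toFinsupp.injective h
  have h2 : ∀ {u : Multiset ℕ}, (∀ k ∈ u, 0 < k) → (u.map fun k => k - 1).map Nat.succ = u := by
    intro u hu
    rw [Multiset.map_map]
    conv_rhs => rw [← Multiset.map_id u]
    refine Multiset.map_congr rfl fun k hk => ?_
    have := hu k hk
    simp; omega
  rw [← h2 hs, ← h2 ht, h1]

theorem aeval_monomial_partsExponent {s : Multiset ℕ} (hs : ∀ k ∈ s, 0 < k) :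
    MvPolynomial.aeval (R := ℂ) (fun k : ℕ => psum (k + 1))
      (MvPolynomial.monomial (partsExponent s) 1) = (s.map psum).prod := by
  rw [MvPolynomial.aeval_monomial, map_one, one_mul, Finsupp.prod, partsExponent,
    Multiset.toFinsupp_support]
  have : s.map psum = (s.map fun k => k - 1).map fun k => psum (k + 1) := by
    rw [Multiset.map_map]
    refine Multiset.map_congr rfl fun k hk => ?_
    have := hs k hk
    simp only [Function.comp_apply]
    rw [Nat.sub_add_cancel this]
  rw [this, Finset.prod_multiset_map_count]
  simp [Multiset.toFinsupp_apply]

/-- In the polynomial in the power sums that represents `ch n f`, the coefficient of the monomial of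
the cycle type of v is a nonzero multiple of f v. Algebraic independence lets this coefficient be
read off. -/
theorem ch_injective {n : ℕ} {f g : Perm (Fin n) → ℂ} (hf : IsClassFunction f)
    (hg : IsClassFunction g) (h : ch n f = ch n g) : f = g := by
  classical
  have key : ∀ f : Perm (Fin n) → ℂ, ch n f =
      MvPolynomial.aeval (R := ℂ) (fun k : ℕ => psum (k + 1))
        ((n.factorial : ℂ)⁻¹ • ∑ w : Perm (Fin n), f w • MvPolynomial.monomial
          (partsExponent w.partition.parts) (1 : ℂ)) := by
    intro f
    rw [ch_eq, map_smul, map_sum]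
    congr 1
    refine sum_congr rfl fun w _ => ?_
    rw [map_smul, aeval_monomial_partsExponent fun k hk => w.partition.parts_pos hk]
    rfl
  rw [key, key] at h
  have h1 := aeval_psum_injective h
  funext v
  have hcoeff : ∀ f : Perm (Fin n) → ℂ, IsClassFunction f →
      MvPolynomial.coeff (partsExponent v.partition.parts)
        ((n.factorial : ℂ)⁻¹ • ∑ w : Perm (Fin n), f w • MvPolynomial.monomial
          (partsExponent w.partition.parts) (1 : ℂ)) = (n.factorial : ℂ)⁻¹ *
          ((univ.filter fun w : Perm (Fin n) => w.partition = v.partition).card * f v) := by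
    intro f hf
    rw [MvPolynomial.coeff_smul, MvPolynomial.coeff_sum, smul_eq_mul]
    congr 1
    rw [← nsmul_eq_mul, ← sum_const, sum_filter]
    refine sum_congr rfl fun w _ => ?_
    rw [MvPolynomial.coeff_smul, MvPolynomial.coeff_monomial, smul_eq_mul]
    by_cases hw : w.partition = v.partition
    · rw [if_pos hw, if_pos (by rw [hw]), mul_one, hf.apply_eq hw]
    · rw [if_neg hw, if_neg, mul_zero]
      intro hc
      exact hw (Nat.Partition.ext (partsExponent_injOn (fun k hk => w.partition.parts_pos hk)
        (fun k hk => v.partition.parts_pos hk) hc))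
  have h2 := congrArg (MvPolynomial.coeff (partsExponent v.partition.parts)) h1
  rw [hcoeff f hf, hcoeff g hg] at h2
  have h3 : (n.factorial : ℂ)⁻¹ ≠ 0 := inv_ne_zero (Nat.cast_ne_zero.2 n.factorial_ne_zero)
  have h4 : ((univ.filter fun w : Perm (Fin n) => w.partition = v.partition).card : ℂ) ≠ 0 := by
    rw [Nat.cast_ne_zero, Finset.card_ne_zero]
    exact ⟨v, by simp⟩
  exact mul_left_cancel₀ h4 (mul_left_cancel₀ h3 h2)

/-! ### The image of the Frobenius characteristic -/

/-- The symmetric functions of degree `n`: the span of the power sum products of degree `n`. -/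
def symSpan (n : ℕ) : Submodule ℂ Series :=
  Submodule.span ℂ {F | ∃ s : Multiset ℕ, (∀ k ∈ s, 0 < k) ∧ s.sum = n ∧ F = (s.map psum).prod}

theorem mul_mem_symSpan {a b : ℕ} {F G : Series} (hF : F ∈ symSpan a) (hG : G ∈ symSpan b) :
    F * G ∈ symSpan (a + b) := by
  have h := Submodule.mul_mem_mul hF hG
  rw [symSpan, symSpan, Submodule.span_mul_span] at h
  refine Submodule.span_mono ?_ h
  rintro _ ⟨_, ⟨s, hs, hs', rfl⟩, _, ⟨t, ht, ht', rfl⟩, rfl⟩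
  refine ⟨s + t, ?_, by rw [Multiset.sum_add, hs', ht'], by simp⟩
  intro k hk
  rcases Multiset.mem_add.1 hk with h | h
  · exact hs k h
  · exact ht k h

theorem one_mem_symSpan : (1 : Series) ∈ symSpan 0 :=
  Submodule.subset_span ⟨0, by simp, rfl, by simp⟩

theorem prod_mem_symSpan {ι : Type*} (s : Finset ι) (d : ι → ℕ) (F : ι → Series)
    (h : ∀ i ∈ s, F i ∈ symSpan (d i)) : ∏ i ∈ s, F i ∈ symSpan (∑ i ∈ s, d i) := by
  classical
  induction s using Finset.induction_on with
  | empty => simpa using one_mem_symSpan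
  | insert i s hi ih =>
    rw [prod_insert hi, sum_insert hi]
    exact mul_mem_symSpan (h i (mem_insert_self _ _))
      (ih fun j hj => h j (mem_insert_of_mem hj))

theorem expand_mem_symSpan {n k : ℕ} (hk : k ≠ 0) {F : Series} (hF : F ∈ symSpan n) :
    MvPowerSeries.expand k hk F ∈ symSpan (k * n) := by
  have : symSpan n ≤ (symSpan (k * n)).comap (MvPowerSeries.expand k hk).toLinearMap := by
    refine Submodule.span_le.2 ?_
    rintro _ ⟨s, hs, hs', rfl⟩
    refine Submodule.subset_span ⟨s.map (k * ·), ?_, ?_, ?_⟩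
    · intro i hi
      obtain ⟨j, hj, rfl⟩ := Multiset.mem_map.1 hi
      exact Nat.mul_pos (Nat.pos_of_ne_zero hk) (hs j hj)
    · rw [Multiset.sum_map_mul_left, Multiset.map_id', hs']
    · simp only [AlgHom.toLinearMap_apply]
      rw [map_multiset_prod, Multiset.map_map, Multiset.map_map]
      congr 1
      exact Multiset.map_congr rfl fun j _ => expand_psum hk j
  exact this hF

/-- Homogeneity of the plethysms h_m[g_j] and e_m[g_j], by induction along the Newton recursion. It
is needed to stay away from the default value of `classFunctionOf`. -/
theorem aeval_newtonPoly_mem_symSpan {j : ℕ} {q : ℕ → Series}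
    (hq : ∀ k, q k ∈ symSpan (j * (k + 1))) (ε : ℂ) (m : ℕ) :
    MvPolynomial.aeval q (newtonPoly ε m) ∈ symSpan (j * m) := by
  induction m using Nat.strong_induction_on with
  | _ m ih =>
    rcases m with _ | m
    · simpa [newtonPoly] using one_mem_symSpan
    · have h := aeval_newtonPoly_succ q ε m
      have h3 : ((m : ℂ) + 1) ≠ 0 := by exact_mod_cast Nat.succ_ne_zero m
      rw [← Submodule.smul_mem_iff _ h3, h]
      refine Submodule.sum_mem _ fun k hk => Submodule.smul_mem _ _ ?_
      rw [mem_range] at hk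
      have h4 := mul_mem_symSpan (hq k) (ih (m - k) (by omega))
      rwa [← mul_add, show k + 1 + (m - k) = m + 1 by omega] at h4

theorem cyclePsum_mem_symSpan {n : ℕ} (w : Perm (Fin n)) : cyclePsum w ∈ symSpan n :=
  Submodule.subset_span ⟨_, fun _ hk => w.partition.parts_pos hk,
    w.partition.parts_sum.trans (Fintype.card_fin n), rfl⟩

theorem ch_mem_symSpan (n : ℕ) (f : Perm (Fin n) → ℂ) : ch n f ∈ symSpan n := by
  rw [ch_eq]
  exact Submodule.smul_mem _ _ (Submodule.sum_mem _ fun w _ =>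
    Submodule.smul_mem _ _ (cyclePsum_mem_symSpan w))

/-- The cycle type omits fixed points, so the parts equal to 1 are split off and recovered from the
size. -/
theorem exists_perm_of_parts {n : ℕ} {s : Multiset ℕ} (hs : ∀ k ∈ s, 0 < k) (hsum : s.sum = n) :
    ∃ w : Perm (Fin n), w.partition.parts = s := by
  classical
  have hadd : s.filter (2 ≤ ·) + s.filter (fun k => ¬ 2 ≤ k) = s := Multiset.filter_add_not _ _
  have hone : s.filter (fun k => ¬ 2 ≤ k) =
      Multiset.replicate (Multiset.card (s.filter (fun k => ¬ 2 ≤ k))) 1 := by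
    rw [Multiset.eq_replicate]
    refine ⟨rfl, fun b hb => ?_⟩
    rw [Multiset.mem_filter] at hb
    have := hs b hb.1
    omega
  have hsum' : (s.filter (2 ≤ ·)).sum + Multiset.card (s.filter (fun k => ¬ 2 ≤ k)) = n := by
    have h1 := congrArg Multiset.sum hadd
    rw [Multiset.sum_add, hone, Multiset.sum_replicate, hsum] at h1
    simpa using h1
  obtain ⟨w, hw⟩ := (Perm.exists_with_cycleType_iff (Fin n) (m := s.filter (2 ≤ ·))).2
    ⟨by rw [Fintype.card_fin]; omega, fun a ha => (Multiset.mem_filter.1 ha).2⟩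
  refine ⟨w, ?_⟩
  have : (s.filter (2 ≤ ·)).sum = w.support.card := by rw [← hw, Perm.sum_cycleType]
  rw [Perm.parts_partition, hw, Fintype.card_fin, ← this]
  conv_rhs => rw [← hadd, hone]
  congr 2
  omega

/-- A product of power sums is the characteristic of the indicator of one conjugacy class, scaled by
n! over the class size; linearity does the rest. -/
theorem exists_ch_eq {n : ℕ} {F : Series} (hF : F ∈ symSpan n) :
    ∃ f : Perm (Fin n) → ℂ, IsClassFunction f ∧ ch n f = F := by
  classical
  induction hF using Submodule.span_induction with
  | mem F hF =>
    obtain ⟨s, hs, hsum, rfl⟩ := hF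
    obtain ⟨v, hv⟩ := exists_perm_of_parts hs hsum
    let C := univ.filter fun w : Perm (Fin n) => w.partition = v.partition
    have hC : (C.card : ℂ) ≠ 0 := by
      rw [Nat.cast_ne_zero, Finset.card_ne_zero]
      exact ⟨v, by simp [C]⟩
    have hn : (n.factorial : ℂ) ≠ 0 := Nat.cast_ne_zero.2 n.factorial_ne_zero
    refine ⟨fun w => if w.partition = v.partition then (n.factorial : ℂ) * (C.card : ℂ)⁻¹ else 0,
      ?_, ?_⟩
    · intro g h
      have : (h * g * h⁻¹).partition = g.partition :=
        (Perm.partition_eq_of_isConj.1 (isConj_iff.2 ⟨h, rfl⟩)).symm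
      simp only [this]
    · rw [ch_eq]
      have : ∀ w : Perm (Fin n), (if w.partition = v.partition then
          (n.factorial : ℂ) * (C.card : ℂ)⁻¹ else 0) • cyclePsum w =
          if w.partition = v.partition then ((n.factorial : ℂ) * (C.card : ℂ)⁻¹) •
            (s.map psum).prod else 0 := by
        intro w
        split_ifs with h
        · rw [cyclePsum, h, hv]
        · simp
      rw [sum_congr rfl fun w _ => this w, ← sum_filter, sum_const, ← Nat.cast_smul_eq_nsmul ℂ,
        smul_smul, smul_smul]
      change ((n.factorial : ℂ)⁻¹ * (C.card : ℂ) * ((n.factorial : ℂ) * (C.card : ℂ)⁻¹)) •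
        (s.map psum).prod = (s.map psum).prod
      rw [show (n.factorial : ℂ)⁻¹ * (C.card : ℂ) * ((n.factorial : ℂ) * (C.card : ℂ)⁻¹) = 1 by
        field_simp, one_smul]
  | zero => exact ⟨0, IsClassFunction.zero, ch_zero n⟩
  | add F G _ _ h1 h2 =>
    obtain ⟨f, hf, rfl⟩ := h1
    obtain ⟨g, hg, rfl⟩ := h2
    exact ⟨f + g, hf.add hg, ch_add n f g⟩
  | smul a F _ h =>
    obtain ⟨f, hf, rfl⟩ := h
    exact ⟨a • f, hf.smul a, ch_smul n a f⟩

theorem classFunctionOf_spec {n : ℕ} {F : Series} (hF : F ∈ symSpan n) :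
    IsClassFunction (classFunctionOf n F) ∧ ch n (classFunctionOf n F) = F := by
  have h := exists_ch_eq hF
  rw [classFunctionOf, dif_pos h]
  exact h.choose_spec

/-! ### The hat characters -/

theorem sum_mul_count {n : ℕ} (l : n.Partition) : ∑ j ∈ Icc 1 n, j * l.parts.count j = n := by
  have h := (mem_finsuppAntidiag.1 l.toFinsuppAntidiag_mem_finsuppAntidiag).1
  refine Eq.trans (sum_congr rfl fun j _ => ?_) h
  exact mul_comm _ _

theorem prod_plethysm_mem_symSpan {n : ℕ} (l : n.Partition) {g : ℕ → Series}
    (hg : ∀ j, g j ∈ symSpan j) (ε : ℕ → ℂ) :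
    ∏ j ∈ Icc 1 n, MvPolynomial.aeval (psumPlethysm (g j)) (newtonPoly (ε j) (l.parts.count j)) ∈
      symSpan n := by
  have h := prod_mem_symSpan (Icc 1 n) (fun j => j * l.parts.count j)
    (fun j => MvPolynomial.aeval (psumPlethysm (g j)) (newtonPoly (ε j) (l.parts.count j)))
    fun j _ => aeval_newtonPoly_mem_symSpan (fun k => by
      rw [mul_comm]; exact expand_mem_symSpan _ (hg j)) _ _
  rwa [sum_mul_count] at h

theorem lieChar_eq {n : ℕ} (l : n.Partition) :
    lieChar l = classFunctionOf n (∏ j ∈ Icc 1 n, MvPolynomial.aeval (psumPlethysm (ell j))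
      (newtonPoly 1 (l.parts.count j))) := by
  rw [lieChar]
  congr 1
  exact prod_congr rfl fun j _ => plethysm_hsymm _ _

/-- The sign ε merges the products over odd and even parts, so that one generating function argument
covers both families of characters. -/
theorem whitneyChar_eq {n : ℕ} (l : n.Partition) :
    whitneyChar l = classFunctionOf n (∏ j ∈ Icc 1 n, MvPolynomial.aeval
      (psumPlethysm (piSymm j)) (newtonPoly (whitneySign j) (l.parts.count j))) := by
  rw [whitneyChar, ← prod_filter_mul_prod_filter_not (Icc 1 n) Odd]
  simp_rw [Nat.not_odd_iff_even]
  congr 2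
  · refine prod_congr rfl fun j hj => ?_
    rw [plethysm_hsymm, whitneySign, (mem_filter.1 hj).2.add_one.neg_one_pow]
    rfl
  · refine prod_congr rfl fun j hj => ?_
    rw [plethysm_esymm, whitneySign, (mem_filter.1 hj).2.add_one.neg_one_pow]
    rfl

theorem rank_le {n : ℕ} (l : n.Partition) : rank l ≤ n := by
  conv_rhs => rw [← l.parts_sum, ← Multiset.map_id l.parts]
  exact Multiset.sum_map_le_sum_map _ _ fun k _ => Nat.sub_le k 1

theorem sum_hatPartitions {A : Type*} [AddCommMonoid A] (n : ℕ) (f : n.Partition → A) :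
    ∑ i ∈ range (n + 1), ∑ l ∈ hatPartitions i n, f l =
      ∑ l : n.Partition with 1 ∉ l.parts, f l := by
  rw [← sum_fiberwise_of_maps_to (g := rank) (t := range (n + 1))]
  · refine sum_congr rfl fun i _ => ?_
    rw [hatPartitions, filter_filter]
  · intro l _
    exact mem_range.2 (Nat.lt_succ_of_le (rank_le l))

theorem ch_sum_hat {n : ℕ} {g : ℕ → Series} (hg : ∀ j, g j ∈ symSpan j) (ε : ℕ → ℂ)
    {f : n.Partition → Perm (Fin n) → ℂ}
    (hf : ∀ l, f l = classFunctionOf n (∏ j ∈ Icc 1 n, MvPolynomial.aeval (psumPlethysm (g j))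
      (newtonPoly (ε j) (l.parts.count j)))) :
    IsClassFunction (∑ i ∈ range (n + 1), ∑ l ∈ hatPartitions i n, f l) ∧
      ch n (∑ i ∈ range (n + 1), ∑ l ∈ hatPartitions i n, f l) =
        PowerSeries.coeff n (hatSeries ε g) := by
  rw [sum_hatPartitions]
  refine ⟨IsClassFunction.sum fun l _ => ?_, ?_⟩
  · rw [hf]
    exact (classFunctionOf_spec (prod_plethysm_mem_symSpan l hg ε)).1
  · rw [ch_sum]
    have h : ∀ l : n.Partition, ch n (f l) = ∏ j ∈ Icc 1 n,
        MvPolynomial.aeval (psumPlethysm (g j)) (newtonPoly (ε j) (l.parts.count j)) := fun l => by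
      rw [hf]
      exact (classFunctionOf_spec (prod_plethysm_mem_symSpan l hg ε)).2
    rw [sum_congr rfl fun l _ => h l, sum_partition_prod_no_ones (fun j m =>
      MvPolynomial.aeval (psumPlethysm (g j)) (newtonPoly (ε j) m)) (by simp [newtonPoly]),
      hatSeries, PowerSeries.coeff_mk]
    rfl

end

section

open Finset Equiv

/-! ### The Frobenius characteristic of the Lie characters -/

theorem cyclePsum_conj {n : ℕ} (w x : Perm (Fin n)) : cyclePsum (x * w * x⁻¹) = cyclePsum w := by
  rw [cyclePsum, cyclePsum, ← Perm.partition_eq_of_isConj.1 (isConj_iff.2 ⟨x, rfl⟩)]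

/-- Frobenius reciprocity: t and the cycle power sums are class functions, so each of the n!
conjugates of H contributes the same sum. The twist t is constant or the sign in the applications.
-/
theorem ch_mul_inducedCharacter {n : ℕ} (H : Subgroup (Perm (Fin n))) (ψ : H → ℂ)
    [Fintype H] {t : Perm (Fin n) → ℂ} (ht : IsClassFunction t) :
    ch n (fun w => t w * inducedCharacter H ψ w) =
      (Nat.card H : ℂ)⁻¹ • ∑ h : H, (t h * ψ h) • cyclePsum (h : Perm (Fin n)) := by
  classical
  rw [ch_eq]
  have h1 : ∀ w, (t w * inducedCharacter H ψ w) • cyclePsum w = (Nat.card H : ℂ)⁻¹ •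
      ∑ x : Perm (Fin n), (t w * if h : x⁻¹ * w * x ∈ H then ψ ⟨x⁻¹ * w * x, h⟩ else 0) •
        cyclePsum w := by
    intro w
    rw [← sum_smul, ← mul_sum, smul_smul, inducedCharacter]
    congr 1
    rw [mul_left_comm]
  have h2 : ∀ x : Perm (Fin n), ∑ w, (t w * if h : x⁻¹ * w * x ∈ H then ψ ⟨x⁻¹ * w * x, h⟩ else 0) •
      cyclePsum w = ∑ h : H, (t h * ψ h) • cyclePsum (h : Perm (Fin n)) := by
    intro x
    rw [← Equiv.sum_comp (MulAut.conj x).toEquiv]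
    have h3 : ∀ w, (t ((MulAut.conj x).toEquiv w) *
        if h : x⁻¹ * (MulAut.conj x).toEquiv w * x ∈ H then
          ψ ⟨x⁻¹ * (MulAut.conj x).toEquiv w * x, h⟩ else 0) •
        cyclePsum ((MulAut.conj x).toEquiv w) =
        if h : w ∈ H then (t w * ψ ⟨w, h⟩) • cyclePsum w else 0 := by
      intro w
      have h4 : (MulAut.conj x).toEquiv w = x * w * x⁻¹ := rfl
      have h5 : x⁻¹ * (x * w * x⁻¹) * x = w := by group
      rw [h4, ht, cyclePsum_conj]
      simp only [h5]
      split_ifs <;> simp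
    rw [sum_congr rfl fun w _ => h3 w]
    symm
    rw [← sum_filter_add_sum_filter_not univ (· ∈ H)]
    rw [sum_eq_zero (s := univ.filter fun w => ¬ w ∈ H), add_zero]
    · refine sum_bij (fun h _ => (h : Perm (Fin n))) ?_ ?_ ?_ ?_
      · intro h _; simp
      · intro a _ b _ h; exact Subtype.ext h
      · intro b hb; exact ⟨⟨b, (mem_filter.1 hb).2⟩, mem_univ _, rfl⟩
      · intro h _; rw [dif_pos h.2]
    · intro w hw; rw [dif_neg (mem_filter.1 hw).2]
  rw [sum_congr rfl fun w _ => h1 w, ← smul_sum, sum_comm, sum_congr rfl fun x _ => h2 x, sum_const,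
    card_univ, Fintype.card_perm, Fintype.card_fin, smul_comm, ← Nat.cast_smul_eq_nsmul ℂ,
    smul_smul (n.factorial : ℂ)⁻¹, inv_mul_cancel₀ (Nat.cast_ne_zero.2 n.factorial_ne_zero),
    one_smul]

/-- If some cycle had length smaller than the order, the corresponding power of w would fix a point
without being 1. -/
theorem parts_of_semiregular {n : ℕ} {w : Perm (Fin n)}
    (h : ∀ (m : ℕ) (x : Fin n), (w ^ m) x = x → w ^ m = 1) :
    w.partition.parts = Multiset.replicate (n / orderOf w) (orderOf w) := by
  have hall : ∀ l ∈ w.partition.parts, l = orderOf w := by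
    intro l hl
    rw [Perm.parts_partition, Multiset.mem_add] at hl
    rcases hl with hl | hl
    · refine Nat.dvd_antisymm (Perm.dvd_of_mem_cycleType hl) ?_
      rw [Perm.cycleType_def, Multiset.mem_map] at hl
      obtain ⟨c, hc, rfl⟩ := hl
      replace hc : c ∈ w.cycleFactorsFinset := hc
      have hc' := Perm.mem_cycleFactorsFinset_iff.1 hc
      obtain ⟨x, hx⟩ := hc'.1.nonempty_support
      refine orderOf_dvd_of_pow_eq_one (h _ x ?_)
      rw [← Perm.cycleOf_pow_apply_self, ← Perm.cycle_is_cycleOf hx hc]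
      simp only [Function.comp_apply]
      rw [← hc'.1.orderOf, pow_orderOf_eq_one, Perm.one_apply]
    · rw [Multiset.mem_replicate, Fintype.card_fin] at hl
      obtain ⟨hl, rfl⟩ := hl
      obtain ⟨x, hx⟩ : ∃ x, x ∉ w.support := by
        by_contra hno
        push Not at hno
        rw [Finset.eq_univ_of_forall hno, card_univ, Fintype.card_fin] at hl
        omega
      have := h 1 x (by simpa using hx)
      rw [pow_one] at this
      rw [this, orderOf_one]
  rw [Multiset.eq_replicate]
  refine ⟨?_, hall⟩
  have h1 := w.partition.parts_sum.trans (Fintype.card_fin n)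
  rw [Multiset.eq_replicate_of_mem hall, Multiset.sum_replicate, smul_eq_mul] at h1
  exact (Nat.div_eq_of_eq_mul_left (orderOf_pos w) h1.symm).symm

theorem sign_eq_neg_one_pow {n : ℕ} (w : Perm (Fin n)) :
    ((Perm.sign w : ℤ) : ℂ) = (-1) ^ (n + Multiset.card w.partition.parts) := by
  rw [Perm.sign_of_cycleType, Perm.parts_partition, Multiset.card_add, Multiset.card_replicate,
    Perm.sum_cycleType, Fintype.card_fin]
  push_cast
  refine neg_one_pow_congr ?_
  have : w.support.card ≤ n := by simpa using w.support.card_le_univ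
  obtain ⟨k, hk⟩ := Nat.exists_eq_add_of_le this
  have hk' : n - w.support.card = k := by omega
  rw [hk']
  have : Even n ↔ Even (w.support.card + k) := by rw [← hk]
  simp only [parity_simps] at this ⊢
  tauto

theorem orderOf_finRotate {n : ℕ} (hn : n ≠ 0) : orderOf (finRotate n) = n := by
  match n with
  | 1 => exact orderOf_eq_one_iff.2 (Subsingleton.elim _ _)
  | n + 2 => rw [isCycle_finRotate.orderOf, support_finRotate, card_univ, Fintype.card_fin]

theorem finRotate_semiregular {n : ℕ} (m : ℕ) (x : Fin n) (h : (finRotate n ^ m) x = x) :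
    finRotate n ^ m = 1 := by
  match n with
  | 0 => exact x.elim0
  | 1 => exact Subsingleton.elim _ _
  | n + 2 =>
    refine (isCycle_finRotate.pow_eq_one_iff' (x := x) ?_).2 h
    rw [← Perm.mem_support, support_finRotate]
    exact mem_univ x

/-- The power c^k and the root ζ^k have the same order d, and c^k consists of n/d cycles of length
d. The sum over the cyclic group is thus a sum over the n-th roots of unity, grouped by exact order.
-/
theorem ch_mul_lieCharacter {n : ℕ} (hn : n ≠ 0) {t : Perm (Fin n) → ℂ} (ht : IsClassFunction t)
    {η : ℕ → ℂ} (htη : ∀ w, t w = η (Multiset.card w.partition.parts)) :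
    (n : ℂ) • ch n (fun w => t w * lieCharacter n w) =
      ∑ x ∈ n.divisorsAntidiagonal, (η x.2 * primitiveSum x.1) • psum x.1 ^ x.2 := by
  classical
  have hn' : (n : ℂ) ≠ 0 := Nat.cast_ne_zero.2 hn
  have hord : orderOf (cyclicGenerator n) = n := by
    rw [← Subgroup.orderOf_coe]; exact orderOf_finRotate hn
  have hcard : Nat.card (cyclicSubgroup n) = n := by
    rw [cyclicSubgroup, Nat.card_zpowers, orderOf_finRotate hn]
  have hprim := Complex.isPrimitiveRoot_exp n hn
  set ζ := Complex.exp (2 * Real.pi * Complex.I / n) with hζ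
  have hψ : ∀ k, ((cyclicCharacter n (cyclicGenerator n ^ k) : ℂˣ) : ℂ) = ζ ^ k := by
    intro k
    rw [map_pow, cyclicCharacter, monoidHomOfForallMemZpowers_apply_gen]
    rfl
  have horder : ∀ k, orderOf (finRotate n ^ k) = orderOf (ζ ^ k) := by
    intro k
    rw [orderOf_eq_orderOf_iff]
    intro m
    rw [← pow_mul, ← pow_mul, hprim.pow_eq_one_iff_dvd, ← orderOf_dvd_iff_pow_eq_one,
      orderOf_finRotate hn]
  have hparts : ∀ k, (finRotate n ^ k).partition.parts =
      Multiset.replicate (n / orderOf (ζ ^ k)) (orderOf (ζ ^ k)) := by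
    intro k
    rw [← horder]
    refine parts_of_semiregular fun m x hx => ?_
    rw [← pow_mul] at hx ⊢
    exact finRotate_semiregular _ x hx
  unfold lieCharacter
  rw [ch_mul_inducedCharacter _ _ ht, hcard, smul_smul, mul_inv_cancel₀ hn', one_smul,
    ← IsCyclic.image_range_orderOf (mem_zpowers_cyclicGenerator n), hord, sum_image]
  swap
  · intro a ha b hb hab
    refine pow_injOn_Iio_orderOf ?_ ?_ hab
    · rw [hord]; simpa using ha
    · rw [hord]; simpa using hb
  trans ∑ k ∈ range n, (η (n / orderOf (ζ ^ k)) * ζ ^ k) •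
      psum (orderOf (ζ ^ k)) ^ (n / orderOf (ζ ^ k))
  · refine sum_congr rfl fun k _ => ?_
    have hcoe : ((cyclicGenerator n ^ k : cyclicSubgroup n) : Perm (Fin n)) = finRotate n ^ k := rfl
    rw [hψ, hcoe, htη, cyclePsum, hparts, Multiset.card_replicate, Multiset.map_replicate,
      Multiset.prod_replicate]
  rw [← sum_primitiveRoots hn hprim fun z => (η (n / orderOf z) * z) •
    psum (orderOf z) ^ (n / orderOf z)]
  refine sum_congr rfl fun x hx => ?_
  rw [Nat.mem_divisorsAntidiagonal] at hx
  have hx1 : 0 < x.1 := Nat.pos_of_ne_zero fun h => by rw [h] at hx; simp at hx; omega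
  rw [primitiveSum, mul_sum, sum_smul]
  refine sum_congr rfl fun z hz => ?_
  rw [← ((mem_primitiveRoots hx1).1 hz).eq_orderOf]
  have : n / x.1 = x.2 := Nat.div_eq_of_eq_mul_right hx1 hx.1.symm
  rw [this]

theorem ell_formula {n : ℕ} (hn : 1 ≤ n) : (n : ℂ) • ell n =
    ∑ x ∈ n.divisorsAntidiagonal, primitiveSum x.1 • psum x.1 ^ x.2 := by
  have h := ch_mul_lieCharacter (n := n) (by omega) (t := fun _ => 1) (fun _ _ => rfl)
    (η := fun _ => 1) (fun _ => rfl)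
  simpa [ell] using h

theorem piSymm_formula {n : ℕ} (hn : 1 ≤ n) : (n : ℂ) • piSymm n =
    ∑ x ∈ n.divisorsAntidiagonal, ((-1) ^ (n + x.2) * primitiveSum x.1) • psum x.1 ^ x.2 :=
  ch_mul_lieCharacter (n := n) (by omega) 
    (fun g h => by rw [map_mul, map_mul, Perm.sign_inv, mul_right_comm, Int.units_mul_self, one_mul])
    (η := fun e => (-1) ^ (n + e)) sign_eq_neg_one_pow

/-! ### The generating functions of the hat characters -/

/-- The generating function of the characteristics of the `lieHat n`. -/
def lieHatSeries : PowerSeries Series := PowerSeries.mk fun n => ch n (lieHat n)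

/-- The generating function of the characteristics of the `whitneyHat n`. -/
def whitneyHatSeries : PowerSeries Series := PowerSeries.mk fun n => ch n (whitneyHat n)

theorem isClassFunction_lieHat (n : ℕ) : IsClassFunction (lieHat n) :=
  (ch_sum_hat (fun j => ch_mem_symSpan j _) (fun _ => 1) lieChar_eq).1

theorem isClassFunction_whitneyHat (n : ℕ) : IsClassFunction (whitneyHat n) :=
  (ch_sum_hat (fun j => ch_mem_symSpan j _) whitneySign whitneyChar_eq).1

theorem hsymm_mul_lieHatSeries :
    (PowerSeries.mk fun m => hsymm (m : ℕ)) * lieHatSeries =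
      PowerSeries.mk fun r => psum 1 ^ r := by
  have : lieHatSeries = hatSeries (fun _ => 1) ell := by
    ext1 n
    rw [lieHatSeries, PowerSeries.coeff_mk]
    exact (ch_sum_hat (fun j => ch_mem_symSpan j _) (fun _ => 1) lieChar_eq).2
  rw [this]
  exact hsymm_mul_hatSeries_lie fun j hj => ell_formula hj

theorem hsymm_mul_whitneyHatSeries :
    (PowerSeries.mk fun m => hsymm (m : ℕ)) * whitneyHatSeries =
      (1 + PowerSeries.C (psum 2) * PowerSeries.X ^ 2) * PowerSeries.mk fun r => psum 1 ^ r := by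
  have : whitneyHatSeries = hatSeries whitneySign piSymm := by
    ext1 n
    rw [whitneyHatSeries, PowerSeries.coeff_mk]
    exact (ch_sum_hat (fun j => ch_mem_symSpan j _) whitneySign whitneyChar_eq).2
  rw [this]
  exact hsymm_mul_hatSeries_whitney fun j hj => piSymm_formula hj

end

section

open Finset

/-! ### Jacobi-Trudi determinants -/

/-- The Jacobi-Trudi matrix with rows `h_{b_i}, h_{b_i + 1}, …`. -/
def jtMatrix {N : ℕ} (b : Fin N → ℤ) : Matrix (Fin N) (Fin N) Series :=
  Matrix.of fun i j => hsymm (b i + (j : ℤ))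

theorem jtMatrix_apply {N : ℕ} (b : Fin N → ℤ) (i j : Fin N) :
    jtMatrix b i j = hsymm (b i + (j : ℤ)) := rfl

/-- The Jacobi-Trudi determinant of the first `N` terms of a sequence of row lengths. -/
def jtDet (N : ℕ) (r : ℕ → ℕ) : Series :=
  (jtMatrix fun i : Fin N => (r i : ℤ) - (i : ℤ)).det

theorem det_of_last_row {R : Type*} [CommRing R] {N : ℕ} (A : Matrix (Fin (N + 1)) (Fin (N + 1)) R)
    (h : ∀ j : Fin N, A (Fin.last N) j.castSucc = 0) :
    A.det = A (Fin.last N) (Fin.last N) *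
      (A.submatrix Fin.castSucc Fin.castSucc).det := by
  rw [Matrix.det_succ_row A (Fin.last N), Fin.sum_univ_castSucc]
  rw [sum_eq_zero fun j _ => by rw [h]; ring, zero_add]
  have : (-1 : R) ^ ((Fin.last N : ℕ) + (Fin.last N : ℕ)) = 1 := Even.neg_one_pow ⟨_, rfl⟩
  rw [this, one_mul, Fin.succAbove_last]

/-- A row of length zero at the bottom of the matrix is 0, ..., 0, 1. -/
theorem jtDet_succ {N : ℕ} {r : ℕ → ℕ} (h : r N = 0) : jtDet (N + 1) r = jtDet N r := by
  rw [jtDet, det_of_last_row]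
  · rw [jtMatrix_apply]
    simp only [Fin.val_last, h]
    rw [show ((0 : ℕ) : ℤ) - (N : ℤ) + (N : ℤ) = 0 by simp, hsymm_zero, one_mul]
    rfl
  · intro j
    rw [jtMatrix_apply]
    refine hsymm_of_neg ?_
    simp [h, j.2]

theorem jtDet_eq {N M : ℕ} (hNM : N ≤ M) {r : ℕ → ℕ} (h : ∀ i, N ≤ i → r i = 0) :
    jtDet M r = jtDet N r := by
  induction M, hNM using Nat.le_induction with
  | base => rfl
  | succ M hM ih => rw [jtDet_succ (h M hM), ih]

theorem rowLen_eq_zero_iff {μ : YoungDiagram} {i : ℕ} : μ.rowLen i = 0 ↔ μ.colLen 0 ≤ i := by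
  have h := YoungDiagram.mem_iff_lt_rowLen (μ := μ) (i := i) (j := 0)
  rw [YoungDiagram.mem_iff_lt_colLen] at h
  omega

theorem schur_eq_jtDet {μ : YoungDiagram} {N : ℕ} (h : μ.rowLen N = 0) :
    schur μ = jtDet N μ.rowLen := by
  rw [jtDet_eq (rowLen_eq_zero_iff.1 h) fun i hi => rowLen_eq_zero_iff.2 hi]
  rfl

theorem jtDet_congr {N : ℕ} {r r' : ℕ → ℕ} (h : ∀ i < N, r i = r' i) : jtDet N r = jtDet N r' := by
  rw [jtDet, jtDet]
  congr 2
  funext i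
  rw [h i i.2]

/-- Both sides are the trace of adj(A) · B, expanded by rows or by columns. -/
theorem sum_det_updateRow {R ι : Type*} [CommRing R] [Fintype ι] [DecidableEq ι]
    (A B : Matrix ι ι R) :
    ∑ i, (A.updateRow i (B i)).det = ∑ j, (A.updateCol j fun i => B i j).det := by
  have h1 : ∀ i, (A.updateRow i (B i)).det = ∑ j, A.adjugate j i * B i j := by
    intro i
    rw [← Matrix.det_transpose, ← Matrix.updateCol_transpose, ← Matrix.cramer_apply,
      Matrix.cramer_eq_adjugate_mulVec, ← Matrix.adjugate_transpose]
    rfl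
  have h2 : ∀ j, (A.updateCol j fun i => B i j).det = ∑ i, A.adjugate j i * B i j := by
    intro j
    rw [← Matrix.cramer_apply, Matrix.cramer_eq_adjugate_mulVec]
    rfl
  simp_rw [h1, h2]
  exact sum_comm

/-- A row of the given row lengths can be extended by one cell. -/
def Addable (r : ℕ → ℕ) (i : ℕ) : Prop := ∀ k, k + 1 = i → r i < r k

/-- The Pieri rule for the multiplication with `h_1`. -/
theorem pieri {N : ℕ} {r : ℕ → ℕ} (hr : Antitone r) (h : r N = 0) :
    hsymm 1 * jtDet N r = ∑ i ∈ range (N + 1), open Classical in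
      if Addable r i then jtDet (N + 1) (Function.update r i (r i + 1)) else 0 := by
  classical
  set b : Fin (N + 1) → ℤ := fun i => (r i : ℤ) - (i : ℤ) with hb
  -- B is the matrix with all indices raised by 1: replacing a row by that of B lengthens it by one
  -- cell, replacing a column yields the next column. The size N + 1 leaves room for a new bottom
  -- row.
  have hkey := sum_det_updateRow (jtMatrix b) (Matrix.of fun (i j : Fin (N + 1)) => hsymm (b i + ((j : ℕ) : ℤ) + 1))
  rw [Fin.sum_univ_castSucc (f := fun j => (Matrix.updateCol (jtMatrix b) j _).det),
    sum_eq_zero (s := (univ : Finset (Fin N))), zero_add] at hkey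
  · have h1 : ((jtMatrix b).updateCol (Fin.last N) fun i =>
        (Matrix.of fun (i j : Fin (N + 1)) => hsymm (b i + ((j : ℕ) : ℤ) + 1)) i (Fin.last N)).det =
        hsymm 1 * jtDet N r := by
      rw [det_of_last_row]
      · congr 1
        · simp [hb, h]
        · rw [jtDet]
          congr 1
          ext i j
          simp [jtMatrix_apply, hb, Fin.castSucc_ne_last]
      · intro j
        rw [Matrix.updateCol_ne (Fin.castSucc_ne_last j), jtMatrix_apply]
        refine hsymm_of_neg ?_
        simp [hb, h, j.2]
    rw [← h1, ← hkey, Finset.sum_range]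
    refine sum_congr rfl fun i _ => ?_
    have h2 : (jtMatrix b).updateRow i ((Matrix.of fun (i j : Fin (N + 1)) => hsymm (b i + ((j : ℕ) : ℤ) + 1)) i) =
        jtMatrix fun k : Fin (N + 1) =>
          ((Function.update r i (r i + 1) k : ℕ) : ℤ) - (k : ℤ) := by
      ext1 k j
      rw [Matrix.updateRow_apply, jtMatrix_apply]
      split_ifs with hk
      · subst hk
        simp only [Matrix.of_apply, hb, jtMatrix_apply]
        rw [Function.update_self]
        congr 1
        push_cast; ring
      · rw [jtMatrix_apply, Function.update_of_ne (fun h => hk (Fin.ext h))]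
    rw [h2]
    split_ifs with ha
    · rfl
    -- If row i cannot be lengthened, the row above has the same length, and the lengthened row
    -- duplicates it in the matrix.
    · simp only [Addable, not_forall, not_lt] at ha
      obtain ⟨k, hk, hle⟩ := ha
      have hk' : k < N + 1 := by have := i.2; omega
      refine Matrix.det_zero_of_row_eq (i := ⟨k, hk'⟩) (j := i) ?_ ?_
      · intro h; rw [← h] at hk; simp at hk
      · funext j
        rw [jtMatrix_apply, jtMatrix_apply]
        congr 2
        have : r k = r i := le_antisymm hle (hr (by omega))
        rw [Function.update_self, Function.update_of_ne (by simp; omega)]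
        simp only
        rw [this, ← hk]
        push_cast; ring
  -- Replacing any column but the last duplicates its right neighbour.
  · intro j _
    refine Matrix.det_zero_of_column_eq (i := j.castSucc) (j := j.succ) ?_ ?_
    · exact (Fin.castSucc_lt_succ).ne
    · intro k
      rw [Matrix.updateCol_self, Matrix.updateCol_ne (Fin.castSucc_lt_succ).ne', jtMatrix_apply]
      simp [add_assoc]

/-! ### Hooks -/

/-- The row lengths of the hook with first row `a` and `m` rows in total. -/
def hookRows (a m : ℕ) (i : ℕ) : ℕ := if i < m then if i = 0 then a else 1 else 0

/-- The Schur function of a column. -/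
def colSchur (n : ℕ) : Series := jtDet n (hookRows 1 n)

theorem jtDet_hookRows_one (a : ℕ) : jtDet 1 (hookRows a 1) = hsymm a := by
  rw [jtDet, Matrix.det_unique, jtMatrix_apply]
  simp [hookRows]

theorem colSchur_zero : colSchur 0 = 1 := by
  rw [colSchur, jtDet, Matrix.det_isEmpty]

/-- Laplace expansion along the first column, whose only nonzero entries are h_a and h_0 = 1. -/
theorem jtDet_hookRows_succ (a m : ℕ) :
    jtDet (m + 2) (hookRows a (m + 2)) =
      hsymm a * colSchur (m + 1) - jtDet (m + 1) (hookRows (a + 1) (m + 1)) := by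
  rw [jtDet, Matrix.det_succ_column_zero, Fin.sum_univ_succ, Fin.sum_univ_succ, sum_eq_zero]
  · rw [add_zero, sub_eq_add_neg]
    congr 1
    · simp only [Fin.val_zero, pow_zero, one_mul, jtMatrix_apply]
      have : hsymm (((hookRows a (m + 2) 0 : ℕ) : ℤ) - ((0 : ℕ) : ℤ) + ((0 : ℕ) : ℤ)) =
          hsymm a := by simp [hookRows]
      rw [this, colSchur, jtDet]
      congr 2
      ext1 i j
      simp only [Matrix.submatrix_apply, Fin.zero_succAbove, jtMatrix_apply, hookRows]
      congr 1
      have := i.2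
      simp
      ring
    · simp only [Fin.succ_zero_eq_one, Fin.val_one, pow_one, jtMatrix_apply]
      have : hsymm (((hookRows a (m + 2) 1 : ℕ) : ℤ) - ((1 : ℕ) : ℤ) +
        (((0 : Fin (m + 2)) : ℕ) : ℤ)) = 1 := by
        simp [hookRows, hsymm_zero]
      rw [this, mul_one, neg_one_mul, jtDet]
      congr 2
      ext1 i j
      simp only [Matrix.submatrix_apply, jtMatrix_apply, hookRows]
      congr 1
      refine Fin.cases ?_ (fun i => ?_) i
      · simp; ring
      · have h1 : (1 : Fin (m + 2)).succAbove i.succ = i.succ.succ := by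
          rw [Fin.succAbove_of_lt_succ]
          simp [Fin.lt_def]
        have := i.2
        rw [h1]
        simp
        ring
  · intro i _
    rw [jtMatrix_apply, hsymm_of_neg]
    · ring
    · have := i.2
      simp only [hookRows, Fin.val_succ, Fin.val_zero]
      rw [if_pos (by omega), if_neg (by omega)]
      push_cast
      omega

theorem jtDet_hookRows_eq_sum (m : ℕ) : ∀ a, jtDet (m + 1) (hookRows a (m + 1)) =
    ∑ k ∈ range (m + 1), (-1) ^ k * hsymm ((a + k : ℕ) : ℤ) * colSchur (m - k) := by
  induction m with
  | zero => intro a; simp [jtDet_hookRows_one, colSchur_zero]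
  | succ m ih =>
    intro a
    rw [jtDet_hookRows_succ, ih, sum_range_succ' _ (m + 1)]
    simp only [pow_zero, one_mul, Nat.sub_zero, add_zero, Nat.add_sub_add_right]
    rw [sub_eq_add_neg, add_comm, ← sum_neg_distrib]
    congr 1
    refine sum_congr rfl fun k _ => ?_
    rw [show a + 1 + k = a + (k + 1) by ring, pow_succ]
    ring

/-- For a = 1 the hook is itself a column, and its expansion becomes the recursion that inverts
H(t). -/
theorem colSchur_series_mul_hsymm :
    (PowerSeries.mk fun n => (-1) ^ n * colSchur n) * (PowerSeries.mk fun m => hsymm (m : ℕ)) =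
      1 := by
  ext1 n
  rw [mul_comm, PowerSeries.coeff_mul, PowerSeries.coeff_one,
    Nat.sum_antidiagonal_eq_sum_range_succ_mk]
  simp only [PowerSeries.coeff_mk]
  rcases n with _ | n
  · simp [hsymm_zero, colSchur_zero]
  · rw [sum_range_succ', if_neg (by omega)]
    have h := jtDet_hookRows_eq_sum n 1
    change colSchur (n + 1) = _ at h
    simp only [Nat.sub_zero, Nat.cast_zero, hsymm_zero, one_mul, Nat.add_sub_add_right]
    rw [h, mul_sum, ← sum_add_distrib]
    refine sum_eq_zero fun k hk => ?_
    rw [mem_range] at hk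
    obtain ⟨e, he⟩ : ∃ e, n = k + e := ⟨n - k, by omega⟩
    subst he
    have h1 : (-1 : Series) ^ (k + e + 1) * (-1) ^ k = - (-1) ^ e := by
      rw [← pow_add]
      have : k + e + 1 + k = e + 1 + 2 * k := by ring
      rw [this, pow_add, pow_mul, neg_one_sq, one_pow, mul_one, pow_succ, mul_neg_one]
    rw [Nat.add_sub_cancel_left, add_comm 1 k]
    linear_combination (hsymm ((k + 1 : ℕ) : ℤ) * colSchur e) * h1

theorem hsymm_one : hsymm 1 = psum 1 := by
  have h := hsymm_newton 0
  simpa [hsymm_zero] using h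

theorem psum_two : psum 2 = 2 * hsymm 2 - hsymm 1 ^ 2 := by
  have h := hsymm_newton 1
  rw [sum_range_succ, sum_range_one] at h
  simp only [Nat.sub_self, Nat.sub_zero, Nat.cast_zero, hsymm_zero, zero_add, Nat.cast_one] at h
  rw [hsymm_one] at h ⊢
  have h2 : ((1 : ℂ) + 1) • hsymm 2 = 2 * hsymm 2 := by
    rw [Algebra.smul_def, map_add, map_one]; ring
  rw [show ((1 + 1 : ℕ) : ℤ) = 2 by norm_num, h2] at h
  rw [h]; ring

/-- The row lengths of the shape `(2, 2, 1, …, 1)` with `m + 2` rows. -/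
def twoTwoRows (m : ℕ) (i : ℕ) : ℕ := if i < 2 then 2 else if i < m + 2 then 1 else 0

/-- Pieri for the hook (2,1,...,1): the first row, the second row and a new bottom row are the only
places for a cell. -/
theorem hsymm_one_mul_hook (m : ℕ) :
    hsymm 1 * jtDet (m + 2) (hookRows 2 (m + 2)) =
      jtDet (m + 2) (hookRows 3 (m + 2)) + jtDet (m + 2) (twoTwoRows m) +
        jtDet (m + 3) (hookRows 2 (m + 3)) := by
  classical
  have hanti : Antitone (hookRows 2 (m + 2)) := by
    intro i j hij
    simp only [hookRows]
    split_ifs <;> omega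
  rw [pieri hanti (by simp [hookRows]), sum_range_succ, sum_range_succ', sum_range_succ',
    sum_eq_zero]
  · rw [zero_add]
    have h0 : Addable (hookRows 2 (m + 2)) 0 := fun k hk => by omega
    have h1 : Addable (hookRows 2 (m + 2)) (0 + 1) := fun k hk => by
      obtain rfl : k = 0 := by omega
      simp [hookRows]
    have h2 : Addable (hookRows 2 (m + 2)) (m + 2) := fun k hk => by
      obtain rfl : k = m + 1 := by omega
      simp only [hookRows]
      split_ifs <;> omega
    rw [if_pos h0, if_pos h1, if_pos h2, add_comm (jtDet _ _) (jtDet _ _)]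
    congr 1
    · congr 1
      · rw [jtDet_succ (N := m + 2) (by simp [hookRows])]
        refine jtDet_congr fun i _ => ?_
        rw [Function.update_apply]
        simp only [hookRows]
        split_ifs <;> omega
      · rw [jtDet_succ (N := m + 2) (by simp [hookRows])]
        refine jtDet_congr fun i _ => ?_
        rw [Function.update_apply]
        simp only [hookRows, twoTwoRows, zero_add, one_ne_zero, if_false]
        split_ifs <;> omega
    · refine jtDet_congr fun i _ => ?_
      rw [Function.update_apply]
      simp only [hookRows]
      split_ifs <;> omega
  · intro i hi
    rw [mem_range] at hi
    rw [if_neg]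
    intro h
    have := h (i + 1) rfl
    simp only [hookRows] at this
    split_ifs at this <;> omega

/-- Multiplication by p_2 adds a domino to a column: horizontally in the first row, or, with a minus
sign, vertically in the second column or at the bottom. It is derived from p_2 = 2 h_2 - h_1^2 and
the hook recursions. For m = 0 the second column has no room for a vertical domino. -/
theorem colSchur_add_psum_two (m : ℕ) :
    colSchur (m + 3) + psum 2 * colSchur (m + 1) =
      jtDet (m + 1) (hookRows 3 (m + 1)) -
        match m with
        | 0 => 0
        | m + 1 => jtDet (m + 2) (twoTwoRows m) := by
  have hcol : ∀ m, colSchur (m + 2) =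
      hsymm 1 * colSchur (m + 1) - jtDet (m + 1) (hookRows 2 (m + 1)) :=
    jtDet_hookRows_succ 1
  have htwo : ∀ m, jtDet (m + 2) (hookRows 2 (m + 2)) =
      hsymm 2 * colSchur (m + 1) - jtDet (m + 1) (hookRows 3 (m + 1)) :=
    jtDet_hookRows_succ 2
  rw [psum_two]
  rcases m with _ | m
  · have h1 : colSchur 1 = hsymm 1 := jtDet_hookRows_one 1
    have h2 : jtDet 1 (hookRows 2 1) = hsymm 2 := jtDet_hookRows_one 2
    have h3 := hcol 0
    have h4 := hcol 1
    have h5 := htwo 0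
    simp only [zero_add] at h3 h4 h5 ⊢
    rw [h1] at h3 h5 ⊢
    rw [h2] at h3
    linear_combination h4 + hsymm 1 * h3 - h5
  · have h1 := hcol (m + 1)
    have h2 := hcol (m + 2)
    have h3 := htwo (m + 1)
    have h4 := hsymm_one_mul_hook m
    simp only [add_assoc, Nat.reduceAdd] at h1 h2 h3 h4 ⊢
    linear_combination h2 + hsymm 1 * h1 - h4 - 2 * h3

end

section

open Finset

/-! ### Virtual characters of a finite group -/

section VirtualCharacters

variable {G : Type} [Group G]

theorem isIrreducibleCharacter_of_isIrreducible {V : Type} [AddCommGroup V] [Module ℂ V]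
    [FiniteDimensional ℂ V] (ρ : Representation ℂ G V) (h : ρ.IsIrreducible) :
    IsIrreducibleCharacter ρ.character := by
  let e : V ≃ₗ[ℂ] (Fin (Module.finrank ℂ V) → ℂ) := (Module.finBasis ℂ V).equivFun
  let σ : Representation ℂ G (Fin (Module.finrank ℂ V) → ℂ) :=
    { toFun := fun g => e.conj (ρ g)
      map_one' := by rw [map_one]; exact LinearEquiv.conj_id e
      map_mul' := fun a b => by rw [map_mul]; exact LinearEquiv.conj_comp e _ _ }
  refine ⟨_, σ, ?_, ?_⟩
  · let f : Subrepresentation σ ≃o Subrepresentation ρ :=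
      { toFun := fun s => ⟨s.toSubmodule.comap e.toLinearMap, fun g v hv => by
          have := s.apply_mem_toSubmodule g hv
          simpa [σ, LinearEquiv.conj_apply] using this⟩
        invFun := fun s => ⟨s.toSubmodule.comap e.symm.toLinearMap, fun g v hv => by
          have := s.apply_mem_toSubmodule g hv
          simpa [σ, LinearEquiv.conj_apply] using this⟩
        left_inv := fun s => by
          apply Subrepresentation.toSubmodule_injective
          ext v; simp
        right_inv := fun s => by
          apply Subrepresentation.toSubmodule_injective
          ext v; simp
        map_rel_iff' := fun {s t} => by
          constructor
          · intro h v hv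
            have h1 : e (e.symm v) ∈ s.toSubmodule := by rwa [e.apply_symm_apply]
            have h2 : e (e.symm v) ∈ t.toSubmodule := @h (e.symm v) h1
            rwa [e.apply_symm_apply] at h2
          · intro h v hv
            exact h hv }
    exact f.isSimpleOrder_iff.2 h
  · funext g
    exact LinearMap.trace_conj' _ e

theorem trace_eq_add_of_isCompl {V : Type} [AddCommGroup V] [Module ℂ V] [FiniteDimensional ℂ V]
    (ρ : Representation ℂ G V) {p q : Subrepresentation ρ} (h : IsCompl p q) :
    ρ.character = p.toRepresentation.character + q.toRepresentation.character := by
  have h' : IsCompl p.toSubmodule q.toSubmodule := by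
    refine ⟨disjoint_iff.2 ?_, codisjoint_iff.2 ?_⟩
    · rw [← Subrepresentation.toSubmodule_inf, h.inf_eq_bot]; rfl
    · rw [← Subrepresentation.toSubmodule_sup, h.sup_eq_top]; rfl
  funext g
  have hint : DirectSum.IsInternal fun b : Bool => cond b p.toSubmodule q.toSubmodule :=
    (DirectSum.isInternal_submodule_iff_isCompl _ (i := true) (j := false) (by simp)
      (by ext b; cases b <;> simp)).2 h'
  have := LinearMap.trace_eq_sum_trace_restrict hint (f := ρ g) (by
    rintro (_ | _)
    · exact q.apply_mem_toSubmodule g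
    · exact p.apply_mem_toSubmodule g)
  rw [Fintype.sum_bool] at this
  exact this

variable (G) in
/-- The group of virtual characters. -/
def virtualCharacters : AddSubgroup (G → ℂ) := AddSubgroup.closure {χ | IsIrreducibleCharacter χ}

theorem exists_sum_irreducible {f : G → ℂ} (hf : f ∈ virtualCharacters G) :
    ∃ (s : Finset (G → ℂ)) (a : (G → ℂ) → ℤ), (∀ χ ∈ s, IsIrreducibleCharacter χ) ∧
      f = ∑ χ ∈ s, (a χ : ℂ) • χ := by
  have h := hf
  rw [virtualCharacters, ← Submodule.span_int_eq_addSubgroupClosure, Submodule.mem_toAddSubgroup,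
    Submodule.mem_span_set] at h
  obtain ⟨c, hc, rfl⟩ := h
  refine ⟨c.support, c, fun χ hχ => hc hχ, ?_⟩
  rw [Finsupp.sum]
  refine sum_congr rfl fun χ _ => ?_
  ext w
  simp

variable [Fintype G]

/-- Induction on the dimension: by Maschke's theorem a proper subrepresentation has a complement,
and characters add over the decomposition. -/
theorem character_mem_virtualCharacters {V : Type} [AddCommGroup V] [Module ℂ V]
    [FiniteDimensional ℂ V] (ρ : Representation ℂ G V) :
    ρ.character ∈ virtualCharacters G := by
  induction hd : Module.finrank ℂ V using Nat.strong_induction_on generalizing V with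
  | _ d ih =>
  by_cases hρ : ρ.IsIrreducible
  · exact AddSubgroup.subset_closure (isIrreducibleCharacter_of_isIrreducible ρ hρ)
  · rcases subsingleton_or_nontrivial V with hV | hV
    · have : ρ.character = 0 := by
        funext g
        rw [Representation.character, Subsingleton.elim (ρ g) 0, map_zero, Pi.zero_apply]
      rw [this]
      exact zero_mem _
    · have hnt : Nontrivial (Subrepresentation ρ) := by
        refine ⟨⊥, ⊤, fun h => ?_⟩
        exact (bot_ne_top : (⊥ : Submodule ℂ V) ≠ ⊤) (congrArg Subrepresentation.toSubmodule h)
      obtain ⟨p, hp⟩ : ∃ p : Subrepresentation ρ, p ≠ ⊥ ∧ p ≠ ⊤ := by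
        by_contra! hcon
        exact hρ { eq_bot_or_eq_top := fun p => or_iff_not_imp_left.2 (hcon p) }
      have : NeZero (Nat.card G : ℂ) := ⟨Nat.cast_ne_zero.2 Nat.card_pos.ne'⟩
      obtain ⟨q, hq⟩ := exists_isCompl p
      have hlt : ∀ r : Subrepresentation ρ, r ≠ ⊤ → Module.finrank ℂ r.toSubmodule < d := by
        intro r hr
        rw [← hd]
        exact Submodule.finrank_lt fun h => hr (Subrepresentation.toSubmodule_injective h)
      rw [trace_eq_add_of_isCompl ρ hq]
      refine add_mem (ih _ (hlt p hp.2) _ rfl) (ih _ (hlt q fun h => hp.1 ?_) _ rfl)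
      rw [h] at hq
      exact disjoint_top.1 hq.disjoint

/-! ### Orthonormality and the recognition of irreducible characters -/

/-- The bilinear form on functions for which the irreducible characters are orthonormal. -/
def charForm (f g : G → ℂ) : ℂ := (Nat.card G : ℂ)⁻¹ * ∑ w, f w * g w⁻¹

theorem charForm_irreducible {χ ψ : G → ℂ} (hχ : IsIrreducibleCharacter χ)
    (hψ : IsIrreducibleCharacter ψ) [Decidable (χ = ψ)] :
    charForm χ ψ = if χ = ψ then 1 else 0 := by
  classical
  have : Invertible (Nat.card G : ℂ) :=
    invertibleOfNonzero (Nat.cast_ne_zero.2 Nat.card_pos.ne')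
  obtain ⟨d, ρ, hρ, rfl⟩ := hχ
  split_ifs with h
  · rw [← h, charForm, Representation.char_orthonormal, if_pos ⟨Representation.Equiv.refl ρ⟩]
  · obtain ⟨d', σ, hσ, rfl⟩ := hψ
    rw [charForm, Representation.char_orthonormal, if_neg]
    rintro ⟨e⟩
    exact h (Representation.char_iso e).symm

theorem charForm_sum {ι : Type*} (s : Finset ι) (a : ι → ℂ) (f : ι → G → ℂ) (g : G → ℂ) :
    charForm (∑ i ∈ s, a i • f i) g = ∑ i ∈ s, a i * charForm (f i) g := by
  simp only [charForm, Finset.sum_apply, Pi.smul_apply, smul_eq_mul, sum_mul, mul_sum]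
  rw [sum_comm]
  refine sum_congr rfl fun i _ => sum_congr rfl fun w _ => ?_
  ring

theorem sum_charForm {ι : Type*} (s : Finset ι) (a : ι → ℂ) (f : ι → G → ℂ) (g : G → ℂ) :
    charForm g (∑ i ∈ s, a i • f i) = ∑ i ∈ s, a i * charForm g (f i) := by
  simp only [charForm, Finset.sum_apply, Pi.smul_apply, smul_eq_mul, mul_sum]
  rw [sum_comm]
  refine sum_congr rfl fun i _ => sum_congr rfl fun w _ => ?_
  ring

/-- A virtual character of norm `1` and of positive degree is an irreducible character. -/
theorem isIrreducibleCharacter_of_virtual {f : G → ℂ} (hf : f ∈ virtualCharacters G)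
    (hnorm : charForm f f = 1) (hpos : ∃ m : ℕ, 0 < m ∧ f 1 = m) : IsIrreducibleCharacter f := by
  classical
  obtain ⟨s, a, hs, hsum⟩ := exists_sum_irreducible hf
  have h1 : ∑ χ ∈ s, a χ ^ 2 = 1 := by
    have h2 : charForm f f = ∑ χ ∈ s, (a χ : ℂ) ^ 2 := by
      conv_lhs => rw [hsum, charForm_sum]
      refine sum_congr rfl fun χ hχ => ?_
      rw [sum_charForm, sum_eq_single_of_mem χ hχ, charForm_irreducible (hs χ hχ) (hs χ hχ),
        if_pos rfl]
      · ring
      · intro ψ hψ hne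
        rw [charForm_irreducible (hs χ hχ) (hs ψ hψ), if_neg hne.symm, mul_zero]
    rw [hnorm] at h2
    exact_mod_cast h2.symm
  obtain ⟨χ, hχ, hne⟩ : ∃ χ ∈ s, a χ ≠ 0 := by
    by_contra! hcon
    rw [sum_eq_zero fun χ hχ => by rw [hcon χ hχ]; rfl] at h1
    exact zero_ne_one h1
  have hother : ∀ ψ ∈ s, ψ ≠ χ → a ψ = 0 := by
    intro ψ hψ hψχ
    rw [← add_sum_erase s _ hχ, ← add_sum_erase (s.erase χ) _ (mem_erase.2 ⟨hψχ, hψ⟩)] at h1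
    have h3 : 0 ≤ ∑ x ∈ (s.erase χ).erase ψ, a x ^ 2 := sum_nonneg fun _ _ => sq_nonneg _
    have h4 : 0 < a χ ^ 2 := by positivity
    by_contra h5
    have h6 : 0 < a ψ ^ 2 := by positivity
    omega
  have hf' : f = (a χ : ℂ) • χ := by
    rw [hsum, sum_eq_single_of_mem χ hχ]
    intro ψ hψ hψχ
    rw [hother ψ hψ hψχ, Int.cast_zero, zero_smul]
  have hsq : a χ ^ 2 = 1 := by
    rwa [sum_eq_single_of_mem χ hχ fun ψ hψ h => by rw [hother ψ hψ h]; rfl] at h1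
  rcases (show a χ = 1 ∨ a χ = -1 from by simpa using hsq) with h | h
  · rw [hf', h, Int.cast_one, one_smul]
    exact hs χ hχ
  · obtain ⟨m, hm, hm'⟩ := hpos
    obtain ⟨d, ρ, -, hρ⟩ := hs χ hχ
    rw [hf', h, Pi.smul_apply, ← hρ, Representation.char_one] at hm'
    have h7 : (((m + Module.finrank ℂ (Fin d → ℂ) : ℕ)) : ℂ) = 0 := by
      push_cast
      rw [← hm']
      simp
    have := Nat.cast_eq_zero.1 h7
    omega

/-- The character of a permutation representation. -/
theorem card_fixed_mem_virtualCharacters {X : Type} [Fintype X] [DecidableEq X]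
    (φ : G →* Equiv.Perm X) :
    (fun g => ((univ.filter fun x => φ g x = x).card : ℂ)) ∈ virtualCharacters G := by
  let ρ : Representation ℂ G (X → ℂ) :=
    { toFun := fun g => LinearMap.funLeft ℂ ℂ (φ g⁻¹)
      map_one' := by ext; simp [LinearMap.funLeft]
      map_mul' := fun a b => by ext; simp [LinearMap.funLeft] }
  have h : ρ.character = fun g => ((univ.filter fun x => φ g x = x).card : ℂ) := by
    funext g
    rw [Representation.character, LinearMap.trace_eq_matrix_trace ℂ (Pi.basisFun ℂ X),
      Matrix.trace, card_filter, Nat.cast_sum]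
    refine sum_congr rfl fun x _ => ?_
    rw [Matrix.diag_apply, LinearMap.toMatrix_apply]
    have : (φ g).symm x = x ↔ φ g x = x := by
      rw [Equiv.symm_apply_eq, eq_comm]
    simp [ρ, LinearMap.funLeft, Pi.single_apply, this]
  rw [← h]
  exact character_mem_virtualCharacters ρ

end VirtualCharacters

end

section

open Finset

/-! ### The bialternant formula -/

section Bialternant

variable {σ : Type*} [DecidableEq σ]

/-- The sum of the monomials of degree `m` in the variables of a given set. -/
def hsymmOn (S : Finset σ) (m : ℕ) : MvPowerSeries σ ℂ :=
  fun d => if d.degree = m ∧ d.support ⊆ S then 1 else 0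

theorem coeff_hsymmOn (S : Finset σ) (m : ℕ) (d : σ →₀ ℕ) :
    MvPowerSeries.coeff d (hsymmOn S m) = if d.degree = m ∧ d.support ⊆ S then 1 else 0 := rfl

theorem hsymmOn_zero (S : Finset σ) : hsymmOn S 0 = 1 := by
  ext d
  rw [coeff_hsymmOn, MvPowerSeries.coeff_one]
  congr 1
  rw [Finsupp.degree_eq_zero_iff]
  refine propext ⟨fun h => h.1, ?_⟩
  rintro rfl
  simp

theorem hsymmOn_empty_succ (m : ℕ) : hsymmOn (∅ : Finset σ) (m + 1) = 0 := by
  ext d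
  rw [coeff_hsymmOn, if_neg, map_zero]
  rintro ⟨h1, h2⟩
  rw [subset_empty, Finsupp.support_eq_empty] at h2
  simp [h2] at h1

theorem hsymmOn_insert {S : Finset σ} {i : σ} (hi : i ∉ S) (m : ℕ) :
    hsymmOn (insert i S) (m + 1) =
      hsymmOn S (m + 1) + MvPowerSeries.X i * hsymmOn (insert i S) m := by
  ext d
  rw [map_add, MvPowerSeries.X, MvPowerSeries.coeff_monomial_mul, one_mul, coeff_hsymmOn,
    coeff_hsymmOn]
  by_cases h : Finsupp.single i 1 ≤ d
  · obtain ⟨e, rfl⟩ := exists_add_of_le h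
    rw [if_pos h, add_tsub_cancel_left, coeff_hsymmOn, if_neg (c := _ ∧ _ ⊆ S), zero_add]
    · congr 1
      rw [map_add, Finsupp.degree_single]
      refine propext (and_congr (by omega) ?_)
      constructor
      · intro hs x hx
        refine hs ?_
        rw [Finsupp.mem_support_iff] at hx ⊢
        simp only [Finsupp.add_apply]
        omega
      · intro hs x hx
        rw [Finsupp.mem_support_iff, Finsupp.add_apply] at hx
        by_cases hxi : x = i
        · simp [hxi]
        · rw [Finsupp.single_eq_of_ne hxi, zero_add] at hx
          exact hs (Finsupp.mem_support_iff.2 hx)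
    · rintro ⟨-, hs⟩
      refine hi (hs ?_)
      simp
  · rw [if_neg h, add_zero]
    congr 1
    have hd : d i = 0 := by
      rw [Finsupp.single_le_iff] at h
      omega
    refine propext (and_congr_right fun _ => ?_)
    rw [subset_insert_iff_of_notMem]
    simp [hd]

/-- The product formula for H(t), obtained by adding one variable at a time and splitting monomials
by whether they contain it. -/
theorem mk_hsymmOn_mul_prod (S : Finset σ) :
    PowerSeries.mk (hsymmOn S) *
      ∏ i ∈ S, (1 - PowerSeries.C (MvPowerSeries.X (R := ℂ) i) * PowerSeries.X) = 1 := by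
  induction S using Finset.induction_on with
  | empty =>
    rw [prod_empty, mul_one]
    ext1 m
    rw [PowerSeries.coeff_mk, PowerSeries.coeff_one]
    rcases m with _ | m
    · rw [hsymmOn_zero, if_pos rfl]
    · rw [hsymmOn_empty_succ, if_neg (Nat.succ_ne_zero m)]
  | insert i S hi ih =>
    rw [prod_insert hi, ← mul_assoc]
    refine Eq.trans (congrArg (· * _) ?_) ih
    rw [mul_sub, mul_one, mul_left_comm]
    ext1 m
    rw [map_sub, PowerSeries.coeff_C_mul, PowerSeries.coeff_mk, PowerSeries.coeff_mk]
    rcases m with _ | m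
    · rw [PowerSeries.coeff_zero_mul_X, hsymmOn_zero, hsymmOn_zero]
      ring
    · rw [PowerSeries.coeff_succ_mul_X, PowerSeries.coeff_mk, hsymmOn_insert hi]
      ring

variable {N : ℕ}

theorem truncVars_hsymm (m : ℕ) : truncVars N (hsymm m) = hsymmOn univ m := by
  ext d
  rw [coeff_truncVars_hsymm, coeff_hsymmOn]
  congr 1
  simp

/-- The polynomial `∏_{i ≠ j} (1 - X_i t)`. -/
def omitPoly (j : Fin N) : Polynomial (MvPowerSeries (Fin N) ℂ) :=
  ∏ i ∈ univ.erase j, (1 - Polynomial.C (MvPowerSeries.X (R := ℂ) i) * Polynomial.X)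

theorem coeff_omitPoly_eq_zero (j : Fin N) {q : ℕ} (hq : N ≤ q) : (omitPoly j).coeff q = 0 := by
  refine Polynomial.coeff_eq_zero_of_natDegree_lt (lt_of_le_of_lt
    (Polynomial.natDegree_prod_le _ _) ?_)
  have hN : 0 < N := j.pos
  have h1 : ∀ i ∈ univ.erase j, (1 - Polynomial.C (MvPowerSeries.X (R := ℂ) i) *
      Polynomial.X : Polynomial (MvPowerSeries (Fin N) ℂ)).natDegree ≤ 1 := by
    intro i _
    compute_degree
  refine lt_of_le_of_lt (sum_le_sum h1) ?_
  rw [sum_const, card_erase_of_mem (mem_univ j), card_univ, Fintype.card_fin, smul_eq_mul]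
  omega

/-- All factors 1/(1 - x_i t) of H(t) cancel except the one with i = j. -/
theorem mk_hsymmOn_mul_omitPoly (j : Fin N) :
    PowerSeries.mk (hsymmOn (univ : Finset (Fin N))) * (omitPoly j : PowerSeries _) =
      PowerSeries.mk fun m => MvPowerSeries.X (R := ℂ) j ^ m := by
  have h1 : (omitPoly j : PowerSeries (MvPowerSeries (Fin N) ℂ)) = ∏ i ∈ univ.erase j,
      (1 - PowerSeries.C (MvPowerSeries.X (R := ℂ) i) * PowerSeries.X) := by
    rw [omitPoly, ← Polynomial.coeToPowerSeries.ringHom_apply, map_prod]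
    refine prod_congr rfl fun i _ => ?_
    simp
  have h2 := mk_hsymmOn_mul_prod (univ : Finset (Fin N))
  rw [← mul_prod_erase univ _ (mem_univ j), ← h1] at h2
  have h3 : (PowerSeries.mk fun m => MvPowerSeries.X (R := ℂ) j ^ m) *
      (1 - PowerSeries.C (MvPowerSeries.X (R := ℂ) j) * PowerSeries.X) = 1 := by
    ext1 m
    rw [mul_sub, mul_one, mul_left_comm, map_sub, PowerSeries.coeff_C_mul, PowerSeries.coeff_mk,
      PowerSeries.coeff_one]
    rcases m with _ | m
    · rw [PowerSeries.coeff_zero_mul_X]; simp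
    · rw [PowerSeries.coeff_succ_mul_X, PowerSeries.coeff_mk, if_neg (Nat.succ_ne_zero m)]
      ring
  calc _ = PowerSeries.mk (hsymmOn (univ : Finset (Fin N))) * (omitPoly j : PowerSeries _) *
        ((PowerSeries.mk fun m => MvPowerSeries.X (R := ℂ) j ^ m) *
          (1 - PowerSeries.C (MvPowerSeries.X (R := ℂ) j) * PowerSeries.X)) := by
        rw [h3, mul_one]
    _ = (PowerSeries.mk fun m => MvPowerSeries.X (R := ℂ) j ^ m) *
        (PowerSeries.mk (hsymmOn (univ : Finset (Fin N))) *
          ((1 - PowerSeries.C (MvPowerSeries.X (R := ℂ) j) * PowerSeries.X) *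
            (omitPoly j : PowerSeries _))) := by ring
    _ = _ := by rw [h2, mul_one]

theorem X_pow_eq_sum_hsymm (j : Fin N) (m : ℕ) :
    MvPowerSeries.X (R := ℂ) j ^ m = ∑ k : Fin N,
      truncVars N (hsymm ((m : ℤ) - (N - 1) + (k : ℕ))) * (omitPoly j).coeff (N - 1 - k) := by
  have h := congrArg (PowerSeries.coeff m) (mk_hsymmOn_mul_omitPoly j)
  rw [PowerSeries.coeff_mk, mul_comm, PowerSeries.coeff_mul] at h
  rw [← h, Nat.sum_antidiagonal_eq_sum_range_succ_mk]
  simp only [PowerSeries.coeff_mk, Polynomial.coeff_coe]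
  have hN : 0 < N := j.pos
  rw [← Fin.sum_univ_eq_sum_range]
  have h4 : ∑ k : Fin N, truncVars N (hsymm ((m : ℤ) - (N - 1) + (k : ℕ))) *
      (omitPoly j).coeff (N - 1 - k) =
      ∑ q ∈ range N, (omitPoly j).coeff q * truncVars N (hsymm ((m : ℤ) - q)) := by
    rw [← sum_range_reflect, ← Fin.sum_univ_eq_sum_range]
    refine sum_congr rfl fun k _ => ?_
    rw [mul_comm]
    congr 3
    have := k.2
    omega
  have h5 : ∑ q : Fin (m + 1), (omitPoly j).coeff q * hsymmOn univ (m - q) =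
      ∑ q ∈ range (m + 1), (omitPoly j).coeff q * truncVars N (hsymm ((m : ℤ) - q)) := by
    rw [← Fin.sum_univ_eq_sum_range]
    refine sum_congr rfl fun q _ => ?_
    rw [← truncVars_hsymm]
    congr 3
    have := q.2
    omega
  rw [h4, h5]
  -- The two sums are extended to a common range: beyond m the index of h is negative, and beyond N
  -- - 1 the polynomial has no coefficients.
  trans ∑ q ∈ range (m + 1 + N), (omitPoly j).coeff q * truncVars N (hsymm ((m : ℤ) - q))
  · refine sum_subset (range_mono (by omega)) fun q _ hq => ?_
    rw [mem_range, not_lt] at hq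
    rw [hsymm_of_neg (by omega), map_zero, mul_zero]
  · refine (sum_subset (range_mono (by omega)) fun q _ hq => ?_).symm
    rw [mem_range, not_lt] at hq
    rw [coeff_omitPoly_eq_zero j hq, zero_mul]

/-- The bialternant formula, for the Jacobi-Trudi determinant with rows `h_{b_i}, h_{b_i + 1}, …`,
where `b_i = m_i - (N - 1)`. -/
theorem truncVars_jtMatrix_det_mul (m : Fin N → ℕ) :
    truncVars N (jtMatrix fun i => (m i : ℤ) - (N - 1)).det *
        (Matrix.of fun i j : Fin N => MvPowerSeries.X (R := ℂ) j ^ (N - 1 - (i : ℕ))).det =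
      (Matrix.of fun i j : Fin N => MvPowerSeries.X (R := ℂ) j ^ m i).det := by
  set C : Matrix (Fin N) (Fin N) (MvPowerSeries (Fin N) ℂ) :=
    Matrix.of fun k j => (omitPoly j).coeff (N - 1 - k) with hC
  have key : ∀ m : Fin N → ℕ,
      (Matrix.of fun i j : Fin N => MvPowerSeries.X (R := ℂ) j ^ m i).det =
        truncVars N (jtMatrix fun i => (m i : ℤ) - (N - 1)).det * C.det := by
    intro m
    rw [AlgHom.map_det, ← Matrix.det_mul]
    congr 1
    ext1 i j
    rw [Matrix.of_apply, X_pow_eq_sum_hsymm, Matrix.mul_apply]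
    rfl
  -- For the empty partition the Jacobi-Trudi matrix is unitriangular, so det C is the Vandermonde
  -- determinant itself.
  have hone : (jtMatrix fun i : Fin N => ((N - 1 - (i : ℕ) : ℕ) : ℤ) - (N - 1)).det = 1 := by
    rw [Matrix.det_of_isUpperTriangular]
    · refine prod_eq_one fun i _ => ?_
      rw [jtMatrix_apply, show ((N - 1 - (i : ℕ) : ℕ) : ℤ) - (N - 1) + (i : ℕ) = 0 by
        have := i.2; omega, hsymm_zero]
    · intro i j hij
      rw [jtMatrix_apply]
      refine hsymm_of_neg ?_
      have := i.2
      have : (j : ℕ) < i := hij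
      omega
  rw [key m, key fun i => N - 1 - (i : ℕ), hone, map_one, one_mul]

end Bialternant

end

section

open Finset Equiv

/-! ### The permutation characters on colourings -/

theorem exists_content_eq {n : ℕ} {β : Type*} {m : β →₀ ℕ} (hm : m.degree = n) :
    ∃ c : Fin n → β, content c = m := by
  induction n generalizing m with
  | zero =>
    rw [Finsupp.degree_eq_zero_iff] at hm
    exact ⟨Fin.elim0, by simp [content, hm]⟩
  | succ n ih =>
    obtain ⟨b, hb⟩ : ∃ b, m b ≠ 0 := by
      by_contra! h
      rw [Finsupp.ext (g := 0) h] at hm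
      simp at hm
    obtain ⟨m', rfl⟩ := exists_add_of_le (Finsupp.single_le_iff.2 (Nat.one_le_iff_ne_zero.2 hb))
    rw [map_add, Finsupp.degree_single] at hm
    obtain ⟨c, rfl⟩ := ih (m := m') (by omega)
    exact ⟨Fin.cons b c, by simp [content, Fin.sum_univ_succ]⟩

theorem exists_comp_perm_of_content_eq {n : ℕ} {β : Type*} {c c' : Fin n → β}
    (h : content c = content c') : ∃ u : Perm (Fin n), c' ∘ u = c := by
  classical
  have key : ∀ b, Nonempty ({i // c i = b} ≃ {i // c' i = b}) := by
    intro b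
    refine ⟨Fintype.equivOfCardEq ?_⟩
    rw [Fintype.card_subtype, Fintype.card_subtype]
    have := DFunLike.congr_fun h b
    rwa [content_apply, content_apply] at this
  let e := fun b => (key b).some
  refine ⟨(Equiv.sigmaFiberEquiv c).symm.trans
    ((Equiv.sigmaCongrRight e).trans (Equiv.sigmaFiberEquiv c')), ?_⟩
  funext i
  exact (e (c i) ⟨i, rfl⟩).2

/-- Burnside's lemma for the colourings of a given content, which form one orbit. -/
theorem sum_card_fixed_colourings {n : ℕ} {β : Type*} [Fintype β] [DecidableEq β] {m : β →₀ ℕ}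
    (hm : m.degree = n) :
    ∑ w : Perm (Fin n), (univ.filter fun c : Fin n → β => c ∘ w = c ∧ content c = m).card =
      n.factorial := by
  obtain ⟨c₀, hc₀⟩ := exists_content_eq hm
  -- The stabilizer of c is as large as the coset of permutations that take c₀ to c. Summing these
  -- cosets over all c counts each permutation once.
  have h1 : ∀ c : Fin n → β, content c = m →
      (univ.filter fun w : Perm (Fin n) => c ∘ w = c).card =
        (univ.filter fun w : Perm (Fin n) => c₀ ∘ w = c).card := by
    intro c hc
    obtain ⟨u, hu⟩ := exists_comp_perm_of_content_eq (hc.trans hc₀.symm)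
    refine card_equiv (Equiv.mulLeft u) fun w => ?_
    simp only [mem_filter, mem_univ, true_and, Equiv.coe_mulLeft, Perm.coe_mul]
    rw [← Function.comp_assoc, hu]
  simp_rw [card_filter, ite_and]
  rw [sum_comm]
  have h2 : ∀ c : Fin n → β,
      (∑ w : Perm (Fin n), if c ∘ w = c then if content c = m then 1 else 0 else 0) =
        ∑ w : Perm (Fin n), if c₀ ∘ w = c then 1 else 0 := by
    intro c
    by_cases hc : content c = m
    · simp only [hc, if_true]
      rw [← card_filter, ← card_filter, h1 c hc]
    · simp only [hc, if_false, ite_self, sum_const_zero]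
      symm
      refine sum_eq_zero fun w _ => if_neg fun h => hc ?_
      rw [← h, content_comp_perm, hc₀]
  simp_rw [h2]
  rw [sum_comm]
  simp [Fintype.card_perm]

theorem content_fst {n : ℕ} {β γ : Type*} [DecidableEq β] [DecidableEq γ] [Fintype γ]
    (e : Fin n → β × γ) (b : β) :
    content (fun i => (e i).1) b = ((content e).curry b).degree := by
  rw [Finsupp.degree_eq_sum, content_apply]
  simp_rw [Finsupp.curry_apply, content_apply]
  rw [← card_biUnion]
  · congr 1
    ext i
    simp [Prod.ext_iff]
  · intro x _ y _ hxy
    rw [Function.onFun, disjoint_left]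
    intro i hi hi'
    simp only [mem_filter, mem_univ, true_and] at hi hi'
    rw [hi] at hi'
    exact hxy (Prod.ext_iff.1 hi').2

theorem content_snd {n : ℕ} {β γ : Type*} [DecidableEq β] [DecidableEq γ] [Fintype β]
    (e : Fin n → β × γ) :
    content (fun i => (e i).2) = ∑ b, (content e).curry b := by
  ext g
  rw [Finsupp.finsetSum_apply, content_apply]
  simp_rw [Finsupp.curry_apply, content_apply]
  rw [← card_biUnion]
  · congr 1
    ext i
    simp [Prod.ext_iff]
  · intro x _ y _ hxy
    rw [Function.onFun, disjoint_left]
    intro i hi hi'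
    simp only [mem_filter, mem_univ, true_and] at hi hi'
    rw [hi] at hi'
    exact hxy (Prod.ext_iff.1 hi').1

/-- A pair of fixed colourings is one fixed colouring by pairs. Its content is a matrix with row
sums a and column sums b, and by Burnside each such matrix contributes n!. -/
theorem sum_colouringChar_mul {n N M : ℕ} {a : Fin N →₀ ℕ} (ha : a.degree = n)
    (b : Fin M →₀ ℕ) :
    ∑ w : Perm (Fin n), colouringChar a w * colouringChar b w =
      n.factorial * ∑ l ∈ finsuppAntidiag (univ : Finset (Fin N)) b,
        if ∀ i, (l i).degree = a i then (1 : ℂ) else 0 := by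
  have h1 : ∀ w : Perm (Fin n), colouringChar a w * colouringChar b w =
      ((univ.filter fun e : Fin n → Fin N × Fin M => e ∘ w = e ∧
        content (fun i => (e i).1) = a ∧ content (fun i => (e i).2) = b).card : ℂ) := by
    intro w
    rw [colouringChar, colouringChar, ← Nat.cast_mul, ← card_product]
    congr 1
    refine (card_equiv (Equiv.arrowProdEquivProdArrow _ _ _) fun e => ?_).symm
    simp only [mem_filter, mem_univ, true_and, mem_product, Equiv.arrowProdEquivProdArrow,
      Equiv.coe_fn_mk, funext_iff, Function.comp_apply, Prod.ext_iff,
      forall_and]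
    tauto
  have h2 : ∀ w : Perm (Fin n), (univ.filter fun e : Fin n → Fin N × Fin M => e ∘ w = e ∧
        content (fun i => (e i).1) = a ∧ content (fun i => (e i).2) = b).card =
      ∑ l ∈ (finsuppAntidiag (univ : Finset (Fin N)) b).filter fun l => ∀ i, (l i).degree = a i,
        (univ.filter fun e : Fin n → Fin N × Fin M =>
          e ∘ w = e ∧ content e = Finsupp.curryEquiv.symm l).card := by
    intro w
    rw [card_eq_sum_card_fiberwise (f := fun e => (content e).curry)
      (t := (finsuppAntidiag (univ : Finset (Fin N)) b).filter fun l => ∀ i, (l i).degree = a i)]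
    · refine sum_congr rfl fun l hl => ?_
      rw [filter_filter]
      congr 1
      ext e
      simp only [mem_filter, mem_univ, true_and, mem_finsuppAntidiag, subset_univ, and_true] at hl ⊢
      rw [Equiv.eq_symm_apply]
      constructor
      · rintro ⟨⟨h3, h4, h5⟩, h6⟩
        exact ⟨h3, h6⟩
      · rintro ⟨h3, h4⟩
        replace h4 : (content e).curry = l := h4
        refine ⟨⟨h3, ?_, ?_⟩, h4⟩
        · ext i
          rw [content_fst, h4, hl.2]
        · rw [content_snd, h4, hl.1]
    · intro e he
      simp only [coe_filter, mem_univ, true_and, Set.mem_ofPred_eq, mem_finsuppAntidiag,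
        subset_univ, and_true] at he ⊢
      refine ⟨?_, fun i => ?_⟩
      · rw [← content_snd, he.2.2]
      · rw [← content_fst, he.2.1]
  simp_rw [h1, h2]
  rw [← Nat.cast_sum, sum_comm]
  rw [sum_congr rfl fun l hl => sum_card_fixed_colourings (n := n) ?_]
  · rw [sum_const, smul_eq_mul, card_filter]
    push_cast
    rw [mul_comm]
  · simp only [mem_filter, mem_finsuppAntidiag, subset_univ, and_true] at hl
    obtain ⟨m, rfl⟩ := Finsupp.curryEquiv.surjective l
    rw [Equiv.symm_apply_apply, ← ha, Finsupp.degree_eq_sum, Finsupp.degree_eq_sum,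
      Fintype.sum_prod_type]
    refine sum_congr rfl fun i _ => ?_
    rw [← hl.2 i, Finsupp.degree_eq_sum]
    rfl

/-- The coefficient of x^b on either side counts the matrices with row sums a and column sums b. -/
theorem ch_colouringChar {n N : ℕ} {a : Fin N →₀ ℕ} (ha : a.degree = n) :
    ch n (colouringChar a) = ∏ i, hsymm (a i) := by
  refine ext_truncVars fun M => ?_
  ext b
  rw [coeff_truncVars_ch, sum_colouringChar_mul ha, ← mul_assoc, inv_mul_cancel₀, one_mul,
    map_prod, MvPowerSeries.coeff_prod]
  · refine sum_congr rfl fun l _ => ?_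
    simp_rw [coeff_truncVars_hsymm]
    rw [prod_ite_zero]
    simp
  · exact Nat.cast_ne_zero.2 n.factorial_ne_zero

end

section

open Finset Equiv

/-! ### Virtual characters whose Frobenius characteristics are Jacobi-Trudi determinants -/

/-- The permutation character on the colourings of content `a`, where the entries of `a` may be
negative, in which case there are no such colourings. -/
def permChar (n : ℕ) {N : ℕ} (a : Fin N → ℤ) (w : Perm (Fin n)) : ℂ :=
  ((univ.filter fun c : Fin n → Fin N => c ∘ w = c ∧ ∀ i, (content c i : ℤ) = a i).card : ℂ)

theorem permChar_eq_zero {n N : ℕ} {a : Fin N → ℤ} {i : Fin N} (h : a i < 0) :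
    permChar n a = 0 := by
  funext w
  rw [permChar, Pi.zero_apply, Nat.cast_eq_zero, card_eq_zero, filter_eq_empty_iff]
  rintro c - ⟨-, hc⟩
  have := hc i
  omega

theorem permChar_eq_colouringChar {n N : ℕ} (a : Fin N →₀ ℕ) :
    permChar n (fun i => (a i : ℤ)) = colouringChar a := by
  funext w
  rw [permChar, colouringChar]
  simp only [Nat.cast_inj, DFunLike.ext_iff]

theorem exists_neg_or_eq_natCast {N : ℕ} (a : Fin N → ℤ) :
    (∃ i, a i < 0) ∨ ∃ a' : Fin N →₀ ℕ, a = fun i => (a' i : ℤ) := by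
  by_cases h : ∃ i, a i < 0
  · exact Or.inl h
  · push Not at h
    refine Or.inr ⟨Finsupp.equivFunOnFinite.symm fun i => (a i).toNat, funext fun i => ?_⟩
    simp [h i]

theorem ch_permChar {n N : ℕ} {a : Fin N → ℤ} (ha : ∑ i, a i = n) :
    ch n (permChar n a) = ∏ i, hsymm (a i) := by
  rcases exists_neg_or_eq_natCast a with ⟨i, hi⟩ | ⟨a, rfl⟩
  · rw [permChar_eq_zero hi, ch_zero, prod_eq_zero (mem_univ i) (hsymm_of_neg hi)]
  · rw [permChar_eq_colouringChar, ch_colouringChar]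
    rw [Finsupp.degree_eq_sum]
    beta_reduce at ha
    exact_mod_cast ha

theorem comp_inv_eq_iff {n : ℕ} {β : Type*} (c : Fin n → β) (w : Perm (Fin n)) :
    c ∘ ⇑w⁻¹ = c ↔ c ∘ w = c := by
  constructor <;> intro h
  · conv_lhs => rw [← h, Function.comp_assoc, ← Perm.coe_mul, inv_mul_cancel]
    rfl
  · conv_lhs => rw [← h, Function.comp_assoc, ← Perm.coe_mul, mul_inv_cancel]
    rfl

theorem permChar_inv {n N : ℕ} (a : Fin N → ℤ) (w : Perm (Fin n)) :
    permChar n a w⁻¹ = permChar n a w := by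
  simp only [permChar, comp_inv_eq_iff]

theorem permChar_mem_virtualCharacters {n N : ℕ} (a : Fin N → ℤ) :
    permChar n a ∈ virtualCharacters (Perm (Fin n)) := by
  classical
  have hcont : ∀ (w : Perm (Fin n)) {c : Fin n → Fin N}, (∀ i, (content c i : ℤ) = a i) →
      ∀ i, (content (c ∘ w) i : ℤ) = a i := by
    intro w c hc i
    rw [content_comp_perm, hc]
  let X := {c : Fin n → Fin N // ∀ i, (content c i : ℤ) = a i}
  let φ : Perm (Fin n) →* Perm X :=
    { toFun := fun w =>
        { toFun := fun c => ⟨c.1 ∘ ⇑w⁻¹, hcont _ c.2⟩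
          invFun := fun c => ⟨c.1 ∘ ⇑w, hcont _ c.2⟩
          left_inv := fun c => Subtype.ext (funext fun i => by simp)
          right_inv := fun c => Subtype.ext (funext fun i => by simp) }
      map_one' := by ext; simp
      map_mul' := fun v w => by ext; simp }
  convert card_fixed_mem_virtualCharacters φ using 1
  funext w
  rw [permChar, ← Fintype.card_subtype, ← Fintype.card_subtype]
  congr 1
  refine Fintype.card_congr ⟨fun c => ⟨⟨c.1, c.2.2⟩, ?_⟩, fun c => ⟨c.1.1, ?_⟩, ?_, ?_⟩
  · exact Subtype.ext ((comp_inv_eq_iff _ _).2 c.2.1)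
  · exact ⟨(comp_inv_eq_iff _ _).1 (congrArg Subtype.val c.2), c.1.2⟩
  · intro c; rfl
  · intro c; rfl

/-- A permutation and its inverse fix the same colourings, so the bilinear form is the pairing that
computes coefficients. -/
theorem charForm_colouringChar {n N : ℕ} (f : Perm (Fin n) → ℂ) (a : Fin N →₀ ℕ) :
    charForm f (colouringChar a) = MvPowerSeries.coeff a (truncVars N (ch n f)) := by
  rw [coeff_truncVars_ch, charForm, Nat.card_eq_fintype_card, Fintype.card_perm, Fintype.card_fin]
  simp_rw [← permChar_eq_colouringChar, permChar_inv]

/-! ### Jacobi-Trudi characters and their orthonormality -/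

/-- The virtual character whose Frobenius characteristic is the Jacobi-Trudi determinant with rows
`h_{b_i}, h_{b_i + 1}, …`. -/
def jtChar (n : ℕ) {N : ℕ} (b : Fin N → ℤ) : Perm (Fin n) → ℂ :=
  ∑ σ : Perm (Fin N), ((Perm.sign σ : ℤ) : ℂ) • permChar n fun i => b i + (σ i : ℕ)

theorem isClassFunction_of_mem_virtualCharacters {G : Type} [Group G] {f : G → ℂ}
    (hf : f ∈ virtualCharacters G) : IsClassFunction f := by
  obtain ⟨s, a, hs, rfl⟩ := exists_sum_irreducible hf
  refine IsClassFunction.sum fun χ hχ => ?_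
  obtain ⟨d, ρ, -, rfl⟩ := hs χ hχ
  exact IsClassFunction.smul (fun g h => ρ.char_conj g h) _

theorem jtChar_mem_virtualCharacters {n N : ℕ} (b : Fin N → ℤ) :
    jtChar n b ∈ virtualCharacters (Perm (Fin n)) := by
  refine sum_mem fun σ _ => ?_
  rw [Int.cast_smul_eq_zsmul]
  exact zsmul_mem (permChar_mem_virtualCharacters _) _

theorem ch_jtChar {n N : ℕ} {b : Fin N → ℤ} (hb : ∑ i, (b i + (i : ℕ)) = n) :
    ch n (jtChar n b) = (jtMatrix b).det := by
  rw [jtChar, ch_sum, ← Matrix.det_transpose, Matrix.det_apply]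
  refine sum_congr rfl fun σ _ => ?_
  rw [ch_smul, Int.cast_smul_eq_zsmul, ch_permChar]
  · rfl
  · rw [← hb, sum_add_distrib, sum_add_distrib]
    congr 1
    exact Equiv.sum_comp σ fun i : Fin N => ((i : ℕ) : ℤ)

theorem eq_one_of_strictAnti_comp {N : ℕ} {m m' : Fin N → ℕ} (hm : StrictAnti m)
    (hm' : StrictAnti m') {σ : Perm (Fin N)} (h : m ∘ σ = m') : σ = 1 := by
  have hσ : StrictMono σ := fun i j hij => by
    have := hm' hij
    rw [← h] at this
    exact hm.lt_iff_gt.1 this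
  have : hσ.orderIsoOfSurjective σ σ.surjective = OrderIso.refl _ := Subsingleton.elim _ _
  ext1 i
  exact DFunLike.congr_fun this i

/-- Expanding the second character by permutation characters, the form is the coefficient of x^m' in
the first characteristic times the Vandermonde determinant. By the bialternant formula this product
is the alternant of m, whose only strictly decreasing exponent vector is m. -/
theorem charForm_jtChar {n N : ℕ} {m m' : Fin N → ℕ} (hm : StrictAnti m) (hm' : StrictAnti m')
    (hsum : ∑ i, ((m i : ℤ) - (N - 1) + (i : ℕ)) = n) :
    charForm (jtChar n fun i => (m i : ℤ) - (N - 1)) (jtChar n fun i => (m' i : ℤ) - (N - 1)) =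
      if m = m' then 1 else 0 := by
  set f := jtChar n fun i => (m i : ℤ) - (N - 1) with hf
  obtain ⟨s, hs⟩ : ∃ s, s = truncVars N (jtMatrix fun i => (m i : ℤ) - (N - 1)).det := ⟨_, rfl⟩
  have hch : truncVars N (ch n f) = s := by rw [hf, ch_jtChar hsum, hs]
  have hX : ∀ a : Fin N → ℕ, ∏ j, MvPowerSeries.X (R := ℂ) j ^ a j =
      MvPowerSeries.monomial (Finsupp.equivFunOnFinite.symm a) 1 := by
    intro a
    rw [MvPowerSeries.monomial_one_eq, Finsupp.prod_fintype _ _ (fun _ => pow_zero _)]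
    rfl
  have h := congrArg (MvPowerSeries.coeff (Finsupp.equivFunOnFinite.symm m'))
    (truncVars_jtMatrix_det_mul m)
  rw [← hs, Matrix.det_apply, Matrix.det_apply, mul_sum, map_sum, map_sum] at h
  have hR : ∑ σ : Perm (Fin N), MvPowerSeries.coeff (Finsupp.equivFunOnFinite.symm m')
      (Perm.sign σ • ∏ i, (Matrix.of fun i j : Fin N => MvPowerSeries.X (R := ℂ) j ^ m i)
        (σ i) i) = if m = m' then 1 else 0 := by
    have hcoeff : ∀ σ : Perm (Fin N), MvPowerSeries.coeff (Finsupp.equivFunOnFinite.symm m')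
        (Perm.sign σ • ∏ i, (Matrix.of fun i j : Fin N => MvPowerSeries.X (R := ℂ) j ^ m i)
          (σ i) i) = if m ∘ σ = m' then ((Perm.sign σ : ℤ) : ℂ) else 0 := by
      intro σ
      simp only [Matrix.of_apply]
      rw [hX fun i => m (σ i), Units.smul_def, map_zsmul, MvPowerSeries.coeff_monomial,
        zsmul_eq_mul, mul_ite, mul_one, mul_zero]
      exact if_congr ((EmbeddingLike.apply_eq_iff_eq _).trans eq_comm) rfl rfl
    simp_rw [hcoeff]
    rw [sum_eq_single_of_mem 1 (mem_univ _)]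
    · simp
    · intro σ _ hσ
      exact if_neg fun h => hσ (eq_one_of_strictAnti_comp hm hm' h)
  rw [hR] at h
  rw [← h]
  conv_lhs => arg 2; rw [jtChar]
  rw [sum_charForm]
  refine sum_congr rfl fun σ _ => ?_
  simp only [Matrix.of_apply]
  rw [hX fun i => N - 1 - (σ i : ℕ), Units.smul_def, mul_smul_comm, map_zsmul,
    MvPowerSeries.coeff_mul_monomial, mul_one, zsmul_eq_mul]
  congr 1
  split_ifs with hle
  · have ha : (fun i => (m' i : ℤ) - (N - 1) + (σ i : ℕ)) =
        fun i => ((Finsupp.equivFunOnFinite.symm m' - Finsupp.equivFunOnFinite.symm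
          (fun i => N - 1 - (σ i : ℕ)) : Fin N →₀ ℕ) i : ℤ) := by
      funext i
      have h1 : N - 1 - (σ i : ℕ) ≤ m' i := hle i
      have h2 := (σ i).2
      rw [Finsupp.tsub_apply, Finsupp.equivFunOnFinite_symm_apply_apply,
        Finsupp.equivFunOnFinite_symm_apply_apply]
      omega
    rw [ha, permChar_eq_colouringChar, charForm_colouringChar, hch]
  -- A Vandermonde exponent exceeding that of x^m' gives no coefficient; correspondingly the
  -- permutation character has a negative content and vanishes.
  · rw [Finsupp.le_def] at hle
    push Not at hle
    obtain ⟨i, hi⟩ := hle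
    rw [Finsupp.equivFunOnFinite_symm_apply_apply, Finsupp.equivFunOnFinite_symm_apply_apply] at hi
    rw [permChar_eq_zero (i := i) (by omega)]
    simp [charForm]

end

section

open Finset

/-! ### Removing the largest entry of a standard tableau -/

namespace StandardTableau

variable {n : ℕ}

theorem entry_mono (Q : StandardTableau n) {x x' y y' : ℕ} (hx : x' ≤ x) (hy : y' ≤ y)
    (h : (x, y) ∈ Q.shape) : Q.entry x' y' ≤ Q.entry x y := by
  have h1 : Q.entry x' y' ≤ Q.entry x' y := by
    rcases hy.eq_or_lt with rfl | hy
    · exact le_rfl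
    · exact (Q.row_strict _ _ _ hy (Q.shape.up_left_mem hx le_rfl h)).le
  have h2 : Q.entry x' y ≤ Q.entry x y := by
    rcases hx.eq_or_lt with rfl | hx
    · exact le_rfl
    · exact (Q.col_strict _ _ _ hx h).le
  exact h1.trans h2

theorem ext_entry {Q R : StandardTableau n} (h : ∀ x y, Q.entry x y = R.entry x y) : Q = R := by
  have he : Q.entry = R.entry := funext fun x => funext fun y => h x y
  refine StandardTableau.ext (SetLike.ext fun c => ?_) he
  obtain ⟨i, j⟩ := c
  rw [Q.mem_shape_iff, R.mem_shape_iff, he]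

theorem entry_injective (Q : StandardTableau n) {x y x' y' : ℕ} (h : (x, y) ∈ Q.shape)
    (h' : Q.entry x y = Q.entry x' y') : x = x' ∧ y = y' := by
  have hne := (Q.mem_shape_iff x y).1 h
  rw [h', ← Q.mem_shape_iff] at hne
  exact Prod.mk.inj (Q.bijOn.injOn (x₁ := (x, y)) (x₂ := (x', y')) h hne h')

theorem mem_shape_of_entry_eq (Q : StandardTableau n) {x y k : ℕ} (h : Q.entry x y = k)
    (hk : k ≠ 0) : (x, y) ∈ Q.shape := (Q.mem_shape_iff x y).2 (h ▸ hk)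

/-- `Q` arises from `Q'` by adding the entry `n + 1` at the end of row `i`. -/
def IsExtension (Q' : StandardTableau n) (i : ℕ) (Q : StandardTableau (n + 1)) : Prop :=
  Addable Q'.shape.rowLen i ∧
    ∀ x y, Q.entry x y = if x = i ∧ y = Q'.shape.rowLen i then n + 1 else Q'.entry x y

theorem exists_extension (Q' : StandardTableau n) {i : ℕ} (hi : Addable Q'.shape.rowLen i) :
    ∃ Q, IsExtension Q' i Q := by
  classical
  have hnot : (i, Q'.shape.rowLen i) ∉ Q'.shape := by simp [YoungDiagram.mem_iff_lt_rowLen]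
  have hne : ∀ {x y}, (x, y) ∈ Q'.shape → ¬ (x = i ∧ y = Q'.shape.rowLen i) := by
    rintro x y h ⟨rfl, rfl⟩
    exact hnot h
  have hbefore : ∀ x y, x ≤ i → y ≤ Q'.shape.rowLen i → ¬ (x = i ∧ y = Q'.shape.rowLen i) →
      (x, y) ∈ Q'.shape := by
    intro x y hx hy h
    rw [YoungDiagram.mem_iff_lt_rowLen]
    rcases hx.eq_or_lt with rfl | hx
    · have : y ≠ Q'.shape.rowLen x := fun h' => h ⟨rfl, h'⟩
      omega
    · obtain ⟨k, rfl⟩ : ∃ k, i = k + 1 := ⟨i - 1, by omega⟩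
      have h1 := hi k rfl
      have h2 := Q'.shape.rowLen_anti x k (by omega)
      omega
  let E : ℕ → ℕ → ℕ := fun x y =>
    if x = i ∧ y = Q'.shape.rowLen i then n + 1 else Q'.entry x y
  have hEold : ∀ {x y}, (x, y) ∈ Q'.shape → E x y = Q'.entry x y := fun h => if_neg (hne h)
  have hEnew : E i (Q'.shape.rowLen i) = n + 1 := if_pos ⟨rfl, rfl⟩
  let S : YoungDiagram :=
    { cells := insert (i, Q'.shape.rowLen i) Q'.shape.cells
      isLowerSet := by
        rintro ⟨x, y⟩ ⟨x', y'⟩ hle hmem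
        obtain ⟨hx, hy⟩ := Prod.mk_le_mk.1 hle
        simp only [coe_insert, Set.mem_insert_iff, Prod.mk.injEq] at hmem ⊢
        rcases hmem with ⟨rfl, rfl⟩ | hmem
        · by_cases h : x' = x ∧ y' = Q'.shape.rowLen x
          · exact Or.inl h
          · exact Or.inr (hbefore x' y' hx hy h)
        · exact Or.inr (Q'.shape.up_left_mem hx hy hmem) }
  have hS : ∀ {x y}, (x, y) ∈ S ↔ (x = i ∧ y = Q'.shape.rowLen i) ∨ (x, y) ∈ Q'.shape := by
    intro x y
    rw [← YoungDiagram.mem_cells, mem_insert, Prod.mk.injEq]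
    rfl
  refine ⟨⟨S, E, ⟨?_, ?_, ?_⟩, ?_, ?_, ?_⟩, hi, fun x y => rfl⟩
  · rintro ⟨x, y⟩ h
    rcases hS.1 h with ⟨rfl, rfl⟩ | h
    · simp [hEnew]
    · have := Q'.entry_mem h
      simp only [hEold h, Set.mem_Icc]
      omega
  · rintro ⟨x, y⟩ h ⟨x', y'⟩ h' heq
    dsimp only at heq
    rcases hS.1 h with ⟨rfl, rfl⟩ | hm <;> rcases hS.1 h' with ⟨rfl, rfl⟩ | hm'
    · rfl
    · have := Q'.entry_mem hm'
      rw [hEnew, hEold hm'] at heq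
      omega
    · have := Q'.entry_mem hm
      rw [hEnew, hEold hm] at heq
      omega
    · rw [hEold hm, hEold hm'] at heq
      exact Q'.bijOn.injOn hm hm' heq
  · rintro k ⟨hk1, hk2⟩
    rcases hk2.eq_or_lt with rfl | hk2
    · exact ⟨(i, Q'.shape.rowLen i), hS.2 (Or.inl ⟨rfl, rfl⟩), hEnew⟩
    · obtain ⟨⟨x, y⟩, h, h'⟩ := Q'.bijOn.surjOn ⟨hk1, Nat.lt_succ_iff.1 hk2⟩
      exact ⟨(x, y), hS.2 (Or.inr h), (hEold h).trans h'⟩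
  · intro x y₁ y₂ hy h
    rcases hS.1 h with ⟨rfl, rfl⟩ | h
    · have h1 := hbefore x y₁ le_rfl hy.le (by omega)
      have := Q'.entry_mem h1
      rw [hEnew, hEold h1]
      omega
    · rw [hEold h, hEold (Q'.shape.up_left_mem le_rfl hy.le h)]
      exact Q'.row_strict _ _ _ hy h
  · intro x₁ x₂ y hx h
    rcases hS.1 h with ⟨rfl, rfl⟩ | h
    · have h1 := hbefore x₁ (Q'.shape.rowLen x₂) hx.le le_rfl (by omega)
      have := Q'.entry_mem h1
      rw [hEnew, hEold h1]
      omega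
    · rw [hEold h, hEold (Q'.shape.up_left_mem hx.le le_rfl h)]
      exact Q'.col_strict _ _ _ hx h
  · intro x y h
    rw [hS, not_or] at h
    exact (if_neg h.1).trans (Q'.zeros _ _ h.2)

theorem exists_isExtension (Q : StandardTableau (n + 1)) : ∃ Q' i, IsExtension Q' i Q := by
  classical
  obtain ⟨⟨i, j⟩, hij, hval⟩ := Q.bijOn.surjOn (a := n + 1) ⟨by omega, le_rfl⟩
  replace hij : (i, j) ∈ Q.shape := hij
  replace hval : Q.entry i j = n + 1 := hval
  have hlast : ∀ {x y}, (x, y) ∈ Q.shape → (Q.entry x y ≤ n ↔ ¬ (x = i ∧ y = j)) := by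
    intro x y h
    have h1 := Q.entry_mem h
    constructor
    · rintro h2 ⟨rfl, rfl⟩
      omega
    · intro h2
      by_contra h3
      exact h2 (Q.entry_injective h (by omega))
  let S : YoungDiagram :=
    { cells := Q.shape.cells.filter fun c => Q.entry c.1 c.2 ≤ n
      isLowerSet := by
        rintro ⟨x, y⟩ ⟨x', y'⟩ hle hmem
        obtain ⟨hx, hy⟩ := Prod.mk_le_mk.1 hle
        simp only [coe_filter, Set.mem_ofPred_eq, YoungDiagram.mem_cells] at hmem ⊢
        exact ⟨Q.shape.up_left_mem hx hy hmem.1, (Q.entry_mono hx hy hmem.1).trans hmem.2⟩ }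
  have hS : ∀ {x y}, (x, y) ∈ S ↔ (x, y) ∈ Q.shape ∧ ¬ (x = i ∧ y = j) := by
    intro x y
    rw [← YoungDiagram.mem_cells, mem_filter, YoungDiagram.mem_cells]
    exact and_congr_right fun h => hlast h
  let E : ℕ → ℕ → ℕ := fun x y => if x = i ∧ y = j then 0 else Q.entry x y
  have hE : ∀ {x y}, (x, y) ∈ S → E x y = Q.entry x y := fun h => if_neg (hS.1 h).2
  have hrow : S.rowLen i = j := by
    have h1 : (i, j) ∉ S := fun h => (hS.1 h).2 ⟨rfl, rfl⟩
    rw [YoungDiagram.mem_iff_lt_rowLen] at h1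
    by_contra h2
    have h3 : (i, S.rowLen i) ∈ S :=
      hS.2 ⟨Q.shape.up_left_mem le_rfl (not_lt.1 h1) hij, fun h => h2 h.2⟩
    rw [YoungDiagram.mem_iff_lt_rowLen] at h3
    omega
  refine ⟨⟨S, E, ⟨?_, ?_, ?_⟩, ?_, ?_, ?_⟩, i, ?_, ?_⟩
  · rintro ⟨x, y⟩ h
    have h1 := (hS.1 h).1
    have h2 := (hlast h1).2 (hS.1 h).2
    simp only [hE h, Set.mem_Icc]
    exact ⟨(Q.entry_mem h1).1, h2⟩
  · rintro ⟨x, y⟩ h ⟨x', y'⟩ h' heq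
    simp only [hE h, hE h'] at heq
    exact Q.bijOn.injOn (hS.1 h).1 (hS.1 h').1 heq
  · rintro k ⟨hk1, hk2⟩
    obtain ⟨⟨x, y⟩, h, h'⟩ := Q.bijOn.surjOn (a := k) ⟨hk1, hk2.trans (Nat.le_succ n)⟩
    replace h' : Q.entry x y = k := h'
    have hmem : (x, y) ∈ S := hS.2 ⟨h, (hlast h).1 (h' ▸ hk2)⟩
    exact ⟨(x, y), hmem, (hE hmem).trans h'⟩
  · intro x y₁ y₂ hy h
    rw [hE h, hE (S.up_left_mem le_rfl hy.le h)]
    exact Q.row_strict _ _ _ hy (hS.1 h).1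
  · intro x₁ x₂ y hx h
    rw [hE h, hE (S.up_left_mem hx.le le_rfl h)]
    exact Q.col_strict _ _ _ hx (hS.1 h).1
  · intro x y h
    change (if _ then _ else _) = _
    split_ifs with h1
    · rfl
    · exact Q.zeros _ _ fun h2 => h (hS.2 ⟨h2, h1⟩)
  · rintro k rfl
    change S.rowLen (k + 1) < S.rowLen k
    rw [hrow, ← YoungDiagram.mem_iff_lt_rowLen]
    exact hS.2 ⟨Q.shape.up_left_mem (Nat.le_succ k) le_rfl hij, by omega⟩
  · intro x y
    change _ = if x = i ∧ y = S.rowLen i then n + 1 else if x = i ∧ y = j then 0 else Q.entry x y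
    rw [hrow]
    split_ifs with h
    · rw [h.1, h.2, hval]
    · rfl

/-! ### Extensions by one cell -/

namespace IsExtension

variable {Q' R' : StandardTableau n} {i k : ℕ} {Q R : StandardTableau (n + 1)}

theorem eq_of_eq (hQ : IsExtension Q' i Q) (hR : IsExtension Q' i R) : Q = R :=
  ext_entry fun x y => by rw [hQ.2, hR.2]

theorem entry_eq_succ_iff (hQ : IsExtension Q' i Q) {x y : ℕ} :
    Q.entry x y = n + 1 ↔ x = i ∧ y = Q'.shape.rowLen i := by
  rw [hQ.2]
  split_ifs with h
  · simp [h]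
  · have := Q'.entry_le x y
    simp only [h, iff_false]
    omega

theorem entry_eq_iff (hQ : IsExtension Q' i Q) {x y v : ℕ} (hv : v ≠ 0) (hvn : v ≤ n) :
    Q.entry x y = v ↔ Q'.entry x y = v := by
  rw [hQ.2]
  split_ifs with h
  · have h1 : Q'.entry x y = 0 := by
      refine Q'.zeros _ _ fun h2 => ?_
      rw [YoungDiagram.mem_iff_lt_rowLen, h.1, h.2] at h2
      exact lt_irrefl _ h2
    omega
  · rfl

theorem unique (hQ : IsExtension Q' i Q) (hR : IsExtension R' k Q) : Q' = R' ∧ i = k := by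
  refine ⟨ext_entry fun x y => ?_, ?_⟩
  · by_cases h : Q'.entry x y = 0
    · by_contra h1
      have h2 : R'.entry x y ≠ 0 := fun h2 => h1 (h.trans h2.symm)
      have h3 := (hR.entry_eq_iff h2 (R'.entry_le x y)).2 rfl
      rw [hQ.entry_eq_iff h2 (R'.entry_le x y)] at h3
      exact h1 h3
    · have h3 := (hQ.entry_eq_iff h (Q'.entry_le x y)).2 rfl
      rw [hR.entry_eq_iff h (Q'.entry_le x y)] at h3
      exact h3.symm
  · exact (hR.entry_eq_succ_iff.1 (hQ.entry_eq_succ_iff.2 ⟨rfl, rfl⟩)).1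

theorem rowLen_eq (hQ : IsExtension Q' i Q) :
    Q.shape.rowLen = Function.update Q'.shape.rowLen i (Q'.shape.rowLen i + 1) := by
  funext x
  refine eq_of_forall_lt_iff fun y => ?_
  rw [← YoungDiagram.mem_iff_lt_rowLen, Q.mem_shape_iff, hQ.2, Function.update_apply]
  by_cases hx : x = i
  · subst hx
    rw [if_pos rfl]
    split_ifs with h
    · simp [h.2]
    · rw [← Q'.mem_shape_iff, YoungDiagram.mem_iff_lt_rowLen]
      have : y ≠ Q'.shape.rowLen x := fun h' => h ⟨rfl, h'⟩
      omega
  · rw [if_neg hx, if_neg fun h => hx h.1, ← Q'.mem_shape_iff, YoungDiagram.mem_iff_lt_rowLen]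

end IsExtension

theorem rowLen_eq_zero (Q : StandardTableau n) {i : ℕ} (hi : n ≤ i) : Q.shape.rowLen i = 0 := by
  by_contra h
  have h1 : (i, 0) ∈ Q.shape := YoungDiagram.mem_iff_lt_rowLen.2 (Nat.pos_of_ne_zero h)
  have := Q.row_lt_entry i 0 h1
  have := Q.entry_le i 0
  omega

theorem sum_rowLen (Q : StandardTableau n) {N : ℕ} (hN : n ≤ N) :
    ∑ i ∈ range N, Q.shape.rowLen i = n := by
  induction n with
  | zero => exact sum_eq_zero fun i _ => Q.rowLen_eq_zero (Nat.zero_le i)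
  | succ n ih =>
    obtain ⟨Q', i, hQ⟩ := Q.exists_isExtension
    have hi : i ∈ range N := by
      rw [mem_range]
      by_contra hi
      obtain ⟨k, rfl⟩ : ∃ k, i = k + 1 := ⟨i - 1, by omega⟩
      have := hQ.1 k rfl
      rw [Q'.rowLen_eq_zero (i := k) (by omega)] at this
      omega
    have h1 := ih Q' (by omega)
    rw [sum_eq_add_sum_sdiff_singleton_of_mem hi] at h1
    rw [hQ.rowLen_eq, sum_update_of_mem hi]
    omega

instance : Fintype (StandardTableau n) := Fintype.ofFinite _

instance : Unique (StandardTableau 0) where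
  default := ⟨⊥, fun _ _ => 0, by simp, by simp, by simp, by simp⟩
  uniq Q := ext_entry fun x y => Nat.le_zero.1 (Q.entry_le x y)

/-- The tableau obtained by removing the largest entry. -/
def restrict (Q : StandardTableau (n + 1)) : StandardTableau n := Q.exists_isExtension.choose

/-- The row of the largest entry. -/
def lastRow (Q : StandardTableau (n + 1)) : ℕ := Q.exists_isExtension.choose_spec.choose

theorem isExtension_restrict (Q : StandardTableau (n + 1)) :
    IsExtension Q.restrict Q.lastRow Q := Q.exists_isExtension.choose_spec.choose_spec

/-! ### Summing Schur functions by removal of the largest entry -/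

theorem schur_shape (Q : StandardTableau n) {N : ℕ} (hN : n ≤ N) :
    schur Q.shape = jtDet N Q.shape.rowLen := schur_eq_jtDet (Q.rowLen_eq_zero hN)

/-- A tableau is the same as its restriction together with an addable row, and the sum over these
rows is the Pieri rule. The weight G may be anything that does not see the new cell. -/
theorem sum_restrict_mul_schur (G : StandardTableau n → Series) :
    ∑ Q : StandardTableau (n + 1), G Q.restrict * schur Q.shape =
      hsymm 1 * ∑ Q : StandardTableau n, G Q * schur Q.shape := by
  classical
  rw [mul_sum]
  have h1 : ∀ Q : StandardTableau n, hsymm 1 * (G Q * schur Q.shape) =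
      ∑ i ∈ range (n + 1), if Addable Q.shape.rowLen i then
        G Q * jtDet (n + 1) (Function.update Q.shape.rowLen i (Q.shape.rowLen i + 1)) else 0 := by
    intro Q
    rw [mul_left_comm, Q.schur_shape le_rfl,
      pieri (fun i j hij => Q.shape.rowLen_anti i j hij) (Q.rowLen_eq_zero le_rfl), mul_sum]
    refine sum_congr rfl fun i _ => ?_
    rw [mul_ite, mul_zero]
  simp_rw [h1]
  rw [← sum_product', ← sum_filter]
  refine sum_bij (fun Q _ => (Q.restrict, Q.lastRow)) ?_ ?_ ?_ ?_
  · intro Q _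
    simp only [mem_filter, mem_product, mem_univ, true_and, mem_range]
    refine ⟨?_, Q.isExtension_restrict.1⟩
    have h2 := Q.isExtension_restrict.entry_eq_succ_iff.2 ⟨rfl, rfl⟩
    have h3 := Q.row_lt_entry _ _ (Q.mem_shape_of_entry_eq h2 (Nat.succ_ne_zero n))
    omega
  · intro Q _ R _ h
    have hQ := Q.isExtension_restrict
    rw [(Prod.mk.inj h).1, (Prod.mk.inj h).2] at hQ
    exact hQ.eq_of_eq R.isExtension_restrict
  · rintro ⟨Q', i⟩ h
    obtain ⟨Q, hQ⟩ := Q'.exists_extension (mem_filter.1 h).2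
    obtain ⟨h2, h3⟩ := Q.isExtension_restrict.unique hQ
    exact ⟨Q, mem_univ _, Prod.ext h2 h3⟩
  · intro Q _
    rw [Q.schur_shape le_rfl, Q.isExtension_restrict.rowLen_eq]

end StandardTableau

end

section

open Finset Equiv StandardTableau

/-! ### The irreducible characters of the symmetric groups -/

variable {n : ℕ}

theorem sum_schur_shape (n : ℕ) : ∑ Q : StandardTableau n, schur Q.shape = psum 1 ^ n := by
  induction n with
  | zero =>
    rw [Fintype.sum_unique, schur_shape _ le_rfl, pow_zero]
    exact Matrix.det_isEmpty
  | succ n ih =>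
    have h := sum_restrict_mul_schur fun _ : StandardTableau n => 1
    simp only [one_mul] at h
    rw [h, ih, hsymm_one, pow_succ']

theorem cyclePsum_one (n : ℕ) : cyclePsum (1 : Perm (Fin n)) = psum 1 ^ n := by
  rw [cyclePsum, Perm.parts_partition]
  simp

theorem ch_single_one (n : ℕ) :
    ch n (Pi.single 1 (n.factorial : ℂ)) = psum 1 ^ n := by
  rw [ch_eq, sum_eq_single_of_mem 1 (mem_univ _)]
  · rw [Pi.single_eq_same, smul_smul, inv_mul_cancel₀ (Nat.cast_ne_zero.2 n.factorial_ne_zero),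
      one_smul, cyclePsum_one]
  · intro w _ hw
    rw [Pi.single_eq_of_ne hw, zero_smul]

theorem isClassFunction_single_one (n : ℕ) :
    IsClassFunction (Pi.single 1 (n.factorial : ℂ) : Perm (Fin n) → ℂ) := by
  intro g h
  simp only [Pi.single_apply]
  refine if_congr ?_ rfl rfl
  rw [mul_inv_eq_one, mul_eq_left]

/-- The exponents of the bialternant of the shape of a tableau. -/
def bialternantExponent (Q : StandardTableau n) (i : Fin n) : ℕ :=
  Q.shape.rowLen i + (n - 1 - i)

theorem strictAnti_bialternantExponent (Q : StandardTableau n) :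
    StrictAnti (bialternantExponent Q) := by
  intro i j hij
  have h1 := Q.shape.rowLen_anti i j (le_of_lt hij)
  have h2 : (i : ℕ) < j := hij
  have := j.2
  rw [bialternantExponent, bialternantExponent]
  omega

/-- The virtual character with Frobenius characteristic the Schur function of the shape of a
tableau. -/
def shapeChar (Q : StandardTableau n) : Perm (Fin n) → ℂ :=
  jtChar n fun i : Fin n => (bialternantExponent Q i : ℤ) - (n - 1)

theorem bialternantExponent_sub (Q : StandardTableau n) (i : Fin n) :
    (bialternantExponent Q i : ℤ) - (n - 1) = Q.shape.rowLen i - (i : ℕ) := by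
  have := i.2
  rw [bialternantExponent]
  omega

theorem sum_bialternantExponent (Q : StandardTableau n) :
    ∑ i, ((bialternantExponent Q i : ℤ) - (n - 1) + (i : ℕ)) = n := by
  simp_rw [bialternantExponent_sub, sub_add_cancel]
  rw [← Nat.cast_sum, Nat.cast_inj, ← Finset.sum_range Q.shape.rowLen]
  exact Q.sum_rowLen le_rfl

theorem ch_shapeChar (Q : StandardTableau n) : ch n (shapeChar Q) = schur Q.shape := by
  rw [shapeChar, ch_jtChar (sum_bialternantExponent Q), Q.schur_shape le_rfl, jtDet]
  simp_rw [bialternantExponent_sub]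

theorem isClassFunction_shapeChar (Q : StandardTableau n) : IsClassFunction (shapeChar Q) :=
  isClassFunction_of_mem_virtualCharacters (jtChar_mem_virtualCharacters _)

/-- The right side is the regular character, with characteristic p_1^n, and iterating Pieri expands
p_1^n over all tableaux. -/
theorem sum_shapeChar (n : ℕ) :
    ∑ Q : StandardTableau n, shapeChar Q = Pi.single 1 (n.factorial : ℂ) := by
  refine ch_injective (IsClassFunction.sum fun Q _ => isClassFunction_shapeChar Q)
    (isClassFunction_single_one n) ?_
  rw [ch_sum, ch_single_one, ← sum_schur_shape]
  exact sum_congr rfl fun Q _ => ch_shapeChar Q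

/-- The degree is the pairing with the regular character, which orthonormality turns into a number
of tableaux. Since Q itself is counted, the degree is positive. -/
theorem shapeChar_one (Q : StandardTableau n) :
    shapeChar Q 1 = ((univ.filter fun R : StandardTableau n =>
      bialternantExponent Q = bialternantExponent R).card : ℂ) := by
  have h1 : charForm (shapeChar Q) (Pi.single 1 (n.factorial : ℂ)) = shapeChar Q 1 := by
    rw [charForm, sum_eq_single_of_mem 1 (mem_univ _), Nat.card_eq_fintype_card, Fintype.card_perm,
      Fintype.card_fin]
    · rw [inv_one, Pi.single_eq_same, mul_left_comm,
        inv_mul_cancel₀ (Nat.cast_ne_zero.2 n.factorial_ne_zero), mul_one]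
    · intro w _ hw
      rw [Pi.single_eq_of_ne (inv_ne_one.2 hw), mul_zero]
  rw [← h1, ← sum_shapeChar, card_filter, Nat.cast_sum]
  have h2 := sum_charForm univ (fun _ => (1 : ℂ)) (fun R : StandardTableau n => shapeChar R)
    (shapeChar Q)
  simp only [one_smul, one_mul] at h2
  rw [h2]
  refine sum_congr rfl fun R _ => ?_
  rw [shapeChar, shapeChar, charForm_jtChar (strictAnti_bialternantExponent Q)
    (strictAnti_bialternantExponent R) (sum_bialternantExponent Q)]
  push_cast
  rfl

theorem isIrreducibleCharacter_shapeChar (Q : StandardTableau n) :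
    IsIrreducibleCharacter (shapeChar Q) := by
  have hmem : shapeChar Q ∈ virtualCharacters (Perm (Fin n)) := jtChar_mem_virtualCharacters _
  have hQ : Q ∈ univ.filter fun R => bialternantExponent Q = bialternantExponent R := by simp
  refine isIrreducibleCharacter_of_virtual hmem ?_ ⟨_, card_pos.2 ⟨Q, hQ⟩, shapeChar_one Q⟩
  rw [shapeChar, charForm_jtChar (strictAnti_bialternantExponent Q)
    (strictAnti_bialternantExponent Q) (sum_bialternantExponent Q), if_pos rfl]

theorem irreducibleCharacter_spec (Q : StandardTableau n) :
    IsIrreducibleCharacter (irreducibleCharacter n Q.shape) ∧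
      ch n (irreducibleCharacter n Q.shape) = schur Q.shape := by
  have h : ∃ χ : Perm (Fin n) → ℂ, IsIrreducibleCharacter χ ∧ ch n χ = schur Q.shape :=
    ⟨_, isIrreducibleCharacter_shapeChar Q, ch_shapeChar Q⟩
  rw [irreducibleCharacter, dif_pos h]
  exact h.choose_spec

theorem IsIrreducibleCharacter.isClassFunction {G : Type} [Group G] {χ : G → ℂ}
    (h : IsIrreducibleCharacter χ) : IsClassFunction χ := by
  obtain ⟨d, ρ, -, rfl⟩ := h
  exact fun g h => ρ.char_conj g h

/-- A class function is determined by the expansion of its Frobenius characteristic into Schur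
functions. -/
theorem eq_sum_irreducibleCharacter {f : Perm (Fin n) → ℂ} (hf : IsClassFunction f)
    (s : Finset (StandardTableau n)) (h : ch n f = ∑ Q ∈ s, schur Q.shape) :
    f = ∑ Q ∈ s, irreducibleCharacter n Q.shape := by
  refine ch_injective hf (IsClassFunction.sum fun Q _ =>
    (irreducibleCharacter_spec Q).1.isClassFunction) ?_
  rw [h, ch_sum]
  exact sum_congr rfl fun Q _ => (irreducibleCharacter_spec Q).2.symm

end

section

open Finset

namespace StandardTableau

/-! ### First ascents and the removal of the largest entry -/

variable {n m : ℕ}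

theorem firstAscentFrom_mem (Q : StandardTableau n) (hm : m ≤ n) :
    m ≤ Q.firstAscentFrom m ∧ Q.IsAscent (Q.firstAscentFrom m) :=
  Nat.sInf_mem (s := {k | m ≤ k ∧ Q.IsAscent k}) ⟨n, hm, Or.inl rfl⟩

theorem firstAscentFrom_le (Q : StandardTableau n) {k : ℕ} (hm : m ≤ k) (h : Q.IsAscent k) :
    Q.firstAscentFrom m ≤ k :=
  Nat.sInf_le (s := {k | m ≤ k ∧ Q.IsAscent k}) ⟨hm, h⟩

theorem firstAscentFrom_le_size (Q : StandardTableau n) (hm : m ≤ n) : Q.firstAscentFrom m ≤ n :=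
  Q.firstAscentFrom_le hm (Or.inl rfl)

theorem firstAscentFrom_self (Q : StandardTableau n) : Q.firstAscentFrom n = n :=
  le_antisymm (Q.firstAscentFrom_le_size le_rfl) (Q.firstAscentFrom_mem le_rfl).1

namespace IsExtension

variable {Q' : StandardTableau n} {i : ℕ} {Q : StandardTableau (n + 1)}

theorem isAscent_iff (hQ : IsExtension Q' i Q) {k : ℕ} (hk : k < n) :
    Q.IsAscent k ↔ Q'.IsAscent k := by
  have h0 : ¬ (k = n + 1) := by omega
  have h1 : ¬ (k = n) := by omega
  rw [IsAscent, IsAscent]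
  simp only [h0, h1, false_or]
  refine exists_congr fun a => exists_congr fun b => exists_congr fun c => exists_congr fun d => ?_
  rcases Nat.eq_zero_or_pos k with rfl | hpos
  · constructor
    · rintro ⟨h, -, h', -⟩
      exact absurd h' ((Q.mem_shape_iff _ _).1 h)
    · rintro ⟨h, -, h', -⟩
      exact absurd h' ((Q'.mem_shape_iff _ _).1 h)
  · have e1 := hQ.entry_eq_iff (x := a) (y := b) hpos.ne' hk.le
    have e2 := hQ.entry_eq_iff (x := c) (y := d) (Nat.succ_ne_zero k) hk
    constructor
    · rintro ⟨-, -, h1, h2, h3⟩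
      rw [e1] at h1
      rw [e2] at h2
      exact ⟨mem_shape_of_entry_eq _ h1 hpos.ne', mem_shape_of_entry_eq _ h2 (Nat.succ_ne_zero k),
        h1, h2, h3⟩
    · rintro ⟨-, -, h1, h2, h3⟩
      rw [← e1] at h1
      rw [← e2] at h2
      exact ⟨mem_shape_of_entry_eq _ h1 hpos.ne', mem_shape_of_entry_eq _ h2 (Nat.succ_ne_zero k),
        h1, h2, h3⟩

/-- By convention n is an ascent of Q'. In Q this is decided by the row i of the new cell. -/
theorem isAscent_size_iff (hQ : IsExtension Q' i Q) {x y : ℕ} (hxy : (x, y) ∈ Q'.shape)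
    (h : Q'.entry x y = n) : Q.IsAscent n ↔ i ≤ x := by
  have hn : n ≠ 0 := h ▸ (Q'.mem_shape_iff _ _).1 hxy
  have h' : Q.entry x y = n := (hQ.entry_eq_iff hn le_rfl).2 h
  constructor
  · rintro (h1 | ⟨a, b, c, d, h1, -, h2, h3, h4⟩)
    · omega
    · rw [hQ.entry_eq_succ_iff] at h3
      have := (Q.entry_injective h1 (h2.trans h'.symm)).1
      omega
  · intro hi
    have h2 := hQ.entry_eq_succ_iff.2 ⟨rfl, rfl⟩
    exact Or.inr ⟨x, y, i, _, mem_shape_of_entry_eq _ h' hn,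
      mem_shape_of_entry_eq _ h2 (Nat.succ_ne_zero n), h', h2, hi⟩

theorem firstAscentFrom_eq_of_lt (hQ : IsExtension Q' i Q) (hm : m ≤ n)
    (h : Q'.firstAscentFrom m < n) : Q.firstAscentFrom m = Q'.firstAscentFrom m := by
  obtain ⟨h1, h2⟩ := Q'.firstAscentFrom_mem hm
  have h3 := Q.firstAscentFrom_le h1 ((hQ.isAscent_iff h).2 h2)
  obtain ⟨h4, h5⟩ := Q.firstAscentFrom_mem (hm.trans (Nat.le_succ n))
  exact le_antisymm h3 (Q'.firstAscentFrom_le h4 ((hQ.isAscent_iff (by omega)).1 h5))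

/-- The first ascent does not change unless it was and remains at the end. -/
theorem firstAscentFrom_eq (hQ : IsExtension Q' i Q) (hm : m ≤ n) :
    Q.firstAscentFrom m = Q'.firstAscentFrom m ∨
      Q.firstAscentFrom m = n + 1 ∧ Q'.firstAscentFrom m = n := by
  rcases (Q'.firstAscentFrom_le_size hm).lt_or_eq with h | h
  · exact Or.inl (hQ.firstAscentFrom_eq_of_lt hm h)
  · obtain ⟨h1, h2⟩ := Q.firstAscentFrom_mem (hm.trans (Nat.le_succ n))
    have h3 := Q.firstAscentFrom_le_size (hm.trans (Nat.le_succ n))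
    rcases lt_trichotomy (Q.firstAscentFrom m) n with h4 | h4 | h4
    · have := Q'.firstAscentFrom_le h1 ((hQ.isAscent_iff h4).1 h2)
      omega
    · omega
    · omega

/-- The first ascent moves to the end exactly if n stops being an ascent, that is, if the new cell
lies below n. As row x + 1 is empty, the only such place is the start of that row. -/
theorem firstAscentFrom_eq_succ_iff (hQ : IsExtension Q' i Q) (hm : m ≤ n) {x y : ℕ}
    (hxy : (x, y) ∈ Q'.shape) (h : Q'.entry x y = n) (hlast : Q'.shape.rowLen (x + 1) = 0)
    (hasc : Q'.firstAscentFrom m = n) : Q.firstAscentFrom m = n + 1 ↔ i = x + 1 := by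
  have h1 : Q.firstAscentFrom m = n + 1 ↔ ¬ Q.IsAscent n := by
    constructor
    · intro h1 h2
      have := Q.firstAscentFrom_le hm h2
      omega
    · intro h2
      rcases hQ.firstAscentFrom_eq hm with h3 | h3
      · have := (Q.firstAscentFrom_mem (hm.trans (Nat.le_succ n))).2
        rw [h3, hasc] at this
        exact absurd this h2
      · exact h3.1
  rw [h1, hQ.isAscent_size_iff hxy h, not_le]
  refine ⟨fun h2 => ?_, fun h2 => by omega⟩
  by_contra h3
  obtain ⟨k, rfl⟩ : ∃ k, i = k + 1 := ⟨i - 1, by omega⟩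
  have h4 := hQ.1 k rfl
  have h5 := Q'.shape.rowLen_anti (x + 1) k (by omega)
  omega

end IsExtension

/-! ### Tableaux determined by their initial part and first ascent -/

/-- There is a unique tableau with property `P`. The lengths of its rows are given by `r`,
its last row is row `t` or empty, and contains the largest entry. -/
def UniqueTableau (P : StandardTableau n → Prop) (r : ℕ → ℕ) (t : ℕ) : Prop :=
  ∃ Q : StandardTableau n, (∀ R, P R ↔ R = Q) ∧ Q.shape.rowLen = r ∧ r (t + 1) = 0 ∧
    (0 < n → ∃ y, Q.entry t y = n)

theorem UniqueTableau.congr {P P' : StandardTableau n → Prop} {r : ℕ → ℕ} {t : ℕ}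
    (h : UniqueTableau P r t) (hP : ∀ Q, P' Q ↔ P Q) : UniqueTableau P' r t := by
  obtain ⟨Q, h1, h2⟩ := h
  exact ⟨Q, fun R => (hP R).trans (h1 R), h2⟩

theorem uniqueTableau_zero : UniqueTableau (fun _ : StandardTableau 0 => True) (fun _ => 0) 0 :=
  ⟨default, fun R => by simp [Subsingleton.elim R default],
    funext fun i => rowLen_eq_zero _ (Nat.zero_le i), rfl, fun h => absurd h (lt_irrefl 0)⟩

theorem UniqueTableau.extend {P' : StandardTableau n → Prop} {r : ℕ → ℕ} {t : ℕ}
    (h : UniqueTableau P' r t) {P : StandardTableau (n + 1) → Prop} {x : ℕ}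
    (hx : Addable r x) (hx' : r (x + 1) = 0)
    (h1 : ∀ Q' k Q, IsExtension Q' k Q → P Q → P' Q')
    (h2 : ∀ Q' k Q, IsExtension Q' k Q → P' Q' → Q'.shape.rowLen = r → r (t + 1) = 0 →
      (0 < n → ∃ y, Q'.entry t y = n) → (P Q ↔ k = x)) :
    UniqueTableau P (Function.update r x (r x + 1)) x := by
  obtain ⟨Q', hQ', rfl, ht, hn⟩ := h
  obtain ⟨Q, hQ⟩ := Q'.exists_extension hx
  refine ⟨Q, fun R => ⟨fun hR => ?_, ?_⟩, hQ.rowLen_eq, ?_,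
    fun _ => ⟨_, hQ.entry_eq_succ_iff.2 ⟨rfl, rfl⟩⟩⟩
  -- Uniqueness: the restriction of R is forced by `h1`, and then the row of the new cell by `h2`.
  · have hR' := R.isExtension_restrict
    have h3 := h1 _ _ _ hR' hR
    rw [hQ'] at h3
    rw [h3] at hR'
    rw [h2 _ _ _ hR' ((hQ' _).2 rfl) rfl ht hn] at hR
    rw [hR] at hR'
    exact hR'.eq_of_eq hQ
  · rintro rfl
    exact (h2 _ _ _ hQ ((hQ' _).2 rfl) rfl ht hn).2 rfl
  · rw [Function.update_of_ne (Nat.succ_ne_self x), hx']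

open Classical in
theorem UniqueTableau.sum_eq {P : StandardTableau n → Prop} {r : ℕ → ℕ} {t N : ℕ}
    (h : UniqueTableau P r t) (hN : r N = 0) :
    ∑ Q : StandardTableau n, (if P Q then 1 else 0) * schur Q.shape = jtDet N r := by
  obtain ⟨Q, hQ, rfl, -⟩ := h
  rw [sum_eq_single_of_mem Q (mem_univ _), if_pos ((hQ Q).2 rfl), one_mul, schur_eq_jtDet hN]
  intro R _ hR
  rw [if_neg fun h => hR ((hQ R).1 h), zero_mul]

/-- A property of the initial part of size `m`. -/
def IsInitial (m : ℕ) (B : ∀ n, StandardTableau n → Prop) : Prop :=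
  ∀ n, m ≤ n → ∀ (Q' : StandardTableau n) k Q, IsExtension Q' k Q → (B (n + 1) Q ↔ B n Q')

/-- Keeping the first ascent at the end forces every further entry to open a new row, so the tableau
grows by a tail in the first column. -/
theorem UniqueTableau.extend_firstAscentFrom {B : ∀ n, StandardTableau n → Prop}
    (hB : IsInitial m B) (hm : m ≤ n) (hn : 0 < n) {r : ℕ → ℕ} {t : ℕ} (hr : 0 < r t)
    (ht : r (t + 2) = 0)
    (h : UniqueTableau (fun Q : StandardTableau n => B n Q ∧ Q.firstAscentFrom m = n) r t) :
    UniqueTableau (fun Q : StandardTableau (n + 1) => B (n + 1) Q ∧ Q.firstAscentFrom m = n + 1)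
      (Function.update r (t + 1) 1) (t + 1) := by
  have ht1 : r (t + 1) = 0 := h.choose_spec.2.2.1
  have h1 := h.extend (x := t + 1)
    (P := fun Q : StandardTableau (n + 1) => B (n + 1) Q ∧ Q.firstAscentFrom m = n + 1)
    (fun k hk => by
      obtain rfl : k = t := by omega
      rwa [ht1]) ht
    (fun Q' k Q hQ hP => ⟨(hB n hm _ _ _ hQ).1 hP.1, by
      have h2 := Q'.firstAscentFrom_le_size hm
      rcases hQ.firstAscentFrom_eq hm with h3 | h3
      · have := hP.2
        omega
      · exact h3.2⟩)
    (fun Q' k Q hQ hP hrow hlast hent => by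
      obtain ⟨y, hy⟩ := hent hn
      rw [hB n hm _ _ _ hQ, and_iff_right hP.1]
      exact hQ.firstAscentFrom_eq_succ_iff hm (Q'.mem_shape_of_entry_eq hy hn.ne') hy
        (by rw [hrow, hlast]) hP.2)
  rwa [ht1] at h1

end StandardTableau

end

section

open Finset

namespace StandardTableau

/-! ### The tableaux whose first ascent is at the end -/

variable {n m : ℕ}

theorem UniqueTableau.extend_cell {P' : StandardTableau n → Prop} {r : ℕ → ℕ} {t : ℕ}
    (h : UniqueTableau P' r t) {P : StandardTableau (n + 1) → Prop} (x y : ℕ)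
    (hx : Addable r x) (hx' : r (x + 1) = 0) (hy : r x = y)
    (hP : ∀ Q' k Q, IsExtension Q' k Q → (P Q ↔ P' Q' ∧ Q.entry x y = n + 1)) :
    UniqueTableau P (Function.update r x (y + 1)) x := by
  subst hy
  refine h.extend hx hx' (fun Q' k Q hQ h1 => ((hP _ _ _ hQ).1 h1).1) ?_
  rintro Q' k Q hQ hQ' rfl - -
  rw [hP _ _ _ hQ, and_iff_right hQ', hQ.entry_eq_succ_iff]
  constructor
  · exact fun h => h.1.symm
  · rintro rfl
    exact ⟨rfl, rfl⟩

/-- The entries `1, 2` form the tableau `12`. -/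
def StartsRowTwo (Q : StandardTableau n) : Prop := Q.entry 0 0 = 1 ∧ Q.entry 0 1 = 2

/-- The entries `1, 2, 3` form the tableau `123`. -/
def StartsRowThree (Q : StandardTableau n) : Prop := Q.StartsRowTwo ∧ Q.entry 0 2 = 3

/-- The entries `1, 2, 3` form the tableau `12/3`. -/
def StartsHook (Q : StandardTableau n) : Prop := Q.StartsRowTwo ∧ Q.entry 1 0 = 3

/-- The entries `1, 2, 3, 4` form the tableau `123/4`. -/
def StartsThreeOne (Q : StandardTableau n) : Prop := Q.StartsRowThree ∧ Q.entry 1 0 = 4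

/-- The entries `1, 2, 3, 4` form the tableau `12/34`. -/
def StartsTwoTwo (Q : StandardTableau n) : Prop := Q.StartsHook ∧ Q.entry 1 1 = 4

/-- The entries `1, 2, 3, 4` form one of the tableaux `12/3/4` and `124/3`. -/
def StartsFree (Q : StandardTableau n) : Prop :=
  Q.StartsHook ∧ (Q.entry 2 0 = 4 ∨ Q.entry 0 2 = 4)

theorem isInitial_startsRowTwo : IsInitial 2 fun _ Q => Q.StartsRowTwo := by
  intro n hn Q' k Q hQ
  exact and_congr (hQ.entry_eq_iff one_ne_zero (by omega)) (hQ.entry_eq_iff two_ne_zero hn)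

theorem isInitial_startsRowThree : IsInitial 3 fun _ Q => Q.StartsRowThree := by
  intro n hn Q' k Q hQ
  exact and_congr (isInitial_startsRowTwo n (by omega) _ _ _ hQ)
    (hQ.entry_eq_iff three_ne_zero hn)

theorem isInitial_startsHook : IsInitial 3 fun _ Q => Q.StartsHook := by
  intro n hn Q' k Q hQ
  exact and_congr (isInitial_startsRowTwo n (by omega) _ _ _ hQ)
    (hQ.entry_eq_iff three_ne_zero hn)

theorem isInitial_startsThreeOne : IsInitial 4 fun _ Q => Q.StartsThreeOne := by
  intro n hn Q' k Q hQ
  exact and_congr (isInitial_startsRowThree n (by omega) _ _ _ hQ)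
    (hQ.entry_eq_iff four_ne_zero hn)

theorem isInitial_startsTwoTwo : IsInitial 4 fun _ Q => Q.StartsTwoTwo := by
  intro n hn Q' k Q hQ
  exact and_congr (isInitial_startsHook n (by omega) _ _ _ hQ)
    (hQ.entry_eq_iff four_ne_zero hn)

theorem isInitial_startsFree : IsInitial 4 fun _ Q => Q.StartsFree := by
  intro n hn Q' k Q hQ
  exact and_congr (isInitial_startsHook n (by omega) _ _ _ hQ)
    (or_congr (hQ.entry_eq_iff four_ne_zero hn) (hQ.entry_eq_iff four_ne_zero hn))

theorem uniqueTableau_one :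
    UniqueTableau (fun Q : StandardTableau 1 => Q.entry 0 0 = 1) (hookRows 1 1) 0 := by
  convert uniqueTableau_zero.extend_cell (P := fun Q : StandardTableau 1 => Q.entry 0 0 = 1)
    0 0 (fun k hk => by omega) rfl rfl (fun Q' k Q hQ => by simp) using 1
  funext i
  rw [Function.update_apply]
  simp only [hookRows]
  split_ifs <;> omega

theorem uniqueTableau_startsRowTwo :
    UniqueTableau (fun Q : StandardTableau 2 => Q.StartsRowTwo) (hookRows 2 1) 0 := by
  convert uniqueTableau_one.extend_cell (P := fun Q : StandardTableau 2 => Q.StartsRowTwo)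
    0 1 (fun k hk => by omega) rfl rfl (fun Q' k Q hQ => by
      rw [StartsRowTwo, hQ.entry_eq_iff one_ne_zero le_rfl]) using 1
  funext i
  rw [Function.update_apply]
  simp only [hookRows]
  split_ifs <;> omega

theorem uniqueTableau_startsRowThree :
    UniqueTableau (fun Q : StandardTableau 3 => Q.StartsRowThree) (hookRows 3 1) 0 := by
  convert uniqueTableau_startsRowTwo.extend_cell
    (P := fun Q : StandardTableau 3 => Q.StartsRowThree)
    0 2 (fun k hk => by omega) rfl rfl (fun Q' k Q hQ =>
      and_congr (isInitial_startsRowTwo 2 le_rfl _ _ _ hQ) Iff.rfl) using 1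
  funext i
  rw [Function.update_apply]
  simp only [hookRows]
  split_ifs <;> omega

theorem uniqueTableau_startsHook :
    UniqueTableau (fun Q : StandardTableau 3 => Q.StartsHook) (hookRows 2 2) 1 := by
  convert uniqueTableau_startsRowTwo.extend_cell
    (P := fun Q : StandardTableau 3 => Q.StartsHook)
    1 0 (fun k hk => by
      obtain rfl : k = 0 := by omega
      simp [hookRows]) rfl rfl (fun Q' k Q hQ =>
      and_congr (isInitial_startsRowTwo 2 le_rfl _ _ _ hQ) Iff.rfl) using 1
  funext i
  rw [Function.update_apply]
  simp only [hookRows]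
  split_ifs <;> omega

theorem uniqueTableau_startsThreeOne :
    UniqueTableau (fun Q : StandardTableau 4 => Q.StartsThreeOne) (hookRows 3 2) 1 := by
  convert uniqueTableau_startsRowThree.extend_cell
    (P := fun Q : StandardTableau 4 => Q.StartsThreeOne)
    1 0 (fun k hk => by
      obtain rfl : k = 0 := by omega
      simp [hookRows]) rfl rfl (fun Q' k Q hQ =>
      and_congr (isInitial_startsRowThree 3 le_rfl _ _ _ hQ) Iff.rfl) using 1
  funext i
  rw [Function.update_apply]
  simp only [hookRows]
  split_ifs <;> omega

theorem uniqueTableau_startsTwoTwo :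
    UniqueTableau (fun Q : StandardTableau 4 => Q.StartsTwoTwo) (twoTwoRows 0) 1 := by
  convert uniqueTableau_startsHook.extend_cell
    (P := fun Q : StandardTableau 4 => Q.StartsTwoTwo)
    1 1 (fun k hk => by
      obtain rfl : k = 0 := by omega
      simp [hookRows]) rfl rfl (fun Q' k Q hQ =>
      and_congr (isInitial_startsHook 3 le_rfl _ _ _ hQ) Iff.rfl) using 1
  funext i
  rw [Function.update_apply]
  simp only [hookRows, twoTwoRows]
  split_ifs <;> omega

theorem firstAscentFrom_zero_of_size_one (Q : StandardTableau 1) : Q.firstAscentFrom 0 = 1 := by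
  have h1 := Q.firstAscentFrom_le_size (Nat.zero_le 1)
  have h2 := (Q.firstAscentFrom_mem (Nat.zero_le 1)).2
  by_contra h3
  rw [show Q.firstAscentFrom 0 = 0 by omega] at h2
  rcases h2 with h2 | ⟨i, j, -, -, h2, -, h3, -⟩
  · omega
  · exact (Q.mem_shape_iff i j).1 h2 h3

theorem entry_of_size_one (Q : StandardTableau 1) : Q.entry 0 0 = 1 := by
  obtain ⟨Q', i, hQ⟩ := Q.exists_isExtension
  have hrow : ∀ k, Q'.shape.rowLen k = 0 := fun k => Q'.rowLen_eq_zero (Nat.zero_le k)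
  have hi : i = 0 := by
    by_contra hi
    have := hQ.1 (i - 1) (by omega)
    rw [hrow, hrow] at this
    omega
  rw [hQ.2, if_pos ⟨hi.symm, (hrow i).symm⟩]

/-- Without a condition on the initial part, a first ascent at the end means that every entry lies
below its predecessor. -/
theorem uniqueTableau_column (n : ℕ) :
    UniqueTableau (fun Q : StandardTableau (n + 1) => True ∧ Q.firstAscentFrom 0 = n + 1)
      (hookRows 1 (n + 1)) n := by
  induction n with
  | zero =>
    refine uniqueTableau_one.congr fun Q => ?_
    simp [Q.firstAscentFrom_zero_of_size_one, Q.entry_of_size_one]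
  | succ n ih =>
    convert UniqueTableau.extend_firstAscentFrom (B := fun _ _ => True)
      (fun _ _ _ _ _ _ => Iff.rfl) (Nat.zero_le _) (Nat.succ_pos n) ?_ ?_ ih using 1
    · funext i
      rw [Function.update_apply]
      simp only [hookRows]
      split_ifs <;> omega
    · simp [hookRows]
    · simp [hookRows]

theorem uniqueTableau_threeOne (k : ℕ) :
    UniqueTableau
      (fun Q : StandardTableau (k + 4) => Q.StartsThreeOne ∧ Q.firstAscentFrom 4 = k + 4)
      (hookRows 3 (k + 2)) (k + 1) := by
  induction k with
  | zero =>
    refine uniqueTableau_startsThreeOne.congr fun Q => ?_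
    simp [Q.firstAscentFrom_self]
  | succ k ih =>
    convert UniqueTableau.extend_firstAscentFrom isInitial_startsThreeOne (by omega) (by omega)
      ?_ ?_ ih using 1
    · funext i
      rw [Function.update_apply]
      simp only [hookRows]
      split_ifs <;> omega
    · simp [hookRows]
    · simp [hookRows]

theorem uniqueTableau_twoTwo (k : ℕ) :
    UniqueTableau
      (fun Q : StandardTableau (k + 4) => Q.StartsTwoTwo ∧ Q.firstAscentFrom 4 = k + 4)
      (twoTwoRows k) (k + 1) := by
  induction k with
  | zero =>
    refine uniqueTableau_startsTwoTwo.congr fun Q => ?_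
    simp [Q.firstAscentFrom_self]
  | succ k ih =>
    convert UniqueTableau.extend_firstAscentFrom isInitial_startsTwoTwo (by omega) (by omega)
      ?_ ?_ ih using 1
    · funext i
      rw [Function.update_apply]
      simp only [twoTwoRows]
      split_ifs <;> omega
    · simp only [twoTwoRows]
      split_ifs <;> omega
    · simp [twoTwoRows]

end StandardTableau

end

section

open Finset

namespace StandardTableau

/-! ### Whitney-generating tableaux of small and of large size -/

variable {n : ℕ}

theorem entry_ne_of_lt (Q : StandardTableau n) {x y v : ℕ} (hv : n < v) : Q.entry x y ≠ v := by
  have := Q.entry_le x y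
  omega

theorem isWhitneyGenerating_one (Q : StandardTableau 1) : ¬ Q.IsWhitneyGenerating := by
  have h : ∀ x y, Q.entry x y ≠ 2 := fun x y => Q.entry_ne_of_lt (by omega)
  simp [IsWhitneyGenerating, h]

theorem isWhitneyGenerating_two (Q : StandardTableau 2) :
    Q.IsWhitneyGenerating ↔ Q.StartsRowTwo := by
  have h : ∀ x y, Q.entry x y ≠ 3 := fun x y => Q.entry_ne_of_lt (by omega)
  simp [IsWhitneyGenerating, StartsRowTwo, h]

theorem isWhitneyGenerating_three (Q : StandardTableau 3) :
    Q.IsWhitneyGenerating ↔ Q.StartsHook := by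
  have h : ∀ x y, Q.entry x y ≠ 4 := fun x y => Q.entry_ne_of_lt (by omega)
  simp [IsWhitneyGenerating, StartsHook, StartsRowTwo, h, and_assoc]

theorem isWhitneyGenerating_iff (Q : StandardTableau n) (hn : 4 ≤ n) :
    Q.IsWhitneyGenerating ↔ Q.StartsFree ∨ (Q.StartsTwoTwo ∧ Odd (Q.firstAscentFrom 4)) ∨
      (Q.StartsThreeOne ∧ Even (Q.firstAscentFrom 4)) := by
  have h0 : n ≠ 0 := by omega
  have h2 : n ≠ 2 := by omega
  have h3 : n ≠ 3 := by omega
  simp only [IsWhitneyGenerating, StartsFree, StartsTwoTwo, StartsThreeOne, StartsHook,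
    StartsRowThree, StartsRowTwo, h0, h2, h3, false_and, false_or]
  tauto

theorem not_startsHook_of_startsRowThree (Q : StandardTableau n) (h : Q.StartsRowThree) :
    ¬ Q.StartsHook := fun h' => by
  have := Q.entry_injective (Q.mem_shape_of_entry_eq h.2 three_ne_zero) (h.2.trans h'.2.symm)
  omega

theorem not_startsTwoTwo_of_startsFree (Q : StandardTableau n) (h : Q.StartsFree) :
    ¬ Q.StartsTwoTwo := fun h' => by
  rcases h.2 with h1 | h1
  all_goals
    have := Q.entry_injective (Q.mem_shape_of_entry_eq h1 four_ne_zero) (h1.trans h'.2.symm)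
    omega

theorem startsRowTwo_iff (Q : StandardTableau 3) :
    Q.restrict.StartsRowTwo ↔ Q.StartsHook ∨ Q.StartsRowThree := by
  have hQ := Q.isExtension_restrict
  rw [StartsHook, StartsRowThree, ← show Q.StartsRowTwo ↔ Q.restrict.StartsRowTwo from
    isInitial_startsRowTwo 2 le_rfl _ _ _ hQ, ← and_or_left]
  refine (and_iff_left_of_imp fun h => ?_).symm
  obtain ⟨R, hR, hrow, -⟩ := uniqueTableau_startsRowTwo
  rw [(hR _).1 ((isInitial_startsRowTwo 2 le_rfl _ _ _ hQ).1 h)] at hQ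
  have hadd := hQ.1
  have hlast : ∀ x y, Q.entry x y = 3 ↔ _ := fun x y => hQ.entry_eq_succ_iff
  rw [hlast, hlast, hrow]
  rw [hrow] at hadd
  rcases Nat.lt_or_ge Q.lastRow 2 with h1 | h1
  · interval_cases Q.lastRow <;> simp [hookRows]
  · have := hadd (Q.lastRow - 1) (by omega)
    simp only [hookRows] at this
    split_ifs at this <;> omega

/-- The shape (2,1) of 12/3 has three places for the entry 4: two give the free cases, and the third
gives 12/34. -/
theorem startsHook_iff (Q : StandardTableau 4) :
    Q.restrict.StartsHook ↔ Q.StartsFree ∨ Q.StartsTwoTwo := by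
  have hQ := Q.isExtension_restrict
  rw [StartsFree, StartsTwoTwo, ← show Q.StartsHook ↔ Q.restrict.StartsHook from
    isInitial_startsHook 3 le_rfl _ _ _ hQ, ← and_or_left]
  refine (and_iff_left_of_imp fun h => ?_).symm
  obtain ⟨R, hR, hrow, -⟩ := uniqueTableau_startsHook
  rw [(hR _).1 ((isInitial_startsHook 3 le_rfl _ _ _ hQ).1 h)] at hQ
  have hadd := hQ.1
  have hlast : ∀ x y, Q.entry x y = 4 ↔ _ := fun x y => hQ.entry_eq_succ_iff
  rw [hlast, hlast, hlast, hrow]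
  rw [hrow] at hadd
  rcases Nat.lt_or_ge Q.lastRow 3 with h1 | h1
  · interval_cases Q.lastRow <;> simp [hookRows]
  · have := hadd (Q.lastRow - 1) (by omega)
    simp only [hookRows] at this
    split_ifs at this <;> omega

/-! ### Recursions for the sums of Schur functions over the tableaux -/

open Classical in
/-- The indicator function of a proposition. -/
def indicator (p : Prop) : Series := if p then 1 else 0

theorem indicator_congr {p q : Prop} (h : p ↔ q) : indicator p = indicator q := by rw [h]

theorem indicator_pos {p : Prop} (h : p) : indicator p = 1 := if_pos h

theorem indicator_neg {p : Prop} (h : ¬ p) : indicator p = 0 := if_neg h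

theorem indicator_or {p q : Prop} (h : p → ¬ q) :
    indicator (p ∨ q) = indicator p + indicator q := by
  by_cases hp : p
  · rw [indicator_pos hp, indicator_pos (Or.inl hp), indicator_neg (h hp), add_zero]
  · rw [indicator_neg hp, zero_add]
    exact indicator_congr (or_iff_right hp)

theorem indicator_even_succ (n : ℕ) :
    indicator (Even (n + 1)) - indicator (Even n) = (-1) ^ (n + 1) := by
  rcases Nat.even_or_odd n with h | h
  · rw [indicator_pos h, indicator_neg (Nat.not_even_iff_odd.2 h.add_one), h.add_one.neg_one_pow,
      zero_sub]
  · rw [indicator_neg (Nat.not_even_iff_odd.2 h), indicator_pos h.add_one,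
      h.add_one.neg_one_pow, sub_zero]

theorem indicator_odd (n : ℕ) : indicator (Odd n) = 1 - indicator (Even n) := by
  rcases Nat.even_or_odd n with h | h
  · rw [indicator_pos h, indicator_neg (Nat.not_odd_iff_even.2 h), sub_self]
  · rw [indicator_pos h, indicator_neg (Nat.not_even_iff_odd.2 h), sub_zero]

theorem indicator_and (p q : Prop) : indicator (p ∧ q) = indicator p * indicator q := by
  by_cases hp : p
  · rw [indicator_pos hp, one_mul]
    exact indicator_congr (and_iff_right hp)
  · rw [indicator_neg hp, indicator_neg fun h => hp h.1, zero_mul]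

theorem sum_indicator {P : StandardTableau n → Prop} {r : ℕ → ℕ} {t N : ℕ}
    (h : UniqueTableau P r t) (hN : r N = 0) :
    ∑ Q : StandardTableau n, indicator (P Q) * schur Q.shape = jtDet N r := h.sum_eq hN

/-- Adding a cell either keeps the first ascent or moves it from n to n + 1, which flips its parity.
-/
theorem indicator_even_firstAscentFrom {m : ℕ} (hm : m ≤ n) (Q : StandardTableau (n + 1)) :
    indicator (Even (Q.firstAscentFrom m)) - indicator (Even (Q.restrict.firstAscentFrom m)) =
      (-1) ^ (n + 1) * indicator (Q.firstAscentFrom m = n + 1) := by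
  rcases Q.isExtension_restrict.firstAscentFrom_eq hm with h | ⟨h, h'⟩
  · have := Q.restrict.firstAscentFrom_le_size hm
    rw [h, sub_self, indicator_neg (by omega), mul_zero]
  · rw [h', h, indicator_even_succ, indicator_pos rfl, mul_one]

/-- The difference of the indicator functions of the Whitney-generating tableaux and of the
extensions of Whitney-generating tableaux. -/
theorem indicator_isWhitneyGenerating (hn : 3 ≤ n) (Q : StandardTableau (n + 1)) :
    indicator Q.IsWhitneyGenerating - indicator Q.restrict.IsWhitneyGenerating =
      (-1) ^ (n + 1) * (indicator (Q.StartsThreeOne ∧ Q.firstAscentFrom 4 = n + 1) -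
        indicator (Q.StartsTwoTwo ∧ Q.firstAscentFrom 4 = n + 1)) := by
  have hsplit : ∀ {k : ℕ} (R : StandardTableau k), 4 ≤ k → indicator R.IsWhitneyGenerating =
      indicator R.StartsFree + (indicator R.StartsTwoTwo * indicator (Odd (R.firstAscentFrom 4)) +
        indicator R.StartsThreeOne * indicator (Even (R.firstAscentFrom 4))) := by
    intro k R hk
    rw [indicator_congr (R.isWhitneyGenerating_iff hk), indicator_or, indicator_or, indicator_and,
      indicator_and]
    · exact fun h h' => R.not_startsHook_of_startsRowThree h'.1.1 h.1.1
    · rintro h (h' | h')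
      · exact R.not_startsTwoTwo_of_startsFree h h'.1
      · exact R.not_startsHook_of_startsRowThree h'.1.1 h.1
  -- In passing from size 3 to 4 the first ascent from 4 on is 4, so 12/34 is lost and 123/4 is
  -- gained. From size 4 on the free cases cancel, and the parity conditions, odd for 12/34 and even
  -- for 123/4, give opposite signs.
  rcases hn.eq_or_lt with rfl | hn
  · rw [hsplit Q le_rfl, indicator_congr (isWhitneyGenerating_three _),
      indicator_congr Q.startsHook_iff, indicator_or (Q.not_startsTwoTwo_of_startsFree),
      show Q.firstAscentFrom 4 = 4 from Q.firstAscentFrom_self, indicator_and, indicator_and,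
      indicator_pos (p := 4 = 3 + 1) rfl, indicator_odd, indicator_pos (p := Even 4) (by decide)]
    ring
  · have hQ := Q.isExtension_restrict
    rw [hsplit Q (by omega), hsplit Q.restrict hn,
      indicator_congr (isInitial_startsFree n hn _ _ _ hQ),
      indicator_congr (isInitial_startsTwoTwo n hn _ _ _ hQ),
      indicator_congr (isInitial_startsThreeOne n hn _ _ _ hQ), indicator_and, indicator_and,
      indicator_congr (isInitial_startsTwoTwo n hn _ _ _ hQ),
      indicator_congr (isInitial_startsThreeOne n hn _ _ _ hQ), indicator_odd, indicator_odd]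
    linear_combination (indicator Q.restrict.StartsThreeOne - indicator Q.restrict.StartsTwoTwo) *
      indicator_even_firstAscentFrom hn Q

/-- The sum of the Schur functions of the shapes of the desarrangement tableaux of size `n`. -/
def desarrangementSum (n : ℕ) : Series := ∑ Q ∈ desarrangementTableaux n, schur Q.shape

/-- The sum of the Schur functions of the shapes of the Whitney-generating tableaux of size `n`. -/
def whitneySum (n : ℕ) : Series := ∑ Q ∈ whitneyGeneratingTableaux n, schur Q.shape

theorem desarrangementSum_eq (n : ℕ) : desarrangementSum n =
    ∑ Q : StandardTableau n, indicator (Even (Q.firstAscentFrom 0)) * schur Q.shape := by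
  classical
  have : desarrangementTableaux n = univ.filter fun Q => Even (Q.firstAscentFrom 0) := by
    ext Q
    simp [desarrangementTableaux, IsDesarrangement]
  rw [desarrangementSum, this, sum_filter]
  refine sum_congr rfl fun Q _ => ?_
  simp only [indicator, ite_mul, one_mul, zero_mul]

theorem whitneySum_eq (n : ℕ) : whitneySum n =
    ∑ Q : StandardTableau n, indicator Q.IsWhitneyGenerating * schur Q.shape := by
  classical
  have : whitneyGeneratingTableaux n = univ.filter fun Q => Q.IsWhitneyGenerating := by
    ext Q
    simp [whitneyGeneratingTableaux]
  rw [whitneySum, this, sum_filter]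
  refine sum_congr rfl fun Q _ => ?_
  simp only [indicator, ite_mul, one_mul, zero_mul]

theorem desarrangementSum_zero : desarrangementSum 0 = 1 := by
  rw [desarrangementSum_eq, Fintype.sum_unique, firstAscentFrom_self, indicator_pos Even.zero,
    one_mul, schur_shape _ le_rfl]
  exact Matrix.det_isEmpty

/-- Being a desarrangement tableau is inherited in both directions except at the column, whose first
ascent is n + 1. -/
theorem desarrangementSum_succ (n : ℕ) : desarrangementSum (n + 1) =
    hsymm 1 * desarrangementSum n + (-1) ^ (n + 1) * colSchur (n + 1) := by
  rw [desarrangementSum_eq, desarrangementSum_eq, ← sum_restrict_mul_schur, colSchur,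
    ← sum_indicator (uniqueTableau_column n) (by simp [hookRows]), mul_sum, ← sum_add_distrib]
  refine sum_congr rfl fun Q _ => ?_
  rw [indicator_congr (iff_of_eq (true_and _))]
  linear_combination schur Q.shape * indicator_even_firstAscentFrom (Nat.zero_le n) Q

theorem whitneySum_zero : whitneySum 0 = 1 := by
  rw [whitneySum_eq, Fintype.sum_unique,
    indicator_pos (p := IsWhitneyGenerating default) (Or.inl rfl), one_mul, schur_shape _ le_rfl]
  exact Matrix.det_isEmpty

theorem whitneySum_one : whitneySum 1 = 0 := by
  rw [whitneySum_eq]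
  exact sum_eq_zero fun Q _ => by rw [indicator_neg Q.isWhitneyGenerating_one, zero_mul]

theorem whitneySum_two : whitneySum 2 = hsymm 2 := by
  rw [whitneySum_eq]
  simp_rw [indicator_congr (isWhitneyGenerating_two _)]
  rw [sum_indicator (N := 1) uniqueTableau_startsRowTwo (by simp [hookRows]), jtDet,
    Matrix.det_fin_one, jtMatrix_apply]
  simp [hookRows]

theorem whitneySum_three : whitneySum 3 =
    hsymm 1 * whitneySum 2 - jtDet 1 (hookRows 3 1) := by
  rw [whitneySum_eq, whitneySum_eq, ← sum_restrict_mul_schur,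
    ← sum_indicator uniqueTableau_startsRowThree (by simp [hookRows]), ← sum_sub_distrib]
  refine sum_congr rfl fun Q _ => ?_
  rw [indicator_congr (isWhitneyGenerating_three _), indicator_congr (isWhitneyGenerating_two _),
    indicator_congr Q.startsRowTwo_iff,
    indicator_or fun h h' => Q.not_startsHook_of_startsRowThree h' h]
  ring

theorem whitneySum_add_four (k : ℕ) : whitneySum (k + 4) = hsymm 1 * whitneySum (k + 3) +
    (-1) ^ (k + 4) * (jtDet (k + 2) (hookRows 3 (k + 2)) - jtDet (k + 2) (twoTwoRows k)) := by
  rw [whitneySum_eq, whitneySum_eq, ← sum_restrict_mul_schur,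
    ← sum_indicator (uniqueTableau_threeOne k) (by simp [hookRows]),
    ← sum_indicator (uniqueTableau_twoTwo k) (by simp [twoTwoRows]), ← sum_sub_distrib, mul_sum,
    ← sum_add_distrib]
  refine sum_congr rfl fun Q _ => ?_
  linear_combination schur Q.shape * indicator_isWhitneyGenerating (by omega) Q

end StandardTableau

/-! ### Comparison of generating functions -/

open StandardTableau

/-- The generating function of the Schur functions of columns, with signs. -/
def colSeries : PowerSeries Series := PowerSeries.mk fun n => (-1) ^ n * colSchur n

theorem one_sub_mul_desarrangementSum :
    (1 - PowerSeries.C (psum 1) * PowerSeries.X) * PowerSeries.mk desarrangementSum =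
      colSeries := by
  ext1 n
  rw [sub_mul, one_mul, map_sub, mul_assoc, PowerSeries.coeff_C_mul, colSeries,
    PowerSeries.coeff_mk, PowerSeries.coeff_mk, mul_comm PowerSeries.X]
  rcases n with _ | n
  · rw [PowerSeries.coeff_zero_mul_X, desarrangementSum_zero, colSchur_zero]
    ring
  · rw [PowerSeries.coeff_succ_mul_X, PowerSeries.coeff_mk, desarrangementSum_succ, hsymm_one]
    ring

theorem one_sub_mul_whitneySum :
    (1 - PowerSeries.C (psum 1) * PowerSeries.X) * PowerSeries.mk whitneySum =
      (1 + PowerSeries.C (psum 2) * PowerSeries.X ^ 2) * colSeries := by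
  have hone : colSchur 1 = psum 1 := by
    rw [colSchur, jtDet, Matrix.det_fin_one, jtMatrix_apply, ← hsymm_one]
    simp [hookRows]
  ext1 n
  rw [sub_mul, one_mul, map_sub, mul_assoc, PowerSeries.coeff_C_mul, add_mul, one_mul, map_add,
    mul_assoc, PowerSeries.coeff_C_mul, colSeries, PowerSeries.coeff_mk, PowerSeries.coeff_mk,
    mul_comm PowerSeries.X, PowerSeries.coeff_X_pow_mul']
  rcases n with _ | _ | n
  · rw [PowerSeries.coeff_zero_mul_X, whitneySum_zero, colSchur_zero, if_neg (by omega)]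
    ring
  · rw [PowerSeries.coeff_succ_mul_X, PowerSeries.coeff_mk, whitneySum_zero, whitneySum_one,
      if_neg (by omega), zero_add, hone]
    ring
  · rw [PowerSeries.coeff_succ_mul_X, PowerSeries.coeff_mk, if_pos (by omega),
      PowerSeries.coeff_mk, show n + 1 + 1 - 2 = n from rfl, ← hsymm_one]
    -- Sizes 2 and 3 have their own initial tableaux; the recursion by two shapes starts at size 4.
    rcases n with _ | _ | k
    · have h : colSchur 2 = hsymm 1 * colSchur 1 - jtDet 1 (hookRows 2 1) :=
        jtDet_hookRows_succ 1 0
      rw [jtDet_hookRows_one, hone, ← hsymm_one] at h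
      rw [whitneySum_two, whitneySum_one, colSchur_zero, h, psum_two, Nat.cast_two]
      ring
    · have h := colSchur_add_psum_two 0
      simp only [zero_add, sub_zero] at h
      rw [whitneySum_three]
      linear_combination h
    · have h := colSchur_add_psum_two (k + 1)
      dsimp only at h
      rw [whitneySum_add_four]
      linear_combination -(-1) ^ (k + 4) * h

theorem mk_pow_mul_one_sub (x : Series) :
    (PowerSeries.mk fun r => x ^ r) * (1 - PowerSeries.C x * PowerSeries.X) = 1 := by
  ext1 n
  rw [mul_sub, mul_one, mul_left_comm, map_sub, PowerSeries.coeff_C_mul, PowerSeries.coeff_mk,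
    PowerSeries.coeff_one]
  rcases n with _ | n
  · rw [PowerSeries.coeff_zero_mul_X, if_pos rfl]
    ring
  · rw [PowerSeries.coeff_succ_mul_X, PowerSeries.coeff_mk, if_neg (Nat.succ_ne_zero n)]
    ring

/-- Multiply H(t) · Lie(t) = 1/(1 - p_1 t) by the inverse E(-t) of H(t), and the recursion for the
tableaux by the inverse of 1 - p_1 t: both series become E(-t)/(1 - p_1 t). -/
theorem lieHatSeries_eq : lieHatSeries = PowerSeries.mk desarrangementSum := by
  have h : colSeries * (PowerSeries.mk fun m => hsymm (m : ℕ)) = 1 := colSchur_series_mul_hsymm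
  linear_combination -lieHatSeries * h +
    colSeries * hsymm_mul_lieHatSeries +
    (PowerSeries.mk desarrangementSum) * mk_pow_mul_one_sub (psum 1) -
    (PowerSeries.mk fun r => psum 1 ^ r) * one_sub_mul_desarrangementSum

theorem whitneyHatSeries_eq : whitneyHatSeries = PowerSeries.mk whitneySum := by
  have h : colSeries * (PowerSeries.mk fun m => hsymm (m : ℕ)) = 1 := colSchur_series_mul_hsymm
  linear_combination -whitneyHatSeries * h +
    colSeries * hsymm_mul_whitneyHatSeries +
    (PowerSeries.mk whitneySum) * mk_pow_mul_one_sub (psum 1) -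
    (PowerSeries.mk fun r => psum 1 ^ r) * one_sub_mul_whitneySum

theorem ch_lieHat (n : ℕ) : ch n (lieHat n) = ∑ Q ∈ desarrangementTableaux n, schur Q.shape := by
  have h := congrArg (PowerSeries.coeff n) lieHatSeries_eq
  rwa [lieHatSeries, PowerSeries.coeff_mk, PowerSeries.coeff_mk] at h

theorem ch_whitneyHat (n : ℕ) :
    ch n (whitneyHat n) = ∑ Q ∈ whitneyGeneratingTableaux n, schur Q.shape := by
  have h := congrArg (PowerSeries.coeff n) whitneyHatSeries_eq
  rwa [whitneyHatSeries, PowerSeries.coeff_mk, PowerSeries.coeff_mk] at h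

end

end WhitneyTableaux

end

/-! ### The two decompositions -/

theorem theorem1p3 (n : ℕ) :
    WhitneyTableaux.lieHat n =
        ∑ Q ∈ WhitneyTableaux.desarrangementTableaux n,
          WhitneyTableaux.irreducibleCharacter n Q.shape ∧
      WhitneyTableaux.whitneyHat n =
        ∑ Q ∈ WhitneyTableaux.whitneyGeneratingTableaux n,
          WhitneyTableaux.irreducibleCharacter n Q.shape :=
  ⟨WhitneyTableaux.eq_sum_irreducibleCharacter (WhitneyTableaux.isClassFunction_lieHat n) _
      (WhitneyTableaux.ch_lieHat n),
    WhitneyTableaux.eq_sum_irreducibleCharacter (WhitneyTableaux.isClassFunction_whitneyHat n) _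
      (WhitneyTableaux.ch_whitneyHat n)⟩
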